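/- **Theorem (Analytic absoluteness).** All topological spaces are $T_0$. Let $M$ (a set or a proper class) be a transitive model of $\mathsf{ZFC}$. *Spaces.* If $M\models\langle X,\tau\rangle$ is a topological space, a *preinterpretation* of it over $M$ is a topological space $\hat X$ with maps $\pi\colon X\to\hat X$ and $\pi\colon\tau\to\{\text{open subsets of }\hat X\}$ such that $x\in O\Leftrightarrow\pi(x)\in\pi(O)$; $\pi(O\cap P)=\pi(O)\cap\pi(P)$; $\pi(\bigcup C)=\bigcup_{O\in C}\pi(O)$ for every $C\subseteq\tau$ with $C\in M$; $\pi(\emptyset)=\emptyset$ and $\pi(X)=\hat X$; and $\pi''\tau$ is a basis of $\hat X$. An *interpretation* is a largest preinterpretation $\pi\colon X\to\hat X$: for every preinterpretation $\pi'\colon X\to\hat X'$ there is $h\colon\hat X'\to\hat X$ with $\pi=h\circ\pi'$ on $X$ and $h^{-1}\pi(O)=\pi'(O)$ for all $O\in\tau$. A space is *interpretable* if it is regular Hausdorff and a continuous open image of a Čech complete space, i.e. of a $G_\delta$ subspace of a compact Hausdorff space. *Structures.* Let $M\models\mathfrak X=\langle X_i, R_j, f_k : i\in I, j\in J, k\in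 K\rangle$ be an interpretable structure: in $M$, each $X_i$ is an interpretable space, each $R_j$ is a Borel subset of a finite product of the spaces $X_i$, and each $f_k$ is a partial continuous function from a finite product of the spaces $X_i$ to one of them, whose domain is closed or $G_\delta$. For a finite product $X=\prod_m X_{i_m}$ formed in $M$, $\hat X=\prod_m\hat X_{i_m}$ and $\pi=\prod_m\pi_{i_m}$, put $\pi(O)=\hat X\setminus\mathrm{cl}(\pi''(X\setminus O))$ for $O\in M$ open in $X$, and extend $\pi$ to the Borel sets of $M$ so that it commutes with complements and with countable unions and intersections in $M$. An *interpretation* $\pi\colon\mathfrak X\to\hat{\mathfrak X}$ consists of interpretations $\pi_i\colon X_i\to\hat X_i$ and a structure $\hat{\mathfrak X}=\langle\hat X_i,\hat R_j,\hat f_k\rangle$ of the same signature such that $\hat R_j=\pi(R_j)$, and $\hat f_k$ is a continuous function with domain $\pi(\mathrm{dom} f_k)$ such that $\hat f_k(\pi(\vec x))=\pi(f_k(\vec x))$ for all $\vec x\in\mathrm{dom} f_k$. *Claim.* If $\pi\colon\mathfrak X\to\hat{\mathfrak X}$ is an interpretation, then $\pi$ is a $\Sigma_1$-elementary embedding: for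 every quantifier-free formula $\psi(\vec x,\vec y)$ of the many-sorted language of $\mathfrak X$ with equality, where an atomic formula is true only if all of its terms are defined, and for all $\vec x$ in $\mathfrak X$, $$\mathfrak X\models\exists\vec y\,\psi(\vec x,\vec y)\iff\hat{\mathfrak X}\models\exists\vec y\,\psi(\pi(\vec x),\vec y).$$ -/

import Mathlib

open Set

universe u v w w₁ w₂ w₃

namespace AnalyticAbs

/-! ### Transitive models of set theory inside the universe `ZFSet` -/

/-- The language of set theory: a single binary relation symbol. -/
inductive MemRel : ℕ → Type
  | mem : MemRel 2

/-- The first-order language `{∈}`. -/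
def setLang : FirstOrder.Language := ⟨fun _ => Empty, MemRel⟩

/-- A binary relation regarded as a structure for the language `{∈}`. -/
@[reducible]
def setStructure {α : Type v} (E : α → α → Prop) : setLang.Structure α where
  funMap := fun f _ => nomatch f
  RelMap := fun {_} r => match r with
    | .mem => fun x => E (x 0) (x 1)

/-- Satisfaction in `(α, E)` of a formula of the language `{∈}` with free variables indexed
by `Fin n`. -/
def Sat {α : Type v} (E : α → α → Prop) {n : ℕ} (φ : setLang.Formula (Fin n)) (p : Fin n → α) :
    Prop :=
  letI := setStructure E
  φ.Realize p

/-- `(α, E)` is a model of ZFC; separation and replacement are the first-order schemata, for all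
formulas with finitely many parameters. -/
structure ModelsZFC {α : Type v} (E : α → α → Prop) : Prop where
  extensionality : ∀ x y, (∀ z, E z x ↔ E z y) → x = y
  foundation : ∀ x, (∃ y, E y x) → ∃ y, E y x ∧ ∀ z, E z y → ¬ E z x
  pairing : ∀ x y, ∃ z, ∀ t, E t z ↔ t = x ∨ t = y
  union : ∀ x, ∃ z, ∀ t, E t z ↔ ∃ y, E y x ∧ E t y
  powerset : ∀ x, ∃ z, ∀ t, E t z ↔ ∀ s, E s t → E s x
  infinity : ∃ z, (∃ e, (∀ t, ¬ E t e) ∧ E e z) ∧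
    ∀ x, E x z → ∃ y, E y z ∧ ∀ t, E t y ↔ E t x ∨ t = x
  separation : ∀ (n : ℕ) (φ : setLang.Formula (Fin (n + 1))) (p : Fin n → α) (a : α),
    ∃ b, ∀ x, E x b ↔ E x a ∧ Sat E φ (Fin.cons x p)
  replacement : ∀ (n : ℕ) (φ : setLang.Formula (Fin (n + 1 + 1))) (p : Fin n → α) (a : α),
    (∀ x, E x a → ∃! y, Sat E φ (Fin.cons x (Fin.cons y p))) →
    ∃ b, ∀ y, E y b ↔ ∃ x, E x a ∧ Sat E φ (Fin.cons x (Fin.cons y p))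
  choice : ∀ a, (∀ x, E x a → ∃ t, E t x) →
    (∀ x y, E x a → E y a → x ≠ y → ∀ t, E t x → ¬ E t y) →
    ∃ c, ∀ x, E x a → ∃! t, E t x ∧ E t c

/-- `M`, a set or a proper class, is a transitive model of ZFC with the true membership. -/
structure IsTransitiveModel (M : Set ZFSet.{u}) : Prop where
  transitive : ∀ x ∈ M, ∀ y ∈ x, y ∈ M
  zfc : ModelsZFC (fun x y : M => (x : ZFSet.{u}) ∈ (y : ZFSet.{u}))

/-! ### Finite tuples and infinite sequences as sets -/

/-- The points of the set `X`. -/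
abbrev Pt (X : ZFSet.{u}) : Type (u + 1) := {x : ZFSet.{u} // x ∈ X}

/-- The von Neumann natural number `n`. -/
noncomputable def natSet : ℕ → ZFSet.{u}
  | 0 => ∅
  | n + 1 => insert (natSet n) (natSet n)

/-- The sequence `⟨s n : n ∈ ω⟩`, as a function on `ω` (a set of ordered pairs), belongs to `M`. -/
def SeqIn (M : Set ZFSet.{u}) (s : ℕ → ZFSet.{u}) : Prop :=
  ZFSet.range (fun n : ℕ => ZFSet.pair (natSet n) (s n)) ∈ M

/-- The finite tuple `(a 0, (a 1, (…, ∅)))` built from ordered pairs. -/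
noncomputable def tuple : {n : ℕ} → (Fin n → ZFSet.{u}) → ZFSet.{u}
  | 0, _ => ∅
  | _ + 1, a => ZFSet.pair (a 0) (tuple (fun k => a k.succ))

/-- The product `X 0 × X 1 × …`, the set of all tuples `tuple a` with `a k ∈ X k`. -/
noncomputable def prodSet : {n : ℕ} → (Fin n → ZFSet.{u}) → ZFSet.{u}
  | 0, _ => {∅}
  | _ + 1, X => (X 0).prod (prodSet (fun k => X k.succ))

/-- The tuple of a family of points. -/
noncomputable def ptTuple {n : ℕ} {X : Fin n → ZFSet.{u}} (a : ∀ k, Pt (X k)) : ZFSet.{u} :=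
  tuple (fun k => (a k : ZFSet.{u}))

/-! ### Topology relativized to `M`

Each predicate below says that `M` satisfies the usual statement: quantifiers over families of
sets, over sequences, over functions and over spaces range over elements of `M`. -/

/-- `M ⊨ τ` is a topology on `X`. -/
structure IsTopologyIn (M : Set ZFSet.{u}) (X τ : ZFSet.{u}) : Prop where
  space_mem : X ∈ M
  top_mem : τ ∈ M
  subset : ∀ O ∈ τ, O ⊆ X
  empty : ∅ ∈ τ
  whole : X ∈ τ
  inter : ∀ O ∈ τ, ∀ P ∈ τ, O ∩ P ∈ τ
  sUnion : ∀ C ∈ M, C ⊆ τ → ZFSet.sUnion C ∈ τ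

/-- Distinct points have disjoint open neighborhoods. -/
def IsHausdorff (X τ : ZFSet.{u}) : Prop :=
  ∀ x ∈ X, ∀ y ∈ X, x ≠ y → ∃ O ∈ τ, ∃ P ∈ τ, x ∈ O ∧ y ∈ P ∧ O ∩ P = ∅

/-- `C` is closed. -/
def IsClosedSet (X τ C : ZFSet.{u}) : Prop :=
  C ⊆ X ∧ X \ C ∈ τ

/-- A point and a closed set not containing it have disjoint open neighborhoods. Closed sets are
complements of elements of `τ`, so they belong to any transitive model containing the space. -/
def IsRegular (X τ : ZFSet.{u}) : Prop :=
  ∀ C, IsClosedSet X τ C → ∀ x ∈ X, x ∉ C →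
    ∃ O ∈ τ, ∃ P ∈ τ, x ∈ O ∧ C ⊆ P ∧ O ∩ P = ∅

/-- `M ⊨` every open cover of `X` has a finite subcover. (Finite sets are the same in `M` and in
the universe.) -/
def IsCompactIn (M : Set ZFSet.{u}) (X τ : ZFSet.{u}) : Prop :=
  ∀ C ∈ M, C ⊆ τ → ZFSet.sUnion C = X →
    ∃ F ∈ M, F ⊆ C ∧ {O | O ∈ F}.Finite ∧ ZFSet.sUnion F = X

/-- `M ⊨ Y` is a `G_δ` subset of `X`: the intersection of a sequence of open sets. -/
def IsGdeltaIn (M : Set ZFSet.{u}) (X τ Y : ZFSet.{u}) : Prop :=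
  Y ⊆ X ∧ ∃ s : ℕ → ZFSet.{u}, SeqIn M s ∧ (∀ n, s n ∈ τ) ∧
    ∀ x ∈ X, x ∈ Y ↔ ∀ n, x ∈ s n

/-- `M ⊨ (Y, σ)` is a `G_δ` subspace of a compact Hausdorff space. -/
def IsCechCompleteIn (M : Set ZFSet.{u}) (Y σ : ZFSet.{u}) : Prop :=
  ∃ Z ζ, IsTopologyIn M Z ζ ∧ IsHausdorff Z ζ ∧ IsCompactIn M Z ζ ∧ IsGdeltaIn M Z ζ Y ∧
    ∀ O, O ∈ σ ↔ ∃ P ∈ ζ, O = P ∩ Y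

/-- `M ⊨ f` is a continuous open map of `Y` onto `X`. -/
structure IsOpenContinuousOntoIn (M : Set ZFSet.{u}) (Y σ X τ f : ZFSet.{u}) : Prop where
  mem : f ∈ M
  isFunc : ZFSet.IsFunc Y X f
  onto : ∀ x ∈ X, ∃ y ∈ Y, ZFSet.pair y x ∈ f
  continuous : ∀ O ∈ τ, Y.sep (fun y => ∃ x ∈ O, ZFSet.pair y x ∈ f) ∈ σ
  isOpen : ∀ O ∈ σ, X.sep (fun x => ∃ y ∈ O, ZFSet.pair y x ∈ f) ∈ τ

/-- `M ⊨ (X, τ)` is an interpretable space: regular Hausdorff, and a continuous open image of a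
Čech complete space. -/
structure IsInterpretableSpaceIn (M : Set ZFSet.{u}) (X τ : ZFSet.{u}) : Prop where
  isTopology : IsTopologyIn M X τ
  regular : IsRegular X τ
  hausdorff : IsHausdorff X τ
  image : ∃ Y σ f, IsTopologyIn M Y σ ∧ IsCechCompleteIn M Y σ ∧
    IsOpenContinuousOntoIn M Y σ X τ f

/-- The product topology as computed in `M`: all `W ∈ M` that are unions of open boxes. -/
noncomputable def prodTop (M : Set ZFSet.{u}) {n : ℕ} (X τ : Fin n → ZFSet.{u}) : ZFSet.{u} :=
  (ZFSet.powerset (prodSet X)).sep (fun W => W ∈ M ∧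
    ∀ a : Fin n → ZFSet.{u}, tuple a ∈ W → ∃ O : Fin n → ZFSet.{u},
      (∀ k, O k ∈ τ k ∧ a k ∈ O k) ∧ prodSet O ⊆ W)

/-- `M ⊨ 𝓑` is a σ-algebra of subsets of `X`. -/
structure IsSigmaAlgebraIn (M : Set ZFSet.{u}) (X 𝓑 : ZFSet.{u}) : Prop where
  mem : 𝓑 ∈ M
  subset : ∀ B ∈ 𝓑, B ⊆ X
  empty : ∅ ∈ 𝓑
  compl : ∀ B ∈ 𝓑, X \ B ∈ 𝓑
  iUnion : ∀ s : ℕ → ZFSet.{u}, SeqIn M s → (∀ n, s n ∈ 𝓑) → ZFSet.iUnion s ∈ 𝓑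

/-- `M ⊨ B` is a Borel subset of `X`: it belongs to every σ-algebra containing the open sets. -/
def IsBorelIn (M : Set ZFSet.{u}) (X τ B : ZFSet.{u}) : Prop :=
  B ∈ M ∧ B ⊆ X ∧ ∀ 𝓑, IsSigmaAlgebraIn M X 𝓑 → τ ⊆ 𝓑 → B ∈ 𝓑

/-! ### Interpretations of spaces -/

/-- `π = (pt, op)` is a topological preinterpretation over `M` of the space `(X, τ)` of `M`.
Only the values of `op` at elements of `τ` matter. All spaces are `T₀`. -/
structure IsPreinterpretation (M : Set ZFSet.{u}) (X τ : ZFSet.{u}) (Xhat : Type u)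
    [TopologicalSpace Xhat] (pt : Pt X → Xhat) (op : ZFSet.{u} → Set Xhat) : Prop where
  t0 : T0Space Xhat
  mem_iff : ∀ x : Pt X, ∀ O ∈ τ, (x : ZFSet.{u}) ∈ O ↔ pt x ∈ op O
  inter : ∀ O ∈ τ, ∀ P ∈ τ, op (O ∩ P) = op O ∩ op P
  sUnion : ∀ C ∈ M, C ⊆ τ → op (ZFSet.sUnion C) = ⋃ O ∈ C, op O
  empty : op ∅ = ∅
  whole : op X = univ
  basis : TopologicalSpace.IsTopologicalBasis {U | ∃ O ∈ τ, op O = U}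

/-- `π = (pt, op)` is an interpretation over `M` of `(X, τ)`: a largest preinterpretation, that is,
every preinterpretation reduces to it. -/
structure IsInterpretation (M : Set ZFSet.{u}) (X τ : ZFSet.{u}) (Xhat : Type u)
    [TopologicalSpace Xhat] (pt : Pt X → Xhat) (op : ZFSet.{u} → Set Xhat) : Prop where
  isPreinterpretation : IsPreinterpretation M X τ Xhat pt op
  largest : ∀ (Y : Type u) [TopologicalSpace Y] (pt' : Pt X → Y) (op' : ZFSet.{u} → Set Y),
    IsPreinterpretation M X τ Y pt' op' →
    ∃ h : Y → Xhat, (∀ x, pt x = h (pt' x)) ∧ ∀ O ∈ τ, h ⁻¹' (op O) = op' O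

/-- The action on open sets of the product of the maps `π k : X k → Xhat k`: the canonical
extension `W ↦ X̂ \ cl(π''(X \ W))` of the product map, where `X = ∏ X k` and `X̂ = ∏ X̂ k`. -/
def prodOpen {n : ℕ} {X : Fin n → ZFSet.{u}} {Xhat : Fin n → Type u}
    [∀ k, TopologicalSpace (Xhat k)] (pt : ∀ k, Pt (X k) → Xhat k) (W : ZFSet.{u}) :
    Set (∀ k, Xhat k) :=
  (closure {b | ∃ a : ∀ k, Pt (X k), ptTuple a ∉ W ∧ b = fun k => pt k (a k)})ᶜ

/-- `BorelImage M τ pt B B'` says that the Borel subset `B` of the product `∏ X k` in `M` is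
interpreted as `B' ⊆ ∏ Xhat k`. This is the graph of the extension of the product map from open
sets to Borel sets that commutes with complements and with countable unions (hence also with
countable intersections) in `M`, as the least relation with these closure properties. -/
inductive BorelImage (M : Set ZFSet.{u}) {n : ℕ} {X : Fin n → ZFSet.{u}} (τ : Fin n → ZFSet.{u})
    {Xhat : Fin n → Type u} [∀ k, TopologicalSpace (Xhat k)] (pt : ∀ k, Pt (X k) → Xhat k) :
    ZFSet.{u} → Set (∀ k, Xhat k) → Prop
  | ofOpen (W : ZFSet.{u}) (hW : W ∈ prodTop M X τ) : BorelImage M τ pt W (prodOpen pt W)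
  | compl (B : ZFSet.{u}) (B' : Set (∀ k, Xhat k)) (hB : BorelImage M τ pt B B') :
      BorelImage M τ pt (prodSet X \ B) B'ᶜ
  | iUnion (s : ℕ → ZFSet.{u}) (s' : ℕ → Set (∀ k, Xhat k)) (hs : SeqIn M s)
      (h : ∀ i, BorelImage M τ pt (s i) (s' i)) :
      BorelImage M τ pt (ZFSet.iUnion s) (⋃ i, s' i)

/-! ### Many-sorted structures with relations and partial functions -/

/-- A many-sorted signature with finitary relation and function symbols. -/
structure Signature where
  Srt : Type w₁
  Rel : Type w₂
  Fn : Type w₃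
  relArity : Rel → ℕ
  relDom : ∀ j, Fin (relArity j) → Srt
  fnArity : Fn → ℕ
  fnDom : ∀ k, Fin (fnArity k) → Srt
  fnCod : Fn → Srt

/-- A structure with carriers `A i`; function symbols denote partial functions. -/
structure PartialStructure (S : Signature.{w₁, w₂, w₃}) (A : S.Srt → Type v) where
  rel : ∀ j, Set (∀ m, A (S.relDom j m))
  fn : ∀ k, (∀ m, A (S.fnDom k m)) →. A (S.fnCod k)

/-- Terms of sort `i` in variables `x : V` of sorts `Γ x`. -/
inductive Term (S : Signature.{w₁, w₂, w₃}) {V : Type} (Γ : V → S.Srt) :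
    S.Srt → Type (max w₁ w₃)
  | var (x : V) : Term S Γ (Γ x)
  | app (k : S.Fn) (t : ∀ m, Term S Γ (S.fnDom k m)) : Term S Γ (S.fnCod k)

/-- Quantifier-free formulas, with equality. -/
inductive QFFormula (S : Signature.{w₁, w₂, w₃}) {V : Type} (Γ : V → S.Srt) :
    Type (max w₁ w₂ w₃)
  | falsum : QFFormula S Γ
  | eq {i : S.Srt} (t t' : Term S Γ i) : QFFormula S Γ
  | rel (j : S.Rel) (t : ∀ m, Term S Γ (S.relDom j m)) : QFFormula S Γ
  | neg (φ : QFFormula S Γ) : QFFormula S Γ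
  | conj (φ ψ : QFFormula S Γ) : QFFormula S Γ

/-- Under the assignment `e`, the term is defined and has the value `y`. -/
def Term.HasValue {S : Signature.{w₁, w₂, w₃}} {A : S.Srt → Type v} (𝔄 : PartialStructure S A)
    {V : Type} {Γ : V → S.Srt} (e : ∀ x, A (Γ x)) : {i : S.Srt} → Term S Γ i → A i → Prop
  | _, .var x, y => y = e x
  | _, .app k t, y => ∃ b : ∀ m, A (S.fnDom k m), (∀ m, (t m).HasValue 𝔄 e (b m)) ∧ y ∈ 𝔄.fn k b

/-- Satisfaction. An atomic formula holds only if all of its terms are defined. -/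
def QFFormula.Holds {S : Signature.{w₁, w₂, w₃}} {A : S.Srt → Type v} (𝔄 : PartialStructure S A)
    {V : Type} {Γ : V → S.Srt} (e : ∀ x, A (Γ x)) : QFFormula S Γ → Prop
  | .falsum => False
  | .eq t t' => ∃ y, t.HasValue 𝔄 e y ∧ t'.HasValue 𝔄 e y
  | .rel j t => ∃ b, (∀ m, (t m).HasValue 𝔄 e (b m)) ∧ b ∈ 𝔄.rel j
  | .neg φ => ¬ φ.Holds 𝔄 e
  | .conj φ ψ => φ.Holds 𝔄 e ∧ ψ.Holds 𝔄 e

/-- The assignment that gives the free variables the values `x` and the bound ones the values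
`y`. -/
def assign {S : Signature.{w₁, w₂, w₃}} {A : S.Srt → Type v} {n m : ℕ} {Γ : Fin n → S.Srt}
    {Δ : Fin m → S.Srt} (x : ∀ k, A (Γ k)) (y : ∀ k, A (Δ k)) :
    ∀ z : Fin n ⊕ Fin m, A (Sum.elim Γ Δ z)
  | .inl k => x k
  | .inr k => y k

/-- `𝔄 ⊨ ∃ y, ψ(x, y)`, the Σ₁ formula with quantifier-free matrix `ψ`. -/
def HoldsSigma1 {S : Signature.{w₁, w₂, w₃}} {A : S.Srt → Type v} (𝔄 : PartialStructure S A)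
    {n m : ℕ} {Γ : Fin n → S.Srt} {Δ : Fin m → S.Srt} (ψ : QFFormula S (Sum.elim Γ Δ))
    (x : ∀ k, A (Γ k)) : Prop :=
  ∃ y : ∀ k, A (Δ k), ψ.Holds 𝔄 (assign x y)

/-- The family of maps `π` is a Σ₁-elementary embedding: `𝔄 ⊨ φ(x)` if and only if
`𝔅 ⊨ φ(π x)`, for all Σ₁ formulas `φ` and all finite tuples `x` from `𝔄`. -/
def IsSigma1Elementary {S : Signature.{w₁, w₂, w₃}} {A : S.Srt → Type v} {B : S.Srt → Type w}
    (𝔄 : PartialStructure S A) (𝔅 : PartialStructure S B) (π : ∀ i, A i → B i) : Prop :=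
  ∀ (n m : ℕ) (Γ : Fin n → S.Srt) (Δ : Fin m → S.Srt) (ψ : QFFormula S (Sum.elim Γ Δ))
    (x : ∀ k, A (Γ k)),
    HoldsSigma1 𝔄 ψ x ↔ HoldsSigma1 𝔅 ψ (fun k => π (Γ k) (x k))

/-! ### Interpretable structures and their interpretations -/

/-- The data of a structure of spaces whose constituents are sets: spaces `(X i, τ i)`, relations
`R j` (sets of tuples) and partial functions `f k` (sets of pairs of a tuple and a value). -/
structure SetStructure (S : Signature.{w₁, w₂, w₃}) where
  X : S.Srt → ZFSet.{u}
  τ : S.Srt → ZFSet.{u}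
  R : S.Rel → ZFSet.{u}
  f : S.Fn → ZFSet.{u}

namespace SetStructure

variable {S : Signature.{w₁, w₂, w₃}} (𝔛 : SetStructure.{u} S)

/-- The product of the spaces that the relation `R j` lives on. -/
noncomputable def relSpace (j : S.Rel) : ZFSet.{u} := prodSet (fun m => 𝔛.X (S.relDom j m))

/-- The product of the spaces of the arguments of `f k`. -/
noncomputable def fnSpace (k : S.Fn) : ZFSet.{u} := prodSet (fun m => 𝔛.X (S.fnDom k m))

/-- The product topology on `relSpace`, in `M`. -/
noncomputable def relTop (M : Set ZFSet.{u}) (j : S.Rel) : ZFSet.{u} :=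
  prodTop M (fun m => 𝔛.X (S.relDom j m)) (fun m => 𝔛.τ (S.relDom j m))

/-- The product topology on `fnSpace`, in `M`. -/
noncomputable def fnTop (M : Set ZFSet.{u}) (k : S.Fn) : ZFSet.{u} :=
  prodTop M (fun m => 𝔛.X (S.fnDom k m)) (fun m => 𝔛.τ (S.fnDom k m))

/-- The domain of the partial function `f k`. -/
noncomputable def fnDomain (k : S.Fn) : ZFSet.{u} :=
  (𝔛.fnSpace k).sep (fun z => ∃ y, ZFSet.pair z y ∈ 𝔛.f k)

/-- `M ⊨ 𝔛` is an interpretable structure: the spaces are interpretable, the relations are Borel,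
the functions are partial continuous functions with closed or `G_δ` domains. -/
structure IsInterpretableIn (M : Set ZFSet.{u}) : Prop where
  space : ∀ i, IsInterpretableSpaceIn M (𝔛.X i) (𝔛.τ i)
  rel : ∀ j, IsBorelIn M (𝔛.relSpace j) (𝔛.relTop M j) (𝔛.R j)
  fn_mem : ∀ k, 𝔛.f k ∈ M
  fn_subset : ∀ k, 𝔛.f k ⊆ (𝔛.fnSpace k).prod (𝔛.X (S.fnCod k))
  fn_functional : ∀ k z y y', ZFSet.pair z y ∈ 𝔛.f k → ZFSet.pair z y' ∈ 𝔛.f k → y = y'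
  fn_domain : ∀ k, IsClosedSet (𝔛.fnSpace k) (𝔛.fnTop M k) (𝔛.fnDomain k) ∨
    IsGdeltaIn M (𝔛.fnSpace k) (𝔛.fnTop M k) (𝔛.fnDomain k)
  fn_continuous : ∀ k, ∀ O ∈ 𝔛.τ (S.fnCod k), ∃ W ∈ 𝔛.fnTop M k,
    ∀ z y, ZFSet.pair z y ∈ 𝔛.f k → (z ∈ W ↔ y ∈ O)

/-- The structure with carriers the points of `X i`. -/
noncomputable def toPartialStructure : PartialStructure S (fun i => Pt (𝔛.X i)) where
  rel := fun j => {a | ptTuple a ∈ 𝔛.R j}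
  fn := fun k a => ⟨∃ y : Pt (𝔛.X (S.fnCod k)), ZFSet.pair (ptTuple a) y ∈ 𝔛.f k, fun h => h.choose⟩

/-- `π : 𝔛 → 𝔛̂` is an interpretation over `M`: `π i : X i → Xhat i` are interpretations of the
spaces, each relation is the image of `R j` under the product of the maps `π i`, and each function
is the interpretation of the continuous function `f k`, namely the continuous function on the image
of the domain of `f k` such that `f̂ (π x) = π (f x)` for `x` in the domain of `f k`. -/
structure IsInterpretation (M : Set ZFSet.{u}) (Xhat : S.Srt → Type u)
    [∀ i, TopologicalSpace (Xhat i)] (𝔛hat : PartialStructure S Xhat)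
    (pt : ∀ i, Pt (𝔛.X i) → Xhat i) (op : ∀ i, ZFSet.{u} → Set (Xhat i)) : Prop where
  space : ∀ i, AnalyticAbs.IsInterpretation M (𝔛.X i) (𝔛.τ i) (Xhat i) (pt i) (op i)
  rel : ∀ j, BorelImage M (fun m => 𝔛.τ (S.relDom j m)) (fun m => pt (S.relDom j m))
    (𝔛.R j) (𝔛hat.rel j)
  fn_domain : ∀ k, BorelImage M (fun m => 𝔛.τ (S.fnDom k m)) (fun m => pt (S.fnDom k m))
    (𝔛.fnDomain k) (𝔛hat.fn k).Dom
  fn_continuous : ∀ k, Continuous (𝔛hat.fn k).asSubtype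
  fn_commutes : ∀ k (a : ∀ m, Pt (𝔛.X (S.fnDom k m))) (y : Pt (𝔛.X (S.fnCod k))),
    ZFSet.pair (ptTuple a) y ∈ 𝔛.f k →
    pt (S.fnCod k) y ∈ 𝔛hat.fn k (fun m => pt (S.fnDom k m) (a m))

end SetStructure

end AnalyticAbs

open AnalyticAbs

open AnalyticAbs

set_option linter.unusedSectionVars false

namespace AnalyticAbs

/-! ### Definability over a transitive model -/

/-! Both directions follow from one reflection principle: finitely many facts about points of the
spaces `Xhat i`, each asserting or denying that a tuple lies in an interpreted Borel set, are
realized by points of the corresponding spaces in `M` (`Reflectable.exists_assignment`). The truth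
or falsity in `𝔛hat` of an atomic formula is a consequence of such facts, and so is the demand that
`pt i x` be sent back to `x`. Hence a quantifier-free formula keeps its truth value at the reflected
points (`QFFormula.reflectable`).

The heart is that a Borel set `D` of `M`, in a finite product, is nonempty in `M` if its
interpretation contains some point `z` (`Sieve.TV.exists_mem`). Since `z` need not come from `M`, it
is represented by its trace `G`, the family of basic open sets whose interpretations contain it. The
argument is of Mostowski type. Inside `M` there is a tree of attempts to build an element of `D`.
The facts that are true at `z` give, in the universe, a family of nodes without dead ends; as
well-foundedness is absolute, `M` itself contains an infinite branch (`exists_branch`). Two things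
turn this branch into a point of `D`.

Completeness. A continuous open image of a Čech complete space carries a complete sieve: a tree of
open sets such that a filter base of `M` refining a branch of `M` has a cluster point
(`exists_sieve`). This passes to finite products (`Sieve.prod`), where it also shows that `z` is
prime with respect to covers in `M` (`Sieve.Point.exists_mem_of_cover`).

Ranks. Membership in `D` is unfolded into a derivation from complements of open sets, by supersets
and countable intersections; a true union is witnessed by a true term. Complements of open sets
survive the passage to a cluster point, and the rest follows by induction on rank. For the search to
be a set of `M`, the ranks have to lie in an ordinal of `M`; the Borel hierarchy of `M` supplies the
bound (`Sieve.TV.exists_truth`).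

A partial function enters through its graph, which is relatively closed over its domain
(`Reflectable.mem_fn`). -/

instance memStructure (M : Set ZFSet.{u}) : setLang.Structure M :=
  setStructure (fun x y : M => (x : ZFSet.{u}) ∈ (y : ZFSet.{u}))

/-- Types of finite tuples of elements of `M`. -/
class Ctx (M : Set ZFSet.{u}) (E : Type (u + 1)) where
  idx : Type
  fin : Finite idx
  equiv : E ≃ (idx → M)

instance Ctx.self (M : Set ZFSet.{u}) : Ctx M M where
  idx := Unit
  fin := inferInstance
  equiv := (Equiv.funUnique Unit M).symm

instance Ctx.prod (M : Set ZFSet.{u}) (E F : Type (u + 1)) [Ctx M E] [Ctx M F] :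
    Ctx M (E × F) where
  idx := Ctx.idx M E ⊕ Ctx.idx M F
  fin := by
    have := Ctx.fin (M := M) (E := E)
    have := Ctx.fin (M := M) (E := F)
    infer_instance
  equiv := (Equiv.prodCongr Ctx.equiv Ctx.equiv).trans (Equiv.sumArrowEquivProdArrow _ _ _).symm

instance Ctx.pi (M : Set ZFSet.{u}) (n : ℕ) : Ctx M (Fin n → M) where
  idx := Fin n
  fin := inferInstance
  equiv := Equiv.refl _

variable {M : Set ZFSet.{u}} {E F G : Type (u + 1)} [Ctx M E] [Ctx M F] [Ctx M G]

variable (M) in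
/-- The predicate `P` is first-order definable over `(M, ∈)` with parameters. -/
def Dfn (P : E → Prop) : Prop :=
  (univ : Set M).Definable setLang {v | P ((Ctx.equiv (M := M)).symm v)}

variable (M) in
/-- The map `p` selects some coordinates of a tuple. -/
def PFun (p : E → F) : Prop :=
  ∃ r : Ctx.idx M F → Ctx.idx M E, ∀ e, Ctx.equiv (p e) = Ctx.equiv (M := M) e ∘ r

variable (M) in
/-- The map `f` takes values in `M` and its graph is definable over `M`. -/
def DFun (f : E → ZFSet.{u}) : Prop :=
  (∀ e, f e ∈ M) ∧ Dfn M (fun q : E × M => (q.2 : ZFSet.{u}) = f q.1)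

theorem PFun.id : PFun M (fun e : E => e) := ⟨_root_.id, fun _ => rfl⟩

theorem PFun.fst {p : E → F × G} (hp : PFun M p) : PFun M (fun e => (p e).1) := by
  obtain ⟨r, hr⟩ := hp
  refine ⟨fun i => r (Sum.inl i), fun e => ?_⟩
  funext i
  exact congrFun (hr e) (Sum.inl i)

theorem PFun.snd {p : E → F × G} (hp : PFun M p) : PFun M (fun e => (p e).2) := by
  obtain ⟨r, hr⟩ := hp
  refine ⟨fun i => r (Sum.inr i), fun e => ?_⟩
  funext i
  exact congrFun (hr e) (Sum.inr i)

theorem PFun.mk {p : E → F} {q : E → G} (hp : PFun M p) (hq : PFun M q) :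
    PFun M (fun e => (p e, q e)) := by
  obtain ⟨r, hr⟩ := hp
  obtain ⟨s, hs⟩ := hq
  refine ⟨Sum.elim r s, fun e => ?_⟩
  funext i
  cases i with
  | inl i => exact congrFun (hr e) i
  | inr i => exact congrFun (hs e) i

theorem PFun.app {n : ℕ} {p : E → Fin n → M} (hp : PFun M p) (k : Fin n) :
    PFun M (fun e => p e k) := by
  obtain ⟨r, hr⟩ := hp
  refine ⟨fun _ => r k, fun e => ?_⟩
  funext i
  exact congrFun (hr e) k

namespace Dfn

theorem comp {P : F → Prop} {p : E → F} (hP : Dfn M P) (hp : PFun M p) :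
    Dfn M (fun e => P (p e)) := by
  obtain ⟨r, hr⟩ := hp
  have := Set.Definable.preimage_comp r hP
  refine (congrArg (Set.Definable univ setLang) ?_).mp this
  ext v
  have h := hr (Ctx.equiv.symm v)
  simp only [Equiv.apply_symm_apply] at h
  change P (Ctx.equiv.symm (v ∘ r)) ↔ P _
  rw [← h, Equiv.symm_apply_apply]

theorem congr {P Q : E → Prop} (hP : Dfn M P) (h : ∀ e, Q e ↔ P e) : Dfn M Q := by
  rwa [show Q = P from funext fun e => propext (h e)]

theorem and {P Q : E → Prop} (hP : Dfn M P) (hQ : Dfn M Q) : Dfn M (fun e => P e ∧ Q e) :=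
  Set.Definable.inter hP hQ

theorem or {P Q : E → Prop} (hP : Dfn M P) (hQ : Dfn M Q) : Dfn M (fun e => P e ∨ Q e) :=
  Set.Definable.union hP hQ

theorem not {P : E → Prop} (hP : Dfn M P) : Dfn M (fun e => ¬ P e) :=
  Set.Definable.compl hP

theorem imp {P Q : E → Prop} (hP : Dfn M P) (hQ : Dfn M Q) : Dfn M (fun e => P e → Q e) :=
  (hP.not.or hQ).congr fun _ => imp_iff_not_or

theorem iff {P Q : E → Prop} (hP : Dfn M P) (hQ : Dfn M Q) : Dfn M (fun e => P e ↔ Q e) :=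
  ((hP.imp hQ).and (hQ.imp hP)).congr fun _ => iff_iff_implies_and_implies

theorem const (c : Prop) : Dfn M (fun _ : E => c) := by
  by_cases hc : c
  · exact (congrArg (Set.Definable univ setLang) (by ext; simp [hc])).mp (Set.definable_univ (A := univ) (L := setLang) (M := M))
  · exact (congrArg (Set.Definable univ setLang) (by ext; simp [hc])).mp (Set.definable_empty (A := univ) (L := setLang) (M := M))

/-- Quantification over tuples from `M`. -/
theorem exCtx {P : E → F → Prop} (hP : Dfn M (fun q : E × F => P q.1 q.2)) :
    Dfn M (fun e => ∃ y, P e y) := by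
  have := Ctx.fin (M := M) (E := F)
  have h := Set.Definable.exists_of_finite hP
  refine (congrArg (Set.Definable univ setLang) ?_).mp h
  ext v
  change (∃ u, P _ _) ↔ ∃ y, P _ y
  constructor
  · rintro ⟨y, hy⟩
    exact ⟨_, hy⟩
  · rintro ⟨y, hy⟩
    refine ⟨Ctx.equiv (M := M) y, ?_⟩
    change P (Ctx.equiv.symm v) (Ctx.equiv.symm (Ctx.equiv (M := M) y))
    rwa [Equiv.symm_apply_apply]

theorem allCtx {P : E → F → Prop} (hP : Dfn M (fun q : E × F => P q.1 q.2)) :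
    Dfn M (fun e => ∀ y, P e y) :=
  (exCtx (P := fun e y => ¬ P e y) hP.not).not.congr fun e => by simp

theorem mem_proj : Dfn M (fun q : M × M => (q.1 : ZFSet.{u}) ∈ (q.2 : ZFSet.{u})) := by
  let φ : setLang.Formula (Unit ⊕ Unit) :=
    FirstOrder.Language.Relations.formula₂ (L := setLang) MemRel.mem (.var (.inl ()))
      (.var (.inr ()))
  refine Set.Definable.mono (A := ∅) (Set.empty_definable_iff.2 ⟨φ, ?_⟩) (empty_subset _)
  ext v
  simp only [φ, mem_ofPred_eq]
  rfl

theorem eq_proj : Dfn M (fun q : M × M => (q.1 : ZFSet.{u}) = (q.2 : ZFSet.{u})) := by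
  let φ : setLang.Formula (Unit ⊕ Unit) :=
    FirstOrder.Language.Term.equal (L := setLang) (.var (.inl ())) (.var (.inr ()))
  refine Set.Definable.mono (A := ∅) (Set.empty_definable_iff.2 ⟨φ, ?_⟩) (empty_subset _)
  ext v
  simp only [φ, mem_ofPred_eq, FirstOrder.Language.Formula.realize_equal,
    FirstOrder.Language.Term.realize_var]
  exact Subtype.ext_iff.symm

/-- The value `f e` is an element of `M`, so an existential quantifier over `M` can name it. -/
theorem subst {P : E → ZFSet.{u} → Prop} {f : E → ZFSet.{u}}
    (hP : Dfn M (fun q : E × M => P q.1 q.2)) (hf : DFun M f) : Dfn M (fun e => P e (f e)) := by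
  refine (exCtx (P := fun e (y : M) => (y : ZFSet) = f e ∧ P e y) (hf.2.and hP)).congr fun e => ?_
  constructor
  · intro h
    exact ⟨⟨f e, hf.1 e⟩, rfl, h⟩
  · rintro ⟨y, hy, h⟩
    rwa [← hy]

end Dfn

theorem DFun.coe {p : E → M} (hp : PFun M p) : DFun M (fun e => (p e : ZFSet.{u})) :=
  ⟨fun e => (p e).2, Dfn.eq_proj.comp (PFun.mk (PFun.snd PFun.id) (p := fun q : E × M => q.2)
    (q := fun q : E × M => p q.1) (by
      obtain ⟨r, hr⟩ := hp
      exact ⟨fun i => Sum.inl (r i), fun q => hr q.1⟩))⟩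

theorem PFun.comp {p : F → G} {q : E → F} (hp : PFun M p) (hq : PFun M q) :
    PFun M (fun e => p (q e)) := by
  obtain ⟨r, hr⟩ := hp
  obtain ⟨s, hs⟩ := hq
  exact ⟨s ∘ r, fun _ => by rw [hr, hs]; rfl⟩

theorem DFun.comp {f : F → ZFSet.{u}} {p : E → F} (hf : DFun M f) (hp : PFun M p) :
    DFun M (fun e => f (p e)) :=
  ⟨fun _ => hf.1 _, hf.2.comp (PFun.mk (hp.comp (PFun.fst PFun.id)) (PFun.snd PFun.id)
    (p := fun q : E × M => p q.1))⟩

namespace Dfn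

theorem mem {f g : E → ZFSet.{u}} (hf : DFun M f) (hg : DFun M g) : Dfn M (fun e => f e ∈ g e) := by
  refine subst (P := fun e y => y ∈ g e) ?_ hf
  refine subst (E := E × M) (P := fun q z => (q.2 : ZFSet) ∈ z) (f := fun q => g q.1) ?_
    (hg.comp (PFun.fst PFun.id))
  exact mem_proj.comp (PFun.mk (PFun.snd (PFun.fst PFun.id)) (PFun.snd PFun.id))

theorem eq {f g : E → ZFSet.{u}} (hf : DFun M f) (hg : DFun M g) : Dfn M (fun e => f e = g e) :=
  subst (P := fun e y => y = g e) hg.2 hf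

theorem ex {P : E → ZFSet.{u} → Prop} (hP : Dfn M (fun q : E × M => P q.1 q.2)) :
    Dfn M (fun e => ∃ y, y ∈ M ∧ P e y) :=
  (exCtx (P := fun e (y : M) => P e y) hP).congr fun e => by simp

theorem all {P : E → ZFSet.{u} → Prop} (hP : Dfn M (fun q : E × M => P q.1 q.2)) :
    Dfn M (fun e => ∀ y, y ∈ M → P e y) :=
  (allCtx (P := fun e (y : M) => P e y) hP).congr fun e => by simp

end Dfn

theorem DFun.const {A : ZFSet.{u}} (hA : A ∈ M) : DFun M (fun _ : E => A) := by
  have h : Dfn M (fun x : M => (x : ZFSet) = A) := by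
    have h1 := (Set.Definable.singleton_of_mem setLang (mem_univ (⟨A, hA⟩ : M)))
    have h2 := Set.Definable.preimage_comp (fun _ : Fin 1 => ()) h1
    refine (congrArg (Set.Definable univ setLang) ?_).mp h2
    ext v
    exact Subtype.ext_iff
  exact ⟨fun _ => hA, h.comp (PFun.snd PFun.id)⟩

theorem DFun.snd' : DFun M (fun q : E × M => (q.2 : ZFSet.{u})) := DFun.coe (PFun.snd PFun.id)

theorem DFun.fst' {f : E → ZFSet.{u}} (hf : DFun M f) : DFun M (fun q : E × F => f q.1) :=
  hf.comp (PFun.fst PFun.id)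

variable (M) in
/-- The power set of `A` in `M`. -/
noncomputable def powIn (A : ZFSet.{u}) : ZFSet.{u} := (ZFSet.powerset A).sep (· ∈ M)

@[simp] theorem mem_powIn {A x : ZFSet.{u}} : x ∈ powIn M A ↔ x ⊆ A ∧ x ∈ M := by
  simp [powIn]

/-- Substitution of elements of `M` for some variables. -/
theorem Dfn.fix {P : E × F → Prop} (hP : Dfn M P) (e : E) : Dfn M (fun y => P (e, y)) := by
  have h1 : Dfn M (fun y : F => ∃ e' : E,
      (∀ i : Ctx.idx M E, (Ctx.equiv e' i : ZFSet.{u}) = Ctx.equiv (M := M) e i) ∧ P (e', y)) := by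
    refine Dfn.exCtx (P := fun (y : F) (e' : E) => (∀ i : Ctx.idx M E, (Ctx.equiv e' i : ZFSet.{u}) =
      Ctx.equiv (M := M) e i) ∧ P (e', y)) (Dfn.and ?_ ?_)
    · have := Ctx.fin (M := M) (E := E)
      have h2 := fun i : Ctx.idx M E => (Dfn.eq (M := M)
        (f := fun q : F × E => (Ctx.equiv (M := M) q.2 i : ZFSet.{u}))
        (DFun.coe ⟨fun _ => Sum.inr i, fun q => rfl⟩) (DFun.const (Ctx.equiv (M := M) e i).2))
      refine (congrArg (Set.Definable univ setLang) ?_).mp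
        (Set.definable_iInter_of_finite (fun i => h2 i))
      ext v
      simp
    · exact hP.comp (PFun.mk (PFun.snd PFun.id) (PFun.fst PFun.id))
  refine h1.congr fun y => ⟨fun h => ⟨e, fun _ => rfl, h⟩, ?_⟩
  rintro ⟨e', h2, h3⟩
  have : e' = e := (Ctx.equiv (M := M)).injective (funext fun i => Subtype.ext (h2 i))
  rwa [this] at h3

/-- A definable predicate is given by a formula with finitely many parameters. -/
theorem Dfn.exists_formula {P : E → Prop} (hP : Dfn M P) :
    ∃ (n : ℕ) (φ : setLang.Formula (Ctx.idx M E ⊕ Fin n)) (p : Fin n → M),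
      ∀ e, P e ↔ φ.Realize (Sum.elim (Ctx.equiv e) p) := by
  obtain ⟨A₀, -, hA⟩ := Set.definable_iff_finitely_definable.1 hP
  obtain ⟨φ, hφ⟩ := Set.definable_iff_exists_formula_sum.1 hA
  let g := (Finite.equivFin (↑(A₀ : Set M)))
  refine ⟨_, φ.relabel (Sum.elim (fun a => Sum.inr (g a)) Sum.inl), fun i => (g.symm i : M),
    fun e => ?_⟩
  have h := Set.ext_iff.1 hφ (Ctx.equiv e)
  simp only [mem_ofPred_eq, Equiv.symm_apply_apply] at h
  rw [h, FirstOrder.Language.Formula.realize_relabel]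
  refine iff_of_eq (congrArg _ ?_)
  funext i
  cases i <;> simp

variable {M : Set ZFSet.{u}} {E F : Type (u + 1)} [Ctx M E] [Ctx M F]
  [hM : Fact (IsTransitiveModel M)]

theorem mem_of_mem_model {x y : ZFSet.{u}} (hx : x ∈ M) (hy : y ∈ x) : y ∈ M :=
  hM.out.transitive x hx y hy

/-! ### Sets obtained by separation and replacement -/

/-- The axiom yields a set with the right elements among those of `M`; by transitivity it has no
others, so it is the true set. The other axioms are transferred in the same way below. -/
theorem sep_mem_model {A : ZFSet.{u}} (hA : A ∈ M) {P : ZFSet.{u} → Prop}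
    (hP : Dfn M (fun x : M => P x)) : A.sep P ∈ M := by
  obtain ⟨n, φ, p, h⟩ := hP.exists_formula
  obtain ⟨b, hb⟩ := hM.out.zfc.separation n
    (φ.relabel (Sum.elim (fun _ => 0) Fin.succ)) p ⟨A, hA⟩
  have key : A.sep P = b := by
    ext x
    rw [ZFSet.mem_sep]
    by_cases hx : x ∈ M
    · have := hb ⟨x, hx⟩
      rw [this]
      refine and_congr_right fun _ => ?_
      rw [h ⟨x, hx⟩]
      unfold Sat
      rw [FirstOrder.Language.Formula.realize_relabel]
      refine iff_of_eq (congrArg _ ?_)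
      funext i
      cases i <;> rfl
    · exact ⟨fun hh => absurd (mem_of_mem_model hA hh.1) hx,
        fun hh => absurd (mem_of_mem_model b.2 hh) hx⟩
  rw [key]
  exact b.2

theorem exists_replacement {A : ZFSet.{u}} (hA : A ∈ M) {P : ZFSet.{u} → ZFSet.{u} → Prop}
    (hP : Dfn M (fun q : M × M => P q.1 q.2))
    (hex : ∀ x ∈ A, ∃ y ∈ M, P x y ∧ ∀ y' ∈ M, P x y' → y' = y) :
    ∃ B ∈ M, ∀ y, y ∈ B ↔ y ∈ M ∧ ∃ x ∈ A, P x y := by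
  obtain ⟨n, φ, p, h⟩ := hP.exists_formula
  let g : (Unit ⊕ Unit) ⊕ Fin n → Fin (n + 1 + 1) :=
    Sum.elim (Sum.elim (fun _ => 0) (fun _ => 1)) (fun i => i.succ.succ)
  have key : ∀ x y : M, Sat (fun x y : M => (x : ZFSet.{u}) ∈ (y : ZFSet.{u}))
      (φ.relabel g) (Fin.cons x (Fin.cons y p) : Fin (n + 1 + 1) → M) ↔ P x y := by
    intro x y
    rw [h (x, y)]
    unfold Sat
    rw [FirstOrder.Language.Formula.realize_relabel]
    refine iff_of_eq (congrArg _ ?_)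
    funext i
    rcases i with (i | i) | i <;> rfl
  obtain ⟨b, hb⟩ := hM.out.zfc.replacement n (φ.relabel g) p ⟨A, hA⟩ (by
    intro x hx
    obtain ⟨y, hy, hxy, hu⟩ := hex x hx
    refine ⟨⟨y, hy⟩, (key x ⟨y, hy⟩).2 hxy, fun y' hy' => ?_⟩
    exact Subtype.ext (hu y' y'.2 ((key x y').1 hy')))
  refine ⟨b, b.2, fun y => ⟨fun hy => ?_, ?_⟩⟩
  · have hyM := mem_of_mem_model b.2 hy
    obtain ⟨x, hx, hxy⟩ := (hb ⟨y, hyM⟩).1 hy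
    exact ⟨hyM, x, hx, (key _ _).1 hxy⟩
  · rintro ⟨hy, x, hx, hxy⟩
    exact (hb ⟨y, hy⟩).2 ⟨⟨x, mem_of_mem_model hA hx⟩, hx, (key _ _).2 hxy⟩

theorem powIn_mem {A : ZFSet.{u}} (hA : A ∈ M) : powIn M A ∈ M := by
  obtain ⟨z, hz⟩ := hM.out.zfc.powerset ⟨A, hA⟩
  have : powIn M A = z := by
    ext t
    rw [mem_powIn]
    by_cases ht : t ∈ M
    · rw [hz ⟨t, ht⟩]
      exact ⟨fun h s hs => h.1 hs, fun h => ⟨fun s hs => h ⟨s, mem_of_mem_model ht hs⟩ hs, ht⟩⟩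
    · exact ⟨fun h => absurd h.2 ht, fun h => absurd (mem_of_mem_model z.2 h) ht⟩
  rw [this]
  exact z.2

theorem upair_mem_model {x y : ZFSet.{u}} (hx : x ∈ M) (hy : y ∈ M) :
    ({x, y} : ZFSet.{u}) ∈ M := by
  obtain ⟨z, hz⟩ := hM.out.zfc.pairing ⟨x, hx⟩ ⟨y, hy⟩
  have : ({x, y} : ZFSet.{u}) = z := by
    ext t
    rw [ZFSet.mem_pair]
    by_cases ht : t ∈ M
    · rw [hz ⟨t, ht⟩]
      simp [Subtype.ext_iff]
    · refine ⟨?_, fun h => absurd (mem_of_mem_model z.2 h) ht⟩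
      rintro (h | h) <;> subst h <;> contradiction
  rw [this]
  exact z.2

theorem sUnion_mem_model {x : ZFSet.{u}} (hx : x ∈ M) : ZFSet.sUnion x ∈ M := by
  obtain ⟨z, hz⟩ := hM.out.zfc.union ⟨x, hx⟩
  have : ZFSet.sUnion x = z := by
    ext t
    rw [ZFSet.mem_sUnion]
    by_cases ht : t ∈ M
    · rw [hz ⟨t, ht⟩]
      exact ⟨fun ⟨y, h1, h2⟩ => ⟨⟨y, mem_of_mem_model hx h1⟩, h1, h2⟩,
        fun ⟨y, h1, h2⟩ => ⟨y, h1, h2⟩⟩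
    · refine ⟨fun ⟨y, h1, h2⟩ => absurd (mem_of_mem_model (mem_of_mem_model hx h1) h2) ht,
        fun h => absurd (mem_of_mem_model z.2 h) ht⟩
  rw [this]
  exact z.2

theorem union_mem_model {x y : ZFSet.{u}} (hx : x ∈ M) (hy : y ∈ M) : x ∪ y ∈ M := by
  rw [← ZFSet.sUnion_pair]
  exact sUnion_mem_model (upair_mem_model hx hy)

theorem singleton_mem_model {x : ZFSet.{u}} (hx : x ∈ M) : ({x} : ZFSet.{u}) ∈ M := by
  rw [← ZFSet.pair_eq_singleton]
  exact upair_mem_model hx hx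

theorem insert_mem_model {x y : ZFSet.{u}} (hx : x ∈ M) (hy : y ∈ M) : insert x y ∈ M := by
  rw [ZFSet.insert_eq]
  exact union_mem_model (singleton_mem_model hx) hy

theorem pair_mem_model {x y : ZFSet.{u}} (hx : x ∈ M) (hy : y ∈ M) : ZFSet.pair x y ∈ M :=
  upair_mem_model (singleton_mem_model hx) (upair_mem_model hx hy)

/-! ### Definable predicates and functions -/

/-- Elements of `M` are determined by their elements in `M`, so the graph is expressed through
membership in the values. -/
theorem DFun.of_mem {f : E → ZFSet.{u}} (hf : ∀ e, f e ∈ M)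
    (h : Dfn M (fun q : E × M => (q.2 : ZFSet.{u}) ∈ f q.1)) : DFun M f := by
  refine ⟨hf, ?_⟩
  have h1 : Dfn M (fun q : E × M => ∀ z, z ∈ M → (z ∈ (q.2 : ZFSet.{u}) ↔ z ∈ f q.1)) :=
    Dfn.all (P := fun (q : E × M) z => z ∈ (q.2 : ZFSet.{u}) ↔ z ∈ f q.1)
      ((Dfn.mem (DFun.coe (PFun.snd PFun.id)) (DFun.coe (PFun.snd (PFun.fst PFun.id)))).iff
        (h.comp (PFun.mk (PFun.fst (PFun.fst PFun.id)) (PFun.snd PFun.id))))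
  refine h1.congr fun q => ⟨fun h z _ => by rw [h], fun h => ?_⟩
  ext z
  exact ⟨fun hz => (h z (mem_of_mem_model q.2.2 hz)).1 hz,
    fun hz => (h z (mem_of_mem_model (hf _) hz)).2 hz⟩

namespace Dfn

theorem bex {P : E → ZFSet.{u} → Prop} {f : E → ZFSet.{u}} (hf : DFun M f)
    (hP : Dfn M (fun q : E × M => P q.1 q.2)) : Dfn M (fun e => ∃ y, y ∈ f e ∧ P e y) :=
  (ex (P := fun e y => y ∈ f e ∧ P e y) ((mem (DFun.coe (PFun.snd PFun.id))
    (hf.comp (PFun.fst PFun.id))).and hP)).congr fun e =>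
    ⟨fun ⟨y, h1, h2⟩ => ⟨y, mem_of_mem_model (hf.1 e) h1, h1, h2⟩,
      fun ⟨y, _, h1, h2⟩ => ⟨y, h1, h2⟩⟩

theorem ball {P : E → ZFSet.{u} → Prop} {f : E → ZFSet.{u}} (hf : DFun M f)
    (hP : Dfn M (fun q : E × M => P q.1 q.2)) : Dfn M (fun e => ∀ y, y ∈ f e → P e y) :=
  (bex (P := fun e y => ¬ P e y) hf hP.not).not.congr fun e => by simp

theorem subset {f g : E → ZFSet.{u}} (hf : DFun M f) (hg : DFun M g) :
    Dfn M (fun e => f e ⊆ g e) :=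
  ball (P := fun e y => y ∈ g e) hf (mem (DFun.coe (PFun.snd PFun.id)) (hg.comp (PFun.fst PFun.id)))

end Dfn

namespace DFun

theorem upair {f g : E → ZFSet.{u}} (hf : DFun M f) (hg : DFun M g) :
    DFun M (fun e => ({f e, g e} : ZFSet.{u})) :=
  of_mem (fun e => upair_mem_model (hf.1 e) (hg.1 e)) (((Dfn.eq snd' hf.fst').or
    (Dfn.eq snd' hg.fst')).congr fun q => by simp)

theorem singleton {f : E → ZFSet.{u}} (hf : DFun M f) :
    DFun M (fun e => ({f e} : ZFSet.{u})) :=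
  of_mem (fun e => singleton_mem_model (hf.1 e)) ((Dfn.eq snd' hf.fst').congr fun q => by simp)

theorem pair {f g : E → ZFSet.{u}} (hf : DFun M f) (hg : DFun M g) :
    DFun M (fun e => ZFSet.pair (f e) (g e)) :=
  upair (singleton hf) (upair hf hg)

theorem insert {f g : E → ZFSet.{u}} (hf : DFun M f) (hg : DFun M g) :
    DFun M (fun e => (Insert.insert (f e) (g e) : ZFSet.{u})) :=
  of_mem (fun e => insert_mem_model (hf.1 e) (hg.1 e)) (((Dfn.eq snd' hf.fst').or
    (Dfn.mem snd' hg.fst')).congr fun q => by simp)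

theorem sep {f : E → ZFSet.{u}} {P : E → ZFSet.{u} → Prop} (hf : DFun M f)
    (hP : Dfn M (fun q : E × M => P q.1 q.2)) : DFun M (fun e => (f e).sep (P e)) :=
  of_mem (fun e => sep_mem_model (hf.1 e) (hP.fix e)) (((Dfn.mem snd' hf.fst').and hP).congr fun q => by simp)

theorem inter {f g : E → ZFSet.{u}} (hf : DFun M f) (hg : DFun M g) :
    DFun M (fun e => f e ∩ g e) :=
  sep (P := fun e y => y ∈ g e) hf (Dfn.mem snd' hg.fst')

theorem sdiff {f g : E → ZFSet.{u}} (hf : DFun M f) (hg : DFun M g) :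
    DFun M (fun e => f e \ g e) :=
  sep (P := fun e y => y ∉ g e) hf (Dfn.mem snd' hg.fst').not

end DFun

/-- Definability of predicates built from the operations above. -/
theorem Dfn.auto {P : E → Prop}
    (h : Dfn M P := by
      -- The context must provide that the parameters belong to `M` and that each abstract definable
      -- relation stays definable after substituting definable functions.
      repeat' first
        | assumption
        | with_reducible exact PFun.id
        | with_reducible apply PFun.fst
        | with_reducible apply PFun.snd
        | with_reducible apply PFun.app
        | with_reducible exact DFun.const (by assumption)
        | with_reducible exact DFun.const (Subtype.prop _)
        | with_reducible apply DFun.coe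
        | with_reducible apply DFun.pair
        | with_reducible apply DFun.inter
        | with_reducible apply DFun.sdiff
        | with_reducible apply DFun.insert
        | with_reducible apply DFun.singleton
        | with_reducible apply DFun.sep
        | with_reducible apply Dfn.and
        | with_reducible apply Dfn.or
        | with_reducible apply Dfn.not
        | with_reducible apply Dfn.iff
        | with_reducible apply Dfn.bex
        | with_reducible apply Dfn.ball
        | with_reducible apply Dfn.ex
        | with_reducible apply Dfn.all
        | with_reducible apply Dfn.mem
        | with_reducible apply Dfn.eq
        | with_reducible apply Dfn.subset
        | with_reducible apply Dfn.exCtx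
        | with_reducible apply Dfn.imp
        | with_reducible exact Dfn.const _
        | apply_assumption) :
    Dfn M P := h

/-- Definability of functions built from the operations above. -/
theorem DFun.auto {f : E → ZFSet.{u}}
    (h : DFun M f := by
      repeat' first
        | assumption
        | with_reducible exact PFun.id
        | with_reducible apply PFun.fst
        | with_reducible apply PFun.snd
        | with_reducible apply PFun.app
        | with_reducible exact DFun.const (by assumption)
        | with_reducible exact DFun.const (Subtype.prop _)
        | with_reducible apply DFun.coe
        | with_reducible apply DFun.pair
        | with_reducible apply DFun.inter
        | with_reducible apply DFun.sdiff
        | with_reducible apply DFun.insert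
        | with_reducible apply DFun.singleton
        | with_reducible apply DFun.sep
        | with_reducible apply Dfn.and
        | with_reducible apply Dfn.or
        | with_reducible apply Dfn.not
        | with_reducible apply Dfn.iff
        | with_reducible apply Dfn.bex
        | with_reducible apply Dfn.ball
        | with_reducible apply Dfn.ex
        | with_reducible apply Dfn.all
        | with_reducible apply Dfn.mem
        | with_reducible apply Dfn.eq
        | with_reducible apply Dfn.subset
        | with_reducible apply Dfn.exCtx
        | with_reducible apply Dfn.imp
        | with_reducible exact Dfn.const _
        | apply_assumption) :
    DFun M f := h

theorem sdiff_mem_model {A B : ZFSet.{u}} (hA : A ∈ M) (hB : B ∈ M) : A \ B ∈ M :=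
  (DFun.sdiff (E := M) (DFun.const hA) (DFun.const hB)).1 ⟨A, hA⟩

theorem inter_mem_model {A B : ZFSet.{u}} (hA : A ∈ M) (hB : B ∈ M) : A ∩ B ∈ M :=
  (DFun.inter (E := M) (DFun.const hA) (DFun.const hB)).1 ⟨A, hA⟩

/-- A pair `{{a}, {a, b}}` is a set of subsets of `A ∪ B`, so separation from a double power set
suffices. -/
theorem prod_mem_model {A B : ZFSet.{u}} (hA : A ∈ M) (hB : B ∈ M) : A.prod B ∈ M := by
  have : A.prod B = (powIn M (powIn M (A ∪ B))).sep
      (fun z => ∃ a, a ∈ A ∧ ∃ b, b ∈ B ∧ z = ZFSet.pair a b) := by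
    ext z
    simp only [ZFSet.mem_prod, ZFSet.mem_sep, mem_powIn]
    refine ⟨?_, fun h => h.2⟩
    rintro ⟨a, ha, b, hb, rfl⟩
    have haM := mem_of_mem_model hA ha
    have hbM := mem_of_mem_model hB hb
    refine ⟨⟨fun t ht => ?_, pair_mem_model haM hbM⟩, a, ha, b, hb, rfl⟩
    have htM := mem_of_mem_model (pair_mem_model haM hbM) ht
    rw [mem_powIn]
    refine ⟨fun s hs => ?_, htM⟩
    simp only [ZFSet.pair, ZFSet.mem_pair] at ht
    rcases ht with rfl | rfl
    · simp at hs
      simp [hs, ha]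
    · simp at hs
      rcases hs with rfl | rfl <;> simp [ha, hb]
  rw [this]
  refine sep_mem_model (powIn_mem (powIn_mem (union_mem_model hA hB))) ?_
  exact Dfn.auto

theorem Dfn.comp₁ {R : ZFSet.{u} → Prop} (hR : Dfn M (fun x : M => R x)) {f : E → ZFSet.{u}}
    (hf : DFun M f) : Dfn M (fun e => R (f e)) :=
  Dfn.subst (P := fun _ y => R y) (hR.comp (PFun.snd PFun.id)) hf

theorem Dfn.comp₂ {R : ZFSet.{u} → ZFSet.{u} → Prop} (hR : Dfn M (fun q : M × M => R q.1 q.2))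
    {f g : E → ZFSet.{u}} (hf : DFun M f) (hg : DFun M g) : Dfn M (fun e => R (f e) (g e)) := by
  refine Dfn.subst (P := fun e y => R y (g e)) ?_ hf
  refine Dfn.subst (E := E × M) (P := fun q z => R q.2 z) (f := fun q => g q.1) ?_ hg.fst'
  exact hR.comp (PFun.mk (PFun.snd (PFun.fst PFun.id)) (PFun.snd PFun.id))

theorem DFun.prod {f g : E → ZFSet.{u}} (hf : DFun M f) (hg : DFun M g) :
    DFun M (fun e => (f e).prod (g e)) := by
  refine of_mem (fun e => prod_mem_model (hf.1 e) (hg.1 e)) ?_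
  have hf' := hf.fst' (F := M)
  have hg' := hg.fst' (F := M)
  refine Dfn.congr (P := fun q : E × M => ∃ a, a ∈ f q.1 ∧ ∃ b, b ∈ g q.1 ∧ q.2 = ZFSet.pair a b)
    (Dfn.bex hf' (Dfn.bex hg'.fst' Dfn.auto)) fun q => by
    rw [ZFSet.mem_prod]

/-! ### Natural numbers and sequences -/

theorem empty_mem_model : (∅ : ZFSet.{u}) ∈ M := by
  obtain ⟨z, ⟨e, he, -⟩, -⟩ := hM.out.zfc.infinity
  have : (∅ : ZFSet.{u}) = e := by
    symm
    rw [ZFSet.eq_empty]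
    intro y hy
    exact he ⟨y, mem_of_mem_model e.2 hy⟩ hy
  rw [this]
  exact e.2

theorem natSet_mem_model (n : ℕ) : natSet.{u} n ∈ M := by
  induction n with
  | zero => exact empty_mem_model
  | succ n ih => exact insert_mem_model ih ih

theorem mem_natSet_iff {n : ℕ} {x : ZFSet.{u}} : x ∈ natSet n ↔ ∃ m < n, x = natSet m := by
  induction n with
  | zero => simp [natSet]
  | succ n ih =>
    rw [natSet, ZFSet.mem_insert_iff, ih]
    constructor
    · rintro (rfl | ⟨m, hm, rfl⟩)
      · exact ⟨n, by omega, rfl⟩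
      · exact ⟨m, by omega, rfl⟩
    · rintro ⟨m, hm, rfl⟩
      rcases Nat.lt_succ_iff_lt_or_eq.1 hm with h | rfl
      · exact Or.inr ⟨m, h, rfl⟩
      · exact Or.inl rfl

theorem natSet_injective : Function.Injective natSet.{u} := by
  have key : ∀ m n, m < n → natSet.{u} m ≠ natSet n := by
    intro m n hmn he
    have : natSet.{u} m ∈ natSet n := mem_natSet_iff.2 ⟨m, hmn, rfl⟩
    rw [he] at this
    exact ZFSet.mem_irrefl _ this
  intro m n h
  by_contra hne
  rcases Nat.lt_or_gt_of_ne hne with h' | h'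
  · exact key m n h' h
  · exact key n m h' h.symm

@[simp] theorem natSet_inj {m n : ℕ} : natSet.{u} m = natSet n ↔ m = n := natSet_injective.eq_iff

/-- The set of von Neumann natural numbers. -/
noncomputable def natOmega : ZFSet.{u} := ZFSet.range (fun n : ℕ => natSet n)

@[simp] theorem mem_natOmega {x : ZFSet.{u}} : x ∈ natOmega ↔ ∃ n, x = natSet n := by
  simp [natOmega, eq_comm]

theorem natOmega_mem_model : natOmega.{u} ∈ M := by
  obtain ⟨z, ⟨e, he, hez⟩, hz⟩ := hM.out.zfc.infinity
  have he0 : (e : ZFSet.{u}) = ∅ := by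
    rw [ZFSet.eq_empty]
    intro y hy
    exact he ⟨y, mem_of_mem_model e.2 hy⟩ hy
  have hn : ∀ n, natSet.{u} n ∈ (z : ZFSet.{u}) := by
    intro n
    induction n with
    | zero => simpa [natSet, he0] using hez
    | succ n ih =>
      obtain ⟨y, hy, hyt⟩ := hz ⟨_, natSet_mem_model n⟩ ih
      have : natSet.{u} (n + 1) = y := by
        ext t
        rw [natSet, ZFSet.mem_insert_iff]
        by_cases ht : t ∈ M
        · rw [hyt ⟨t, ht⟩, Subtype.ext_iff, or_comm]
        · exact ⟨fun h => absurd (mem_of_mem_model (natSet_mem_model (n + 1))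
            (ZFSet.mem_insert_iff.2 h)) ht, fun h => absurd (mem_of_mem_model y.2 h) ht⟩
      rw [this]
      exact hy
  -- The set given by infinity may be too large. Natural numbers are cut out without recursion: zero
  -- or a successor, with all elements zero or successors; ∈-induction does the rest.
  let N : ZFSet.{u} → Prop := fun x => (x = ∅ ∨ ∃ y, y ∈ x ∧ x = insert y y) ∧
    ∀ w, w ∈ x → (w = ∅ ∨ ∃ y, y ∈ w ∧ w = insert y y)
  have key : natOmega.{u} = (z : ZFSet.{u}).sep N := by
    have h0 : ∀ n, natSet.{u} n = ∅ ∨ ∃ y, y ∈ natSet n ∧ natSet n = insert y y := by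
      intro n
      cases n with
      | zero => exact Or.inl rfl
      | succ n => exact Or.inr ⟨natSet n, by simp [natSet], rfl⟩
    have h1 : ∀ x, N x → ∃ n, x = natSet n := by
      intro x
      induction x using ZFSet.inductionOn with
      | _ x ih =>
        rintro ⟨rfl | ⟨y, hy, hxy⟩, h2⟩
        · exact ⟨0, rfl⟩
        · obtain ⟨n, hn⟩ := ih y hy ⟨h2 y hy, fun w hw => h2 w (by
            rw [hxy]; exact ZFSet.mem_insert_of_mem _ hw)⟩
          exact ⟨n + 1, by rw [hxy, hn, natSet]⟩
    ext x
    rw [mem_natOmega, ZFSet.mem_sep]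
    constructor
    · rintro ⟨n, rfl⟩
      refine ⟨hn n, h0 n, fun w hw => ?_⟩
      obtain ⟨m, -, rfl⟩ := mem_natSet_iff.1 hw
      exact h0 m
    · exact fun h => h1 x h.2
  rw [key]
  have := empty_mem_model (M := M)
  exact sep_mem_model z.2 Dfn.auto

theorem exists_finite_mem_model {S : Set ZFSet.{u}} (hS : S.Finite) (hSM : S ⊆ M) :
    ∃ s ∈ M, ∀ x, x ∈ s ↔ x ∈ S := by
  induction S, hS using Set.Finite.induction_on with
  | empty => exact ⟨∅, empty_mem_model, by simp⟩
  | @insert a S _ _ ih =>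
    obtain ⟨s, hs, h⟩ := ih fun x hx => hSM (Or.inr hx)
    exact ⟨insert a s, insert_mem_model (hSM (Or.inl rfl)) hs, by simp [h]⟩

/-- The sequence `s` as a set of ordered pairs. -/
noncomputable def seqSet (s : ℕ → ZFSet.{u}) : ZFSet.{u} :=
  ZFSet.range (fun n : ℕ => ZFSet.pair (natSet n) (s n))

theorem mem_seqSet {s : ℕ → ZFSet.{u}} {x : ZFSet.{u}} :
    x ∈ seqSet s ↔ ∃ n, x = ZFSet.pair (natSet n) (s n) := by
  simp [seqSet, eq_comm]

@[simp] theorem pair_mem_seqSet {s : ℕ → ZFSet.{u}} {n : ℕ} {y : ZFSet.{u}} :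
    ZFSet.pair (natSet n) y ∈ seqSet s ↔ y = s n := by
  rw [mem_seqSet]
  constructor
  · rintro ⟨m, hm⟩
    obtain ⟨h1, h2⟩ := ZFSet.pair_inj.1 hm
    rw [natSet_inj] at h1
    rw [h2, h1]
  · rintro rfl
    exact ⟨n, rfl⟩

theorem mem_model_of_pair {a b : ZFSet.{u}} (h : ZFSet.pair a b ∈ M) : a ∈ M ∧ b ∈ M := by
  have h1 : ({a, b} : ZFSet.{u}) ∈ M := mem_of_mem_model h (by simp [ZFSet.pair])
  exact ⟨mem_of_mem_model h1 (by simp), mem_of_mem_model h1 (by simp)⟩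

theorem SeqIn.mem {s : ℕ → ZFSet.{u}} (hs : SeqIn M s) (n : ℕ) : s n ∈ M :=
  (mem_model_of_pair (mem_of_mem_model hs (mem_seqSet.2 ⟨n, rfl⟩))).2

/-- A sequence built in the universe belongs to `M` once a definable relation recognizes its values
among the elements of a set of `M`. -/
theorem seqIn_of_graph {s : ℕ → ZFSet.{u}} {A : ZFSet.{u}} (hA : A ∈ M) (hs : ∀ n, s n ∈ A)
    {R : ZFSet.{u} → ZFSet.{u} → Prop} (hR : Dfn M (fun q : M × M => R q.1 q.2))
    (h : ∀ n, ∀ y ∈ A, R (natSet n) y ↔ y = s n) : SeqIn M s := by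
  have : seqSet s = (natOmega.prod A).sep
      (fun p => ∃ i, i ∈ natOmega ∧ ∃ y, y ∈ A ∧ p = ZFSet.pair i y ∧ R i y) := by
    ext p
    simp only [mem_seqSet, ZFSet.mem_sep, ZFSet.mem_prod, mem_natOmega]
    constructor
    · rintro ⟨n, rfl⟩
      exact ⟨⟨_, ⟨n, rfl⟩, _, hs n, rfl⟩, _, ⟨n, rfl⟩, _, hs n, rfl, (h n _ (hs n)).2 rfl⟩
    · rintro ⟨-, _, ⟨n, rfl⟩, y, hy, rfl, hR⟩
      exact ⟨n, by rw [(h n y hy).1 hR]⟩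
  change seqSet s ∈ M
  rw [this]
  have h0 := natOmega_mem_model (M := M)
  have hR' : ∀ {E : Type (u + 1)} [Ctx M E] {f g : E → ZFSet.{u}}, DFun M f → DFun M g →
    Dfn M (fun e => R (f e) (g e)) := Dfn.comp₂ hR
  exact sep_mem_model (prod_mem_model h0 hA) Dfn.auto

/-- A definable function applied to the terms of a sequence in `M`. -/
theorem SeqIn.map {s : ℕ → ZFSet.{u}} (hs : SeqIn M s) {A : ZFSet.{u}} (hA : A ∈ M)
    {f : ZFSet.{u} → ZFSet.{u}} (hf : DFun M (fun x : M => f x)) (hfA : ∀ n, f (s n) ∈ A) :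
    SeqIn M (fun n => f (s n)) := by
  refine seqIn_of_graph hA hfA
    (R := fun i y => ∃ x, x ∈ M ∧ ZFSet.pair i x ∈ seqSet s ∧ y = f x) ?_ ?_
  · have h1 : seqSet s ∈ M := hs
    have h2 : ∀ {E : Type (u + 1)} [Ctx M E] {p : E → M}, PFun M p → DFun M (fun e => f (p e)) :=
      fun hp => hf.comp hp
    exact Dfn.auto
  · intro n y _
    simp only [pair_mem_seqSet]
    exact ⟨by rintro ⟨x, -, rfl, rfl⟩; rfl, fun h => ⟨s n, hs.mem n, rfl, h⟩⟩

/-! ### Least fixed points -/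

/-- An ordinal is a transitive set of transitive sets, which is a bounded statement. -/
theorem Dfn.isOrdinal {f : E → ZFSet.{u}} (hf : DFun M f) : Dfn M (fun e => (f e).IsOrdinal) := by
  have : Dfn M (fun x : M => (∀ y, y ∈ (x : ZFSet.{u}) → y ⊆ (x : ZFSet.{u})) ∧
    ∀ y, y ∈ (x : ZFSet.{u}) → ∀ z, z ∈ y → z ⊆ y) := Dfn.auto
  refine (comp₁ (R := fun x => (∀ y, y ∈ x → y ⊆ x) ∧ ∀ y, y ∈ x → ∀ z, z ∈ y → z ⊆ y) this
    hf).congr fun e => ?_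
  exact ZFSet.isOrdinal_iff_forall_mem_isTransitive

/-- Read `R Y a` as "`a` follows from the premises `Y`"; then `T` lists derivable elements of `A`
with ordinal ranks. Transfinite recursion is avoided by certificates: sets of ranked elements, each
justified by members of lower rank. Replacement bounds the least ranks. The third clause permits
induction along derivations, the fourth is closure under `R`. All inductive definitions inside `M`
are instances: recursion on ω, well-founded parts, finite coverings and the Borel hierarchy. -/
theorem exists_lfp {A : ZFSet.{u}} (hA : A ∈ M) {R : ZFSet.{u} → ZFSet.{u} → Prop}
    (hR : Dfn M (fun q : M × M => R q.1 q.2)) :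
    ∃ α ∈ M, ∃ T ∈ M, α.IsOrdinal ∧
      (∀ p ∈ T, ∃ β ∈ α, ∃ a ∈ A, p = ZFSet.pair β a) ∧
      (∀ β a, ZFSet.pair β a ∈ T → ∃ Y ∈ M, R Y a ∧ ∀ y ∈ Y, ∃ γ ∈ β, ZFSet.pair γ y ∈ T) ∧
      (∀ Y ∈ M, ∀ a ∈ A, R Y a → (∀ y ∈ Y, ∃ γ, ZFSet.pair γ y ∈ T) →
        ∃ β, ZFSet.pair β a ∈ T) := by
  have hR' : ∀ {E : Type (u + 1)} [Ctx M E] {f g : E → ZFSet.{u}}, DFun M f → DFun M g →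
    Dfn M (fun e => R (f e) (g e)) := Dfn.comp₂ hR
  let cert : ZFSet.{u} → Prop := fun K => ∀ p, p ∈ K → ∃ β, β ∈ M ∧ ∃ a, a ∈ A ∧
    p = ZFSet.pair β a ∧ β.IsOrdinal ∧ ∃ Y, Y ∈ M ∧ R Y a ∧
      ∀ y, y ∈ Y → ∃ γ, γ ∈ β ∧ ZFSet.pair γ y ∈ K
  have hord : ∀ {E : Type (u + 1)} [Ctx M E] {f : E → ZFSet.{u}}, DFun M f →
    Dfn M (fun e => (f e).IsOrdinal) := Dfn.isOrdinal
  let der : ZFSet.{u} → ZFSet.{u} → Prop := fun β a => ∃ K, K ∈ M ∧ cert K ∧ ZFSet.pair β a ∈ K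
  have hder : Dfn M (fun q : M × M => der q.1 q.2) := Dfn.auto
  have hder' : ∀ {E : Type (u + 1)} [Ctx M E] {f g : E → ZFSet.{u}}, DFun M f → DFun M g →
    Dfn M (fun e => der (f e) (g e)) := Dfn.comp₂ hder
  have derM : ∀ β a, der β a → β ∈ M ∧ a ∈ A ∧ β.IsOrdinal := by
    rintro β a ⟨K, hK, hc, hm⟩
    obtain ⟨β', hβ', a', ha', he, ho, -⟩ := hc _ hm
    obtain ⟨rfl, rfl⟩ := ZFSet.pair_inj.1 he
    exact ⟨hβ', ha', ho⟩
  let rk : ZFSet.{u} → ZFSet.{u} → Prop := fun a β => der β a ∧ ∀ γ, γ ∈ β → ¬ der γ a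
  have rk_ex : ∀ a β, der β a → ∃ γ, rk a γ := by
    intro a β
    induction β using ZFSet.inductionOn with
    | _ β ih =>
      intro h
      by_cases h' : ∃ γ ∈ β, der γ a
      · obtain ⟨γ, hγ, hd⟩ := h'
        exact ih γ hγ hd
      · push Not at h'
        exact ⟨β, h, h'⟩
  have rk_uniq : ∀ a β γ, rk a β → rk a γ → γ = β := by
    intro a β γ h1 h2
    rcases (derM _ _ h1.1).2.2.mem_trichotomous (derM _ _ h2.1).2.2 with h | h | h
    · exact absurd h1.1 (h2.2 _ h)
    · exact h.symm
    · exact absurd h2.1 (h1.2 _ h)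
  let A' := A.sep (fun a => ∃ β, β ∈ M ∧ der β a)
  have hA' : A' ∈ M := sep_mem_model hA Dfn.auto
  obtain ⟨B, hB, hBm⟩ := exists_replacement hA' (P := rk) Dfn.auto (by
    intro a ha
    obtain ⟨-, β, -, hβ⟩ := ZFSet.mem_sep.1 ha
    obtain ⟨γ, hγ⟩ := rk_ex a β hβ
    exact ⟨γ, (derM _ _ hγ.1).1, hγ, fun y _ hy => rk_uniq a γ y hγ hy⟩)
  have hBo : ∀ β ∈ B, β.IsOrdinal := fun β hβ => by
    obtain ⟨-, a, -, h⟩ := (hBm β).1 hβ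
    exact (derM _ _ h.1).2.2
  have hso : (ZFSet.sUnion B).IsOrdinal := by
    rw [ZFSet.isOrdinal_iff_forall_mem_isTransitive]
    refine ⟨ZFSet.IsTransitive.sUnion' fun y hy => (hBo y hy).isTransitive, fun x hx => ?_⟩
    obtain ⟨y, hy, hxy⟩ := ZFSet.mem_sUnion.1 hx
    exact ((hBo y hy).mem hxy).isTransitive
  -- The successor of the supremum of the least ranks, so that every least rank is an element of
  -- `α`.
  let α := insert (ZFSet.sUnion B) (ZFSet.sUnion B)
  have hα : α ∈ M := insert_mem_model (sUnion_mem_model hB) (sUnion_mem_model hB)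
  have hαo : α.IsOrdinal := ZFSet.isOrdinal_succ hso
  have hrkα : ∀ a β, rk a β → β ∈ α := by
    intro a β h
    have hd := derM _ _ h.1
    have hβB : β ∈ B := (hBm β).2 ⟨hd.1, a, ZFSet.mem_sep.2 ⟨hd.2.1, β, hd.1, h.1⟩, h⟩
    have hsub : β ⊆ ZFSet.sUnion B := fun x hx => ZFSet.mem_sUnion.2 ⟨β, hβB, hx⟩
    rw [ZFSet.mem_insert_iff]
    exact (hd.2.2.subset_iff_eq_or_mem hso).1 hsub
  let T := (α.prod A).sep (fun p => ∃ β, β ∈ α ∧ ∃ a, a ∈ A ∧ p = ZFSet.pair β a ∧ der β a)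
  have hT : T ∈ M := sep_mem_model (prod_mem_model hα hA) Dfn.auto
  have hTm : ∀ β a, ZFSet.pair β a ∈ T ↔ β ∈ α ∧ der β a := by
    intro β a
    rw [ZFSet.mem_sep]
    constructor
    · rintro ⟨-, β', hβ', a', ha', he, hd⟩
      obtain ⟨rfl, rfl⟩ := ZFSet.pair_inj.1 he
      exact ⟨hβ', hd⟩
    · rintro ⟨hβ, hd⟩
      have ha := (derM _ _ hd).2.1
      exact ⟨ZFSet.pair_mem_prod.2 ⟨hβ, ha⟩, β, hβ, a, ha, rfl, hd⟩
  have hT1 : ∀ β a, ZFSet.pair β a ∈ T →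
      ∃ Y ∈ M, R Y a ∧ ∀ y ∈ Y, ∃ γ ∈ β, ZFSet.pair γ y ∈ T := by
    intro β a h
    obtain ⟨hβ, K, hK, hc, hm⟩ := (hTm β a).1 h
    obtain ⟨β', hβ', a', ha', he, ho, Y, hY, hRY, hy⟩ := hc _ hm
    obtain ⟨rfl, rfl⟩ := ZFSet.pair_inj.1 he
    refine ⟨Y, hY, hRY, fun y hyY => ?_⟩
    obtain ⟨γ, hγ, hγK⟩ := hy y hyY
    exact ⟨γ, hγ, (hTm γ y).2 ⟨hαo.mem_trans hγ hβ, K, hK, hc, hγK⟩⟩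
  refine ⟨α, hα, T, hT, hαo, ?_, hT1, ?_⟩
  · intro p hp
    obtain ⟨-, β', hβ', a', ha', he, -⟩ := ZFSet.mem_sep.1 hp
    exact ⟨β', hβ', a', ha', he⟩
  · intro Y hY a ha hRY hy
    -- All ranks in `T` are below `α`, so `T` with the new pair of rank `α` is a certificate. Its
    -- least rank then lies in `α` and puts `a` into `T`.
    have hd : der α a := by
      refine ⟨insert (ZFSet.pair α a) T, insert_mem_model (pair_mem_model hα
        (mem_of_mem_model hA ha)) hT, ?_, by simp⟩
      intro p hp
      rcases ZFSet.mem_insert_iff.1 hp with rfl | hp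
      · refine ⟨α, hα, a, ha, rfl, hαo, Y, hY, hRY, fun y hyY => ?_⟩
        obtain ⟨γ, hγ⟩ := hy y hyY
        exact ⟨γ, ((hTm _ _).1 hγ).1, ZFSet.mem_insert_of_mem _ hγ⟩
      · obtain ⟨-, β, hβ, b, hb, rfl, hd⟩ := ZFSet.mem_sep.1 hp
        obtain ⟨Z, hZ, hRZ, hz⟩ := hT1 β b hp
        refine ⟨β, mem_of_mem_model hα hβ, b, hb, rfl, hαo.mem hβ, Z, hZ, hRZ, fun y hyZ => ?_⟩
        obtain ⟨γ, hγ, hγT⟩ := hz y hyZ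
        exact ⟨γ, hγ, ZFSet.mem_insert_of_mem _ hγT⟩
    obtain ⟨γ, hγ⟩ := rk_ex a α hd
    exact ⟨γ, (hTm γ a).2 ⟨hrkα a γ hγ, hγ.1⟩⟩

/-! ### Dependent choice and absoluteness of well-foundedness -/

/-- Dependent choice in `M`. -/
theorem exists_seqIn_of_total {N : ZFSet.{u}} (hN : N ∈ M) {Q : ZFSet.{u} → ZFSet.{u} → Prop}
    (hQ : Dfn M (fun q : M × M => Q q.1 q.2)) (htot : ∀ a ∈ N, ∃ b ∈ N, Q a b) {a₀ : ZFSet.{u}}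
    (h₀ : a₀ ∈ N) :
    ∃ a : ℕ → ZFSet.{u}, SeqIn M a ∧ a 0 = a₀ ∧ (∀ n, a n ∈ N) ∧ ∀ n, Q (a n) (a (n + 1)) := by
  have hQ' : ∀ {E : Type (u + 1)} [Ctx M E] {f g : E → ZFSet.{u}}, DFun M f → DFun M g →
    Dfn M (fun e => Q (f e) (g e)) := Dfn.comp₂ hQ
  have hNN := prod_mem_model hN hN
  -- The axiom of choice is given for disjoint families; tagging the successors of `a` by `a` makes
  -- them disjoint.
  let C := (powIn M (N.prod N)).sep (fun c => ∃ a, a ∈ N ∧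
    c = (N.prod N).sep (fun p => ∃ b, b ∈ N ∧ p = ZFSet.pair a b ∧ Q a b))
  have hC : C ∈ M := sep_mem_model (powIn_mem hNN) Dfn.auto
  have hfib : ∀ a ∈ N, (N.prod N).sep (fun p => ∃ b, b ∈ N ∧ p = ZFSet.pair a b ∧ Q a b) ∈ C := by
    intro a ha
    have haM := mem_of_mem_model hN ha
    exact ZFSet.mem_sep.2 ⟨mem_powIn.2 ⟨ZFSet.sep_subset, sep_mem_model hNN Dfn.auto⟩, a, ha, rfl⟩
  have hfibm : ∀ a ∈ N, ∀ p, p ∈ (N.prod N).sep (fun p => ∃ b, b ∈ N ∧ p = ZFSet.pair a b ∧ Q a b)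
      ↔ ∃ b, b ∈ N ∧ p = ZFSet.pair a b ∧ Q a b := by
    intro a ha p
    rw [ZFSet.mem_sep]
    refine ⟨fun h => h.2, fun h => ⟨?_, h⟩⟩
    obtain ⟨b, hb, rfl, -⟩ := h
    exact ZFSet.pair_mem_prod.2 ⟨ha, hb⟩
  obtain ⟨c, hc⟩ := hM.out.zfc.choice ⟨C, hC⟩ (by
    intro x hx
    obtain ⟨-, a, ha, hxa⟩ := ZFSet.mem_sep.1 (show (x : ZFSet.{u}) ∈ C from hx)
    obtain ⟨b, hb, hab⟩ := htot a ha
    exact ⟨⟨ZFSet.pair a b, pair_mem_model (mem_of_mem_model hN ha) (mem_of_mem_model hN hb)⟩, by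
      rw [hxa, hfibm a ha]; exact ⟨b, hb, rfl, hab⟩⟩) (by
    intro x y hx hy hxy t htx hty
    obtain ⟨-, a, ha, hxa⟩ := ZFSet.mem_sep.1 (show (x : ZFSet.{u}) ∈ C from hx)
    obtain ⟨-, b, hb, hyb⟩ := ZFSet.mem_sep.1 (show (y : ZFSet.{u}) ∈ C from hy)
    rw [hxa, hfibm a ha] at htx
    rw [hyb, hfibm b hb] at hty
    obtain ⟨a', -, h1, -⟩ := htx
    obtain ⟨b', -, h2, -⟩ := hty
    have := (ZFSet.pair_inj.1 (h1.symm.trans h2)).1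
    refine hxy (Subtype.ext ?_)
    rw [hxa, hyb, this])
  have hch : ∀ a ∈ N, ∃ b ∈ N, Q a b ∧ ZFSet.pair a b ∈ (c : ZFSet.{u}) ∧
      ∀ b' ∈ N, Q a b' → ZFSet.pair a b' ∈ (c : ZFSet.{u}) → b' = b := by
    intro a ha
    obtain ⟨t, ⟨ht, htc⟩, hu⟩ := hc ⟨_, mem_of_mem_model hC (hfib a ha)⟩ (hfib a ha)
    obtain ⟨b, hb, htb, hab⟩ := (hfibm a ha _).1 ht
    refine ⟨b, hb, hab, by rw [← htb]; exact htc, fun b' hb' hab' hc' => ?_⟩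
    have := hu ⟨ZFSet.pair a b', mem_of_mem_model c.2 hc'⟩
      ⟨(hfibm a ha _).2 ⟨b', hb', rfl, hab'⟩, hc'⟩
    have h3 := htb.symm.trans (Subtype.ext_iff.1 this).symm
    exact (ZFSet.pair_inj.1 h3).2.symm
  choose! g hgN hgQ hgc hgu using hch
  let a : ℕ → ZFSet.{u} := fun n => g^[n] a₀
  have ha0 : a 0 = a₀ := rfl
  have has : ∀ n, a (n + 1) = g (a n) := fun n => Function.iterate_succ_apply' g n a₀
  have haN : ∀ n, a n ∈ N := by
    intro n
    induction n with
    | zero => exact h₀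
    | succ n ih => rw [has]; exact hgN _ ih
  refine ⟨a, ?_, ha0, haN, fun n => by rw [has]; exact hgQ _ (haN n)⟩
  have hω := natOmega_mem_model (M := M)
  have h0M := mem_of_mem_model hN h₀
  have heM := empty_mem_model (M := M)
  have hcM := c.2
  -- The iteration above took place in the universe. Its graph is generated inductively inside `M`,
  -- from the start value by the selected successors, which puts the sequence into `M`.
  obtain ⟨α, hα, T, hT, -, -, hT1, hT2⟩ := exists_lfp (M := M) (prod_mem_model hω hN)
    (R := fun Y p => p = ZFSet.pair ∅ a₀ ∨ ∃ i, i ∈ natOmega ∧ ∃ b, b ∈ N ∧ ZFSet.pair i b ∈ Y ∧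
      ∃ b', b' ∈ N ∧ p = ZFSet.pair (insert i i) b' ∧ Q b b' ∧ ZFSet.pair b b' ∈ (c : ZFSet.{u}))
    Dfn.auto
  have key1 : ∀ n, ∃ γ, ZFSet.pair γ (ZFSet.pair (natSet n) (a n)) ∈ T := by
    intro n
    induction n with
    | zero =>
      refine hT2 ∅ heM _ (ZFSet.pair_mem_prod.2 ⟨mem_natOmega.2 ⟨0, rfl⟩, haN 0⟩) (Or.inl rfl) ?_
      simp
    | succ n ih =>
      refine hT2 {ZFSet.pair (natSet n) (a n)} (singleton_mem_model (pair_mem_model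
        (natSet_mem_model n) (mem_of_mem_model hN (haN n)))) _
        (ZFSet.pair_mem_prod.2 ⟨mem_natOmega.2 ⟨n + 1, rfl⟩, haN _⟩)
        (Or.inr ⟨natSet n, mem_natOmega.2 ⟨n, rfl⟩, a n, haN n, by simp, a (n + 1), haN _, rfl, ?_,
          ?_⟩) ?_
      · rw [has]; exact hgQ _ (haN n)
      · rw [has]; exact hgc _ (haN n)
      · simpa using ih
  have key2 : ∀ γ i y, ZFSet.pair γ (ZFSet.pair i y) ∈ T → ∃ n, i = natSet n ∧ y = a n := by
    intro γ
    induction γ using ZFSet.inductionOn with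
    | _ γ ih =>
      intro i y h
      obtain ⟨Y, hY, hR, hy⟩ := hT1 _ _ h
      rcases hR with hR | ⟨j, hj, b, hb, hjb, b', hb', he, hbQ, hbc⟩
      · obtain ⟨rfl, rfl⟩ := ZFSet.pair_inj.1 hR
        exact ⟨0, rfl, rfl⟩
      · obtain ⟨rfl, rfl⟩ := ZFSet.pair_inj.1 he
        obtain ⟨δ, hδ, hδT⟩ := hy _ hjb
        obtain ⟨n, rfl, rfl⟩ := ih δ hδ _ _ hδT
        exact ⟨n + 1, rfl, by rw [has]; exact hgu _ (haN n) _ hb' hbQ hbc⟩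
  refine seqIn_of_graph hN haN (R := fun i y => ∃ γ, γ ∈ M ∧ ZFSet.pair γ (ZFSet.pair i y) ∈ T)
    Dfn.auto fun n y _ => ⟨?_, ?_⟩
  · rintro ⟨γ, -, h⟩
    obtain ⟨m, h1, h2⟩ := key2 _ _ _ h
    rw [h2, natSet_injective h1]
  · rintro rfl
    obtain ⟨γ, hγ⟩ := key1 n
    exact ⟨γ, (mem_model_of_pair (mem_of_mem_model hT hγ)).1, hγ⟩

/-- If a definable relation on a set of `M` has an infinite path in the universe, it has one in
`M`. -/
theorem exists_branch {A : ZFSet.{u}} (hA : A ∈ M) {Q : ZFSet.{u} → ZFSet.{u} → Prop}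
    (hQ : Dfn M (fun q : M × M => Q q.1 q.2)) {S : Set ZFSet.{u}} (hSA : ∀ a ∈ S, a ∈ A)
    (hS : ∀ a ∈ S, ∃ b ∈ S, Q a b) {a₀ : ZFSet.{u}} (h₀ : a₀ ∈ S) :
    ∃ a : ℕ → ZFSet.{u}, SeqIn M a ∧ a 0 = a₀ ∧ (∀ n, a n ∈ A) ∧ ∀ n, Q (a n) (a (n + 1)) := by
  have hQ' : ∀ {E : Type (u + 1)} [Ctx M E] {f g : E → ZFSet.{u}}, DFun M f → DFun M g →
    Dfn M (fun e => Q (f e) (g e)) := Dfn.comp₂ hQ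
  -- `T` ranks the well-founded part of `Q`: an element enters when all its successors in `A` have
  -- entered.
  obtain ⟨α, hα, T, hT, -, -, hT1, hT2⟩ := exists_lfp (M := M) hA
    (R := fun Y a => ∀ b, b ∈ A → Q a b → b ∈ Y) Dfn.auto
  let N := A.sep (fun a => ¬ ∃ γ, γ ∈ M ∧ ZFSet.pair γ a ∈ T)
  have hN : N ∈ M := sep_mem_model hA Dfn.auto
  -- A ranked element of `S` would have a successor in `S` of smaller rank, and so on downwards.
  have hST : ∀ γ, ∀ a ∈ S, ZFSet.pair γ a ∉ T := by
    intro γ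
    induction γ using ZFSet.inductionOn with
    | _ γ ih =>
      intro a ha h
      obtain ⟨Y, hY, hR, hy⟩ := hT1 _ _ h
      obtain ⟨b, hb, hab⟩ := hS a ha
      obtain ⟨δ, hδ, hδT⟩ := hy b (hR b (hSA b hb) hab)
      exact ih δ hδ b hb hδT
  -- An unranked element has an unranked successor, for otherwise it would be ranked; dependent
  -- choice in `M` applies to the unranked part.
  obtain ⟨a, ha, ha0, haN, haQ⟩ := exists_seqIn_of_total hN hQ (by
    intro a ha
    obtain ⟨haA, hna⟩ := ZFSet.mem_sep.1 ha
    by_contra hcon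
    push Not at hcon
    have haM := mem_of_mem_model hA haA
    obtain ⟨β, hβ⟩ := hT2 (A.sep (fun b => Q a b)) (sep_mem_model hA Dfn.auto) a haA
      (fun b hb hab => ZFSet.mem_sep.2 ⟨hb, hab⟩) (by
        intro b hb
        obtain ⟨hbA, hab⟩ := ZFSet.mem_sep.1 hb
        by_contra hno
        exact hcon b (ZFSet.mem_sep.2 ⟨hbA, fun ⟨γ, _, h⟩ => hno ⟨γ, h⟩⟩) hab)
    exact hna ⟨β, (mem_model_of_pair (mem_of_mem_model hT hβ)).1, hβ⟩)
    (a₀ := a₀) (ZFSet.mem_sep.2 ⟨hSA _ h₀, fun ⟨γ, _, h⟩ => hST γ _ h₀ h⟩)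
  exact ⟨a, ha, ha0, fun n => (ZFSet.mem_sep.1 (haN n)).1, haQ⟩

/-! ### Complete sieves -/

variable (M) in
/-- A complete sieve in `M` on the space `X` with the basis `B`. The nodes of the sieve are the
elements of `A`, the node `a` carries the set `{x ∈ X | inU a x}`. -/
structure Sieve (X B : ZFSet.{u}) where
  A : ZFSet.{u}
  r : ZFSet.{u}
  inU : ZFSet.{u} → ZFSet.{u} → Prop
  child : ZFSet.{u} → ZFSet.{u} → Prop
  space_mem : X ∈ M
  base_mem : B ∈ M
  A_mem : A ∈ M
  r_mem : r ∈ A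
  dfn_inU : Dfn M (fun q : M × M => inU q.1 q.2)
  dfn_child : Dfn M (fun q : M × M => child q.1 q.2)
  base_subset : ∀ O ∈ B, O ⊆ X
  whole_mem : X ∈ B
  base_inter : ∀ O ∈ B, ∀ P ∈ B, O ∩ P ∈ B
  inU_root : ∀ x ∈ X, inU r x
  inU_child : ∀ a b x, child a b → inU b x → inU a x
  -- Filter bases of `M` consisting of arbitrary nonempty sets, some of them inside each node of the
  -- branch, have a cluster point in `X`.
  complete : ∀ a : ℕ → ZFSet.{u}, SeqIn M a → (∀ n, a n ∈ A) → a 0 = r →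
    (∀ n, child (a n) (a (n + 1))) → ∀ F ∈ M, (∀ S ∈ F, S ⊆ X) → (∀ S ∈ F, ∃ x, x ∈ S) →
    (∀ S ∈ F, ∀ S' ∈ F, ∃ T ∈ F, T ⊆ S ∧ T ⊆ S') → (∀ n, ∃ S ∈ F, ∀ x ∈ S, inU (a n) x) →
    ∃ x ∈ X, ∀ O ∈ B, x ∈ O → ∀ S ∈ F, ∃ y ∈ S, y ∈ O

namespace Sieve

variable {X B X' B' : ZFSet.{u}}

/-- The open set at a node of a sieve. -/
noncomputable def u (s : Sieve M X B) (a : ZFSet.{u}) : ZFSet.{u} := X.sep (s.inU a)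

@[simp] theorem mem_u {s : Sieve M X B} {a x : ZFSet.{u}} : x ∈ s.u a ↔ x ∈ X ∧ s.inU a x := by
  simp [u]

theorem inU_of_le {s : Sieve M X B} {a : ℕ → ZFSet.{u}} (ha : ∀ n, s.child (a n) (a (n + 1)))
    {m n : ℕ} (hmn : m ≤ n) {x : ZFSet.{u}} (hx : s.inU (a n) x) : s.inU (a m) x := by
  induction hmn with
  | refl => exact hx
  | step _ ih => exact ih (s.inU_child _ _ _ (ha _) hx)

theorem u_root {s : Sieve M X B} : s.u s.r = X := by
  ext x
  rw [mem_u]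
  exact ⟨fun h => h.1, fun hx => ⟨hx, s.inU_root x hx⟩⟩

/-- The trace on the basis of a point of an extension of the space. -/
structure Point (s : Sieve M X B) (G : Set ZFSet.{u}) : Prop where
  subset : ∀ O ∈ G, O ∈ B
  whole : X ∈ G
  inter : ∀ O ∈ G, ∀ P ∈ G, O ∩ P ∈ G
  -- Primeness is required for finite covers only, because this is what products inherit directly;
  -- infinite covers in `M` are treated later by means of the sieve.
  cover : ∀ O ∈ G, ∀ C : Set ZFSet.{u}, C.Finite → (∀ P ∈ C, P ∈ B) →
    (∀ x ∈ O, ∃ P ∈ C, x ∈ P) → ∃ P ∈ C, P ∈ G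
  child : ∀ a ∈ s.A, s.u a ∈ G → ∃ b ∈ s.A, s.child a b ∧ s.u b ∈ G
  -- The closure of `O'` lies in `O`.
  regular : ∀ O ∈ G, ∃ O' ∈ G, ∀ x ∈ X, x ∉ O → ∃ P ∈ B, x ∈ P ∧ ∀ y ∈ P, y ∉ O'

theorem Point.nonempty {s : Sieve M X B} {G : Set ZFSet.{u}} (h : s.Point G) {O : ZFSet.{u}}
    (hO : O ∈ G) : ∃ x, x ∈ O := by
  by_contra hcon
  push Not at hcon
  obtain ⟨P, hP, -⟩ := h.cover O hO ∅ finite_empty (by simp) fun x hx => absurd hx (hcon x)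
  exact hP

/-- The sieve on the one-point space. -/
noncomputable def one : Sieve M {∅} {{∅}} where
  A := {∅}
  r := ∅
  inU := fun _ _ => True
  child := fun _ _ => True
  space_mem := singleton_mem_model empty_mem_model
  base_mem := singleton_mem_model (singleton_mem_model empty_mem_model)
  A_mem := singleton_mem_model empty_mem_model
  r_mem := by simp
  dfn_inU := Dfn.const _
  dfn_child := Dfn.const _
  base_subset := by simp
  whole_mem := by simp
  base_inter := by simp
  inU_root := fun _ _ => trivial
  inU_child := fun _ _ _ _ _ => trivial
  complete := by
    intro a _ _ _ _ F _ hFX hFne _ _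
    refine ⟨∅, by simp, fun O hO _ S hS => ?_⟩
    obtain ⟨x, hx⟩ := hFne S hS
    rw [ZFSet.mem_singleton.1 hO]
    exact ⟨x, hx, hFX S hS hx⟩

theorem one_point : (one (M := M)).Point {{∅}} where
  subset := by simp
  whole := rfl
  inter := by rintro O rfl P rfl; ext; simp
  cover := by
    rintro O rfl C _ hCB hC
    obtain ⟨P, hP, -⟩ := hC ∅ (by simp)
    exact ⟨P, hP, ZFSet.mem_singleton.1 (hCB P hP)⟩
  child := by
    intro a _ h
    exact ⟨∅, by simp [one], trivial, h⟩
  regular := by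
    rintro O rfl
    exact ⟨_, rfl, fun x hx hx' => absurd hx hx'⟩

/-! ### Products of sieves and of traces -/

variable (M) in
/-- The basis of open boxes of a product of two spaces. -/
noncomputable def prodBase (X B X' B' : ZFSet.{u}) : ZFSet.{u} :=
  (powIn M (X.prod X')).sep (fun W => ∃ O, O ∈ B ∧ ∃ O', O' ∈ B' ∧ W = O.prod O')

theorem mem_prodBase (s : Sieve M X B) (s' : Sieve M X' B') {W : ZFSet.{u}} :
    W ∈ prodBase M X B X' B' ↔ ∃ O ∈ B, ∃ O' ∈ B', W = O.prod O' := by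
  rw [prodBase, ZFSet.mem_sep, mem_powIn]
  refine ⟨fun h => h.2, fun h => ⟨?_, h⟩⟩
  obtain ⟨O, hO, O', hO', rfl⟩ := h
  refine ⟨fun p hp => ?_, prod_mem_model (mem_of_mem_model s.base_mem hO)
    (mem_of_mem_model s'.base_mem hO')⟩
  obtain ⟨a, ha, b, hb, rfl⟩ := ZFSet.mem_prod.1 hp
  exact ZFSet.pair_mem_prod.2 ⟨s.base_subset O hO ha, s'.base_subset O' hO' hb⟩

theorem prod_inter_prod (O O' P P' : ZFSet.{u}) :
    O.prod O' ∩ P.prod P' = (O ∩ P).prod (O' ∩ P') := by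
  ext p
  simp only [ZFSet.mem_inter, ZFSet.mem_prod]
  constructor
  · rintro ⟨⟨a, ha, b, hb, rfl⟩, c, hc, d, hd, he⟩
    obtain ⟨rfl, rfl⟩ := ZFSet.pair_inj.1 he
    exact ⟨a, ⟨ha, hc⟩, b, ⟨hb, hd⟩, rfl⟩
  · rintro ⟨a, ⟨ha, hc⟩, b, ⟨hb, hd⟩, rfl⟩
    exact ⟨⟨a, ha, b, hb, rfl⟩, a, hc, b, hd, rfl⟩

/-- Cluster points are found one coordinate at a time. The projections of `F` to `X` cluster at some
`x`. The sets `F2`, projections to `X'` of the parts of members of `F` over neighborhoods of `x`,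
then form a filter base in `M`; if it clusters at `x'`, then `F` clusters at the pair. -/
theorem prod_complete (s : Sieve M X B) (s' : Sieve M X' B') {a a' : ℕ → ZFSet.{u}}
    (ha : SeqIn M a) (haA : ∀ n, a n ∈ s.A) (ha0 : a 0 = s.r) (hac : ∀ n, s.child (a n) (a (n + 1)))
    (ha' : SeqIn M a') (haA' : ∀ n, a' n ∈ s'.A) (ha0' : a' 0 = s'.r)
    (hac' : ∀ n, s'.child (a' n) (a' (n + 1))) {F : ZFSet.{u}} (hF : F ∈ M)
    (hFX : ∀ S ∈ F, S ⊆ X.prod X') (hFne : ∀ S ∈ F, ∃ x, x ∈ S)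
    (hFd : ∀ S ∈ F, ∀ S' ∈ F, ∃ T ∈ F, T ⊆ S ∧ T ⊆ S')
    (hFa : ∀ n, ∃ S ∈ F, ∀ x x', ZFSet.pair x x' ∈ S → s.inU (a n) x ∧ s'.inU (a' n) x') :
    ∃ p ∈ X.prod X', ∀ O ∈ B, ∀ O' ∈ B', p ∈ O.prod O' → ∀ S ∈ F, ∃ y ∈ S, y ∈ O.prod O' := by
  have hX := s.space_mem
  have hX' := s'.space_mem
  have hB := s.base_mem
  have hFX' : ∀ S ∈ F, ∀ p ∈ S, ∃ x ∈ X, ∃ x' ∈ X', p = ZFSet.pair x x' :=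
    fun S hS p hp => ZFSet.mem_prod.1 (hFX S hS hp)
  let F1 := (powIn M X).sep (fun T => ∃ S, S ∈ F ∧
    T = X.sep (fun x => ∃ x', x' ∈ X' ∧ ZFSet.pair x x' ∈ S))
  have hF1 : F1 ∈ M := sep_mem_model (powIn_mem hX) Dfn.auto
  have hF1m : ∀ S ∈ F, X.sep (fun x => ∃ x', x' ∈ X' ∧ ZFSet.pair x x' ∈ S) ∈ F1 := by
    intro S hS
    have hSM := mem_of_mem_model hF hS
    exact ZFSet.mem_sep.2 ⟨mem_powIn.2 ⟨ZFSet.sep_subset, sep_mem_model hX Dfn.auto⟩, S, hS, rfl⟩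
  obtain ⟨x, hx, hxc⟩ := s.complete a ha haA ha0 hac F1 hF1
    (fun S hS => (mem_powIn.1 (ZFSet.mem_sep.1 hS).1).1) (by
      intro T hT
      obtain ⟨-, S, hS, rfl⟩ := ZFSet.mem_sep.1 hT
      obtain ⟨p, hp⟩ := hFne S hS
      obtain ⟨x, hx, x', hx', rfl⟩ := hFX' S hS p hp
      exact ⟨x, ZFSet.mem_sep.2 ⟨hx, x', hx', hp⟩⟩) (by
      intro T1 hT1 T2 hT2
      obtain ⟨-, S1, hS1, rfl⟩ := ZFSet.mem_sep.1 hT1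
      obtain ⟨-, S2, hS2, rfl⟩ := ZFSet.mem_sep.1 hT2
      obtain ⟨S, hS, h1, h2⟩ := hFd S1 hS1 S2 hS2
      refine ⟨_, hF1m S hS, fun x hx => ?_, fun x hx => ?_⟩ <;>
      obtain ⟨hx, x', hx', h⟩ := ZFSet.mem_sep.1 hx
      · exact ZFSet.mem_sep.2 ⟨hx, x', hx', h1 h⟩
      · exact ZFSet.mem_sep.2 ⟨hx, x', hx', h2 h⟩) (by
      intro n
      obtain ⟨S, hS, h⟩ := hFa n
      refine ⟨_, hF1m S hS, fun x hx => ?_⟩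
      obtain ⟨hx, x', hx', hp⟩ := ZFSet.mem_sep.1 hx
      exact (h x x' hp).1)
  have hxM := mem_of_mem_model hX hx
  let F2 := (powIn M X').sep (fun T => ∃ S, S ∈ F ∧ ∃ O, O ∈ B ∧ x ∈ O ∧
    T = X'.sep (fun x' => ∃ y, y ∈ O ∧ ZFSet.pair y x' ∈ S))
  have hF2 : F2 ∈ M := sep_mem_model (powIn_mem hX') Dfn.auto
  have hF2m : ∀ S ∈ F, ∀ O ∈ B, x ∈ O →
      X'.sep (fun x' => ∃ y, y ∈ O ∧ ZFSet.pair y x' ∈ S) ∈ F2 := by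
    intro S hS O hO hxO
    have hSM := mem_of_mem_model hF hS
    have hOM := mem_of_mem_model hB hO
    exact ZFSet.mem_sep.2 ⟨mem_powIn.2 ⟨ZFSet.sep_subset, sep_mem_model hX' Dfn.auto⟩,
      S, hS, O, hO, hxO, rfl⟩
  have hmeet : ∀ S ∈ F, ∀ O ∈ B, x ∈ O → ∃ y ∈ O, ∃ x' ∈ X', ZFSet.pair y x' ∈ S := by
    intro S hS O hO hxO
    obtain ⟨y, hy, hyO⟩ := hxc O hO hxO _ (hF1m S hS)
    obtain ⟨hyX, x', hx', h⟩ := ZFSet.mem_sep.1 hy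
    exact ⟨y, hyO, x', hx', h⟩
  obtain ⟨x', hx', hxc'⟩ := s'.complete a' ha' haA' ha0' hac' F2 hF2
    (fun S hS => (mem_powIn.1 (ZFSet.mem_sep.1 hS).1).1) (by
      intro T hT
      obtain ⟨-, S, hS, O, hO, hxO, rfl⟩ := ZFSet.mem_sep.1 hT
      obtain ⟨y, hy, x', hx', h⟩ := hmeet S hS O hO hxO
      exact ⟨x', ZFSet.mem_sep.2 ⟨hx', y, hy, h⟩⟩) (by
      intro T1 hT1 T2 hT2
      obtain ⟨-, S1, hS1, O1, hO1, hxO1, rfl⟩ := ZFSet.mem_sep.1 hT1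
      obtain ⟨-, S2, hS2, O2, hO2, hxO2, rfl⟩ := ZFSet.mem_sep.1 hT2
      obtain ⟨S, hS, h1, h2⟩ := hFd S1 hS1 S2 hS2
      refine ⟨_, hF2m S hS (O1 ∩ O2) (s.base_inter _ hO1 _ hO2) (ZFSet.mem_inter.2 ⟨hxO1, hxO2⟩),
        fun x hx => ?_, fun x hx => ?_⟩ <;>
      obtain ⟨hx, y, hy, h⟩ := ZFSet.mem_sep.1 hx
      · exact ZFSet.mem_sep.2 ⟨hx, y, (ZFSet.mem_inter.1 hy).1, h1 h⟩
      · exact ZFSet.mem_sep.2 ⟨hx, y, (ZFSet.mem_inter.1 hy).2, h2 h⟩) (by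
      intro n
      obtain ⟨S, hS, h⟩ := hFa n
      refine ⟨_, hF2m S hS _ s.whole_mem hx, fun x' hx' => ?_⟩
      obtain ⟨hx', y, hy, hp⟩ := ZFSet.mem_sep.1 hx'
      exact (h y x' hp).2)
  refine ⟨ZFSet.pair x x', ZFSet.pair_mem_prod.2 ⟨hx, hx'⟩, ?_⟩
  intro O hO O' hO' hp S hS
  obtain ⟨hxO, hxO'⟩ := ZFSet.pair_mem_prod.1 hp
  obtain ⟨y', hy', hyO'⟩ := hxc' O' hO' hxO' _ (hF2m S hS O hO hxO)
  obtain ⟨hyX', y, hy, h⟩ := ZFSet.mem_sep.1 hy'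
  exact ⟨_, h, ZFSet.pair_mem_prod.2 ⟨hy, hyO'⟩⟩

/-- The product of two sieves. -/
noncomputable def prod (s : Sieve M X B) (s' : Sieve M X' B') :
    Sieve M (X.prod X') (prodBase M X B X' B') where
  A := s.A.prod s'.A
  r := ZFSet.pair s.r s'.r
  inU := fun c p => ∃ a, a ∈ s.A ∧ ∃ a', a' ∈ s'.A ∧ ∃ x, x ∈ X ∧ ∃ x', x' ∈ X' ∧
    c = ZFSet.pair a a' ∧ p = ZFSet.pair x x' ∧ s.inU a x ∧ s'.inU a' x'
  child := fun c d => ∃ a, a ∈ s.A ∧ ∃ a', a' ∈ s'.A ∧ ∃ b, b ∈ s.A ∧ ∃ b', b' ∈ s'.A ∧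
    c = ZFSet.pair a a' ∧ d = ZFSet.pair b b' ∧ s.child a b ∧ s'.child a' b'
  space_mem := prod_mem_model s.space_mem s'.space_mem
  base_mem := by
    have h1 := s.space_mem
    have h2 := s'.space_mem
    have h3 := s.base_mem
    have h4 := s'.base_mem
    refine sep_mem_model (powIn_mem (prod_mem_model h1 h2)) ?_
    exact Dfn.bex (DFun.const h3) (Dfn.bex (DFun.const h4) (Dfn.eq DFun.auto
      (DFun.prod DFun.auto DFun.auto)))
  A_mem := prod_mem_model s.A_mem s'.A_mem
  r_mem := ZFSet.pair_mem_prod.2 ⟨s.r_mem, s'.r_mem⟩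
  dfn_inU := by
    have h1 := s.space_mem
    have h2 := s'.space_mem
    have h3 := s.A_mem
    have h4 := s'.A_mem
    have h5 : ∀ {E : Type (u + 1)} [Ctx M E] {f g : E → ZFSet.{u}}, DFun M f → DFun M g →
      Dfn M (fun e => s.inU (f e) (g e)) := Dfn.comp₂ s.dfn_inU
    have h6 : ∀ {E : Type (u + 1)} [Ctx M E] {f g : E → ZFSet.{u}}, DFun M f → DFun M g →
      Dfn M (fun e => s'.inU (f e) (g e)) := Dfn.comp₂ s'.dfn_inU
    exact Dfn.auto
  dfn_child := by
    have h3 := s.A_mem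
    have h4 := s'.A_mem
    have h5 : ∀ {E : Type (u + 1)} [Ctx M E] {f g : E → ZFSet.{u}}, DFun M f → DFun M g →
      Dfn M (fun e => s.child (f e) (g e)) := Dfn.comp₂ s.dfn_child
    have h6 : ∀ {E : Type (u + 1)} [Ctx M E] {f g : E → ZFSet.{u}}, DFun M f → DFun M g →
      Dfn M (fun e => s'.child (f e) (g e)) := Dfn.comp₂ s'.dfn_child
    exact Dfn.auto
  base_subset := by
    intro W hW
    exact (mem_powIn.1 (ZFSet.mem_sep.1 hW).1).1
  whole_mem := (mem_prodBase s s').2 ⟨X, s.whole_mem, X', s'.whole_mem, rfl⟩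
  base_inter := by
    intro O hO P hP
    obtain ⟨O1, hO1, O2, hO2, rfl⟩ := (mem_prodBase s s').1 hO
    obtain ⟨P1, hP1, P2, hP2, rfl⟩ := (mem_prodBase s s').1 hP
    exact (mem_prodBase s s').2 ⟨_, s.base_inter _ hO1 _ hP1, _, s'.base_inter _ hO2 _ hP2,
      prod_inter_prod _ _ _ _⟩
  inU_root := by
    intro p hp
    obtain ⟨x, hx, x', hx', rfl⟩ := ZFSet.mem_prod.1 hp
    exact ⟨_, s.r_mem, _, s'.r_mem, x, hx, x', hx', rfl, rfl, s.inU_root x hx, s'.inU_root x' hx'⟩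
  inU_child := by
    rintro _ _ _ ⟨a, ha, a', ha', b, -, b', -, rfl, rfl, hab, hab'⟩
      ⟨c, -, c', -, x, hx, x', hx', he, rfl, h, h'⟩
    obtain ⟨rfl, rfl⟩ := ZFSet.pair_inj.1 he
    exact ⟨a, ha, a', ha', x, hx, x', hx', rfl, rfl, s.inU_child _ _ _ hab h,
      s'.inU_child _ _ _ hab' h'⟩
  complete := by
    intro c hc hcA hc0 hcc F hF hFX hFne hFd hFc
    have hcp : ∀ n, ∃ a ∈ s.A, ∃ a' ∈ s'.A, c n = ZFSet.pair a a' :=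
      fun n => ZFSet.mem_prod.1 (hcA n)
    choose a haA a' haA' hca using hcp
    have hcS : seqSet c ∈ M := hc
    have h3 := s.A_mem
    have h4 := s'.A_mem
    have ha : SeqIn M a := by
      refine seqIn_of_graph h3 haA
        (R := fun i y => ∃ y', y' ∈ s'.A ∧ ZFSet.pair i (ZFSet.pair y y') ∈ seqSet c) Dfn.auto ?_
      intro n y _
      simp only [pair_mem_seqSet, hca, ZFSet.pair_inj]
      exact ⟨fun ⟨y', _, h, _⟩ => h, fun h => ⟨_, haA' n, h, rfl⟩⟩
    have ha' : SeqIn M a' := by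
      refine seqIn_of_graph h4 haA'
        (R := fun i y' => ∃ y, y ∈ s.A ∧ ZFSet.pair i (ZFSet.pair y y') ∈ seqSet c) Dfn.auto ?_
      intro n y _
      simp only [pair_mem_seqSet, hca, ZFSet.pair_inj]
      exact ⟨fun ⟨y', _, _, h⟩ => h, fun h => ⟨_, haA n, rfl, h⟩⟩
    have h0 := ZFSet.pair_inj.1 ((hca 0).symm.trans hc0)
    have hch : ∀ n, s.child (a n) (a (n + 1)) ∧ s'.child (a' n) (a' (n + 1)) := by
      intro n
      obtain ⟨b, -, b', -, d, -, d', -, h1, h2, h3, h4⟩ := hcc n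
      rw [hca, ZFSet.pair_inj] at h1 h2
      rw [h1.1, h1.2, h2.1, h2.2]
      exact ⟨h3, h4⟩
    obtain ⟨p, hp, hpc⟩ := prod_complete s s' ha haA h0.1 (fun n => (hch n).1) ha' haA' h0.2
      (fun n => (hch n).2) hF hFX hFne hFd (by
        intro n
        obtain ⟨S, hS, h⟩ := hFc n
        refine ⟨S, hS, fun x x' hxx => ?_⟩
        obtain ⟨b, -, b', -, y, -, y', -, h1, h2, h3, h4⟩ := h _ hxx
        rw [hca, ZFSet.pair_inj] at h1
        rw [ZFSet.pair_inj] at h2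
        rw [h1.1, h1.2, h2.1, h2.2]
        exact ⟨h3, h4⟩)
    refine ⟨p, hp, fun O hO => ?_⟩
    obtain ⟨O1, hO1, O2, hO2, rfl⟩ := (mem_prodBase s s').1 hO
    exact hpc O1 hO1 O2 hO2

theorem prod_u (s : Sieve M X B) (s' : Sieve M X' B') {a a' : ZFSet.{u}} (ha : a ∈ s.A)
    (ha' : a' ∈ s'.A) : (s.prod s').u (ZFSet.pair a a') = (s.u a).prod (s'.u a') := by
  ext p
  simp only [mem_u, ZFSet.mem_prod, prod, ZFSet.pair_inj]
  constructor
  · rintro ⟨-, b, -, b', -, x, hx, x', hx', ⟨rfl, rfl⟩, rfl, h1, h2⟩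
    exact ⟨x, ⟨hx, h1⟩, x', ⟨hx', h2⟩, rfl⟩
  · rintro ⟨x, ⟨hx, h1⟩, x', ⟨hx', h2⟩, rfl⟩
    exact ⟨⟨x, hx, x', hx', rfl⟩, a, ha, a', ha', x, hx, x', hx', ⟨rfl, rfl⟩, rfl, h1, h2⟩

theorem prod_eq_prod {O O' P P' : ZFSet.{u}} (hO : ∃ x, x ∈ O) (hO' : ∃ x, x ∈ O')
    (h : O.prod O' = P.prod P') : O = P ∧ O' = P' := by
  have key : ∀ x y, (x ∈ O ∧ y ∈ O') ↔ (x ∈ P ∧ y ∈ P') := fun x y => by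
    rw [← ZFSet.pair_mem_prod, h, ZFSet.pair_mem_prod]
  obtain ⟨a, ha⟩ := hO
  obtain ⟨b, hb⟩ := hO'
  have hab := (key a b).1 ⟨ha, hb⟩
  refine ⟨ZFSet.ext fun x => ?_, ZFSet.ext fun y => ?_⟩
  · have := key x b
    tauto
  · have := key a y
    tauto

theorem Point.prod {s : Sieve M X B} {s' : Sieve M X' B'} {G G' : Set ZFSet.{u}} (h : s.Point G)
    (h' : s'.Point G') :
    (s.prod s').Point {W | ∃ O ∈ G, ∃ O' ∈ G', W = O.prod O'} where
  subset := by
    rintro W ⟨O, hO, O', hO', rfl⟩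
    exact (mem_prodBase s s').2 ⟨O, h.subset O hO, O', h'.subset O' hO', rfl⟩
  whole := ⟨X, h.whole, X', h'.whole, rfl⟩
  inter := by
    rintro W ⟨O, hO, O', hO', rfl⟩ V ⟨P, hP, P', hP', rfl⟩
    exact ⟨_, h.inter O hO P hP, _, h'.inter O' hO' P' hP', prod_inter_prod _ _ _ _⟩
  cover := by
    rintro W ⟨O, hO, O', hO', rfl⟩ C hC hCB hcov
    by_contra hcon
    push Not at hcon
    have hbox : ∀ P ∈ C, ∃ p : ZFSet.{u} × ZFSet.{u}, p.1 ∈ B ∧ p.2 ∈ B' ∧ P = p.1.prod p.2 := by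
      intro P hP
      obtain ⟨P1, h1, P2, h2, rfl⟩ := (mem_prodBase s s').1 (hCB P hP)
      exact ⟨(P1, P2), h1, h2, rfl⟩
    choose! f hf1 hf2 hf using hbox
    -- Primeness of `G` yields a point of `O` outside all first sides that are not in `G`. The boxes
    -- over this point have second sides covering `O'`, so primeness of `G'` selects a box, and its
    -- first side must be in `G`.
    obtain ⟨x, hxO, hx⟩ : ∃ x ∈ O, ∀ P ∈ C, (f P).1 ∉ G → x ∉ (f P).1 := by
      by_contra hno
      push Not at hno
      obtain ⟨_, ⟨P, ⟨hP, hPG⟩, rfl⟩, hP'⟩ := h.cover O hO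
        ((fun P => (f P).1) '' {P | P ∈ C ∧ (f P).1 ∉ G})
        ((hC.subset fun P hP => hP.1).image _) (by
          rintro _ ⟨P, ⟨hP, -⟩, rfl⟩
          exact hf1 P hP) (by
          intro x hx
          obtain ⟨P, hP, hPG, hxP⟩ := hno x hx
          exact ⟨_, ⟨P, ⟨hP, hPG⟩, rfl⟩, hxP⟩)
      exact hPG hP'
    obtain ⟨_, ⟨P, ⟨hP, hxP⟩, rfl⟩, hP'⟩ := h'.cover O' hO'
      ((fun P => (f P).2) '' {P | P ∈ C ∧ x ∈ (f P).1})
      ((hC.subset fun P hP => hP.1).image _) (by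
        rintro _ ⟨P, ⟨hP, -⟩, rfl⟩
        exact hf2 P hP) (by
        intro y hy
        obtain ⟨P, hP, hxy⟩ := hcov _ (ZFSet.pair_mem_prod.2 ⟨hxO, hy⟩)
        rw [hf P hP, ZFSet.pair_mem_prod] at hxy
        exact ⟨_, ⟨P, ⟨hP, hxy.1⟩, rfl⟩, hxy.2⟩)
    have hPG : (f P).1 ∈ G := by
      by_contra hno
      exact hx P hP hno hxP
    exact hcon P hP ⟨_, hPG, _, hP', hf P hP⟩
  child := by
    intro c hc hcG
    obtain ⟨a, ha, a', ha', rfl⟩ := ZFSet.mem_prod.1 hc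
    obtain ⟨O, hO, O', hO', he⟩ := hcG
    rw [prod_u s s' ha ha'] at he
    -- A nonempty box determines its sides, so both factors of the node belong to the respective
    -- traces.
    obtain ⟨h1, h2⟩ := prod_eq_prod (h.nonempty hO) (h'.nonempty hO') he.symm
    subst h1 h2
    obtain ⟨b, hb, hab, hbG⟩ := h.child a ha hO
    obtain ⟨b', hb', hab', hbG'⟩ := h'.child a' ha' hO'
    refine ⟨ZFSet.pair b b', ZFSet.pair_mem_prod.2 ⟨hb, hb'⟩,
      ⟨a, ha, a', ha', b, hb, b', hb', rfl, rfl, hab, hab'⟩, ?_⟩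
    rw [prod_u s s' hb hb']
    exact ⟨_, hbG, _, hbG', rfl⟩
  regular := by
    rintro W ⟨O, hO, O', hO', rfl⟩
    obtain ⟨P, hP, hPO⟩ := h.regular O hO
    obtain ⟨P', hP', hPO'⟩ := h'.regular O' hO'
    refine ⟨_, ⟨P, hP, P', hP', rfl⟩, fun p hp hpO => ?_⟩
    obtain ⟨x, hx, x', hx', rfl⟩ := ZFSet.mem_prod.1 hp
    rw [ZFSet.pair_mem_prod, not_and_or] at hpO
    rcases hpO with hxO | hxO
    · obtain ⟨Q, hQ, hxQ, hdis⟩ := hPO x hx hxO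
      refine ⟨Q.prod X', (mem_prodBase s s').2 ⟨Q, hQ, X', s'.whole_mem, rfl⟩,
        ZFSet.pair_mem_prod.2 ⟨hxQ, hx'⟩, fun y hy hyP => ?_⟩
      obtain ⟨y1, hy1, y2, hy2, rfl⟩ := ZFSet.mem_prod.1 hy
      exact hdis y1 hy1 (ZFSet.pair_mem_prod.1 hyP).1
    · obtain ⟨Q, hQ, hxQ, hdis⟩ := hPO' x' hx' hxO
      refine ⟨X.prod Q, (mem_prodBase s s').2 ⟨X, s.whole_mem, Q, hQ, rfl⟩,
        ZFSet.pair_mem_prod.2 ⟨hx, hxQ⟩, fun y hy hyP => ?_⟩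
      obtain ⟨y1, hy1, y2, hy2, rfl⟩ := ZFSet.mem_prod.1 hy
      exact hdis y2 hy2 (ZFSet.pair_mem_prod.1 hyP).2

variable (M) in
/-- The basis of open boxes of a finite product. -/
noncomputable def boxBase : {n : ℕ} → (Fin n → ZFSet.{u}) → (Fin n → ZFSet.{u}) → ZFSet.{u}
  | 0, _, _ => {{∅}}
  | _ + 1, X, τ => prodBase M (X 0) (τ 0) (prodSet fun k => X k.succ)
      (boxBase (fun k => X k.succ) fun k => τ k.succ)

/-- The product of finitely many sieves. -/
noncomputable def pi : {n : ℕ} → {X τ : Fin n → ZFSet.{u}} → (∀ k, Sieve M (X k) (τ k)) →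
    Sieve M (prodSet X) (boxBase M X τ)
  | 0, _, _, _ => one
  | _ + 1, _, _, s => (s 0).prod (pi fun k => s k.succ)

/-- The set of boxes with sides in the families `G k`. -/
def boxes {n : ℕ} (G : Fin n → Set ZFSet.{u}) : Set ZFSet.{u} :=
  {W | ∃ O : Fin n → ZFSet.{u}, (∀ k, O k ∈ G k) ∧ W = prodSet O}

theorem boxes_succ {n : ℕ} (G : Fin (n + 1) → Set ZFSet.{u}) :
    boxes G = {W | ∃ O ∈ G 0, ∃ O' ∈ boxes (fun k => G k.succ), W = O.prod O'} := by
  ext W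
  constructor
  · rintro ⟨O, hO, rfl⟩
    exact ⟨O 0, hO 0, _, ⟨fun k => O k.succ, fun k => hO _, rfl⟩, rfl⟩
  · rintro ⟨O, hO, _, ⟨O', hO', rfl⟩, rfl⟩
    exact ⟨Fin.cons O O', fun k => by refine Fin.cases ?_ ?_ k <;> simp [hO, hO'], by simp [prodSet]⟩

theorem mem_boxBase {n : ℕ} {X τ : Fin n → ZFSet.{u}} (s : ∀ k, Sieve M (X k) (τ k))
    {W : ZFSet.{u}} : W ∈ boxBase M X τ ↔ W ∈ boxes (fun k => {O | O ∈ τ k}) := by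
  induction n generalizing W with
  | zero => simp [boxBase, boxes, prodSet]
  | succ n ih =>
    rw [boxBase, boxes_succ, mem_prodBase (s 0) (pi fun k => s k.succ)]
    refine exists_congr fun O => and_congr_right fun _ => exists_congr fun O' => ?_
    rw [ih fun k => s k.succ]

theorem Point.pi {n : ℕ} {X τ : Fin n → ZFSet.{u}} {s : ∀ k, Sieve M (X k) (τ k)}
    {G : Fin n → Set ZFSet.{u}} (h : ∀ k, (s k).Point (G k)) :
    (Sieve.pi s).Point (boxes G) := by
  induction n with
  | zero =>
    have : boxes G = {{∅}} := by
      ext W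
      simp [boxes, prodSet]
    rw [this]
    exact one_point
  | succ n ih =>
    rw [boxes_succ]
    exact (h 0).prod (ih fun k => h k.succ)

end Sieve

/-! ### Interpretable spaces have complete sieves -/

theorem IsTopologyIn.union {X τ O P : ZFSet.{u}} (h : IsTopologyIn M X τ) (hO : O ∈ τ)
    (hP : P ∈ τ) : O ∪ P ∈ τ := by
  rw [← ZFSet.sUnion_pair]
  refine h.sUnion _ (upair_mem_model (mem_of_mem_model h.top_mem hO)
    (mem_of_mem_model h.top_mem hP)) ?_
  intro x hx
  rcases ZFSet.mem_pair.1 hx with rfl | rfl <;> assumption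

/-- `Z` is covered by `g` and the open sets disjoint from some neighborhood of `y`. A finite
subcover gives `P` as a finite union and `O` as a finite intersection. The set `P` witnesses that
the closure of `O` lies in `g`. -/
theorem IsCompactIn.regular {Z ζ g y : ZFSet.{u}} (ht : IsTopologyIn M Z ζ) (hH : IsHausdorff Z ζ)
    (hc : IsCompactIn M Z ζ) (hg : g ∈ ζ) (hy : y ∈ g) :
    ∃ O ∈ ζ, ∃ P ∈ ζ, y ∈ O ∧ (∀ z ∈ O, z ∉ P) ∧ ∀ z ∈ Z, z ∈ P ∨ z ∈ g := by
  have hζ := ht.top_mem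
  have hgM := mem_of_mem_model hζ hg
  have hyM := mem_of_mem_model hgM hy
  let C := ζ.sep (fun P => ∃ O, O ∈ ζ ∧ y ∈ O ∧ ∀ z, z ∈ O → z ∉ P)
  have hC : C ∈ M := sep_mem_model hζ Dfn.auto
  have hCm : ∀ P, P ∈ C ↔ P ∈ ζ ∧ ∃ O, O ∈ ζ ∧ y ∈ O ∧ ∀ z, z ∈ O → z ∉ P :=
    fun P => ZFSet.mem_sep
  have hsub : insert g C ⊆ ζ := by
    intro P hP
    rcases ZFSet.mem_insert_iff.1 hP with rfl | hP
    · exact hg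
    · exact ((hCm P).1 hP).1
  obtain ⟨F, hF, hFC, hFf, hFZ⟩ := hc (insert g C) (insert_mem_model hgM hC) hsub (by
    ext z
    rw [ZFSet.mem_sUnion]
    constructor
    · rintro ⟨P, hP, hz⟩
      exact ht.subset P (hsub hP) hz
    · intro hz
      by_cases hzy : y = z
      · exact ⟨g, ZFSet.mem_insert _ _, hzy ▸ hy⟩
      · obtain ⟨O, hO, P, hP, hyO, hzP, hOP⟩ := hH y (ht.subset g hg hy) z hz hzy
        refine ⟨P, ZFSet.mem_insert_of_mem _ ((hCm P).2 ⟨hP, O, hO, hyO, fun t ht1 ht2 => ?_⟩), hzP⟩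
        exact ZFSet.notMem_empty t (hOP ▸ ZFSet.mem_inter.2 ⟨ht1, ht2⟩))
  have key : ∀ S : Set ZFSet.{u}, S.Finite → (∀ P ∈ S, P ∈ insert g C) →
      ∃ P ∈ C, ∀ Q ∈ S, ∀ z ∈ Q, z ∈ P ∨ z ∈ g := by
    intro S hS
    induction S, hS using Set.Finite.induction_on with
    | empty =>
      intro _
      exact ⟨∅, (hCm _).2 ⟨ht.empty, Z, ht.whole, ht.subset g hg hy, by simp⟩, by simp⟩
    | @insert a S _ _ ih =>
      intro hSC
      obtain ⟨P, hP, h⟩ := ih fun P hP => hSC P (Or.inr hP)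
      rcases ZFSet.mem_insert_iff.1 (hSC a (Or.inl rfl)) with rfl | ha
      · refine ⟨P, hP, fun Q hQ z hz => ?_⟩
        rcases hQ with rfl | hQ
        · exact Or.inr hz
        · exact h Q hQ z hz
      · obtain ⟨hPζ, O, hO, hyO, hOP⟩ := (hCm P).1 hP
        obtain ⟨haζ, O', hO', hyO', hOa⟩ := (hCm a).1 ha
        refine ⟨P ∪ a, (hCm _).2 ⟨ht.union hPζ haζ, O ∩ O', ht.inter _ hO _ hO',
          ZFSet.mem_inter.2 ⟨hyO, hyO'⟩, fun z hz hz' => ?_⟩, fun Q hQ z hz => ?_⟩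
        · obtain ⟨h1, h2⟩ := ZFSet.mem_inter.1 hz
          rcases ZFSet.mem_union.1 hz' with h3 | h3
          · exact hOP z h1 h3
          · exact hOa z h2 h3
        · rw [ZFSet.mem_union]
          rcases hQ with rfl | hQ
          · exact Or.inl (Or.inr hz)
          · rcases h Q hQ z hz with h | h
            · exact Or.inl (Or.inl h)
            · exact Or.inr h
  obtain ⟨P, hP, h⟩ := key {O | O ∈ F} hFf fun P hP => hFC hP
  obtain ⟨hPζ, O, hO, hyO, hOP⟩ := (hCm P).1 hP
  refine ⟨O, hO, P, hPζ, hyO, hOP, fun z hz => ?_⟩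
  rw [← hFZ] at hz
  obtain ⟨Q, hQ, hzQ⟩ := ZFSet.mem_sUnion.1 hz
  exact h Q hQ z hzQ

section SpaceSieve

variable {X τ Y σ f Z ζ : ZFSet.{u}} {g : ℕ → ZFSet.{u}}

/-- Pull `F` back to the compact space `Z`, intersecting with the sets `V n`. If every point of `Z`
had a neighborhood `O` missing some `V n ∩ f⁻¹ S`, a finite subcover would contradict directedness
and nonemptiness of `F`. The resulting cluster point `z` lies in the closure of every `V (n + 1)`,
hence in every `g n` and so in `Y`; continuity makes `f z` a cluster point of `F`. -/
theorem spaceSieve_complete (htY : IsTopologyIn M Y σ)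
    (hf : IsOpenContinuousOntoIn M Y σ X τ f) (htZ : IsTopologyIn M Z ζ)
    (hcZ : IsCompactIn M Z ζ) (hYZ : Y ⊆ Z) (hYg : ∀ z ∈ Z, z ∈ Y ↔ ∀ n, z ∈ g n)
    (hσ : ∀ O, O ∈ σ ↔ ∃ P ∈ ζ, O = P ∩ Y) {V : ℕ → ZFSet.{u}} (hV : SeqIn M V)
    (hVσ : ∀ n, V n ∈ σ) (hVd : ∀ n, V (n + 1) ⊆ V n)
    (hVc : ∀ n, ∃ P ∈ ζ, (∀ y ∈ V (n + 1), y ∉ P) ∧ ∀ z ∈ Z, z ∈ P ∨ z ∈ g n)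
    {F : ZFSet.{u}} (hF : F ∈ M) (hFd : ∀ S ∈ F, ∀ S' ∈ F, ∃ T ∈ F, T ⊆ S ∧ T ⊆ S')
    (hFne : ∀ S ∈ F, ∃ x, x ∈ S)
    (hFV : ∀ n, ∃ S ∈ F, ∀ x ∈ S, ∃ y ∈ V n, ZFSet.pair y x ∈ f) :
    ∃ x ∈ X, ∀ O ∈ τ, x ∈ O → ∀ S ∈ F, ∃ y ∈ S, y ∈ O := by
  have hζ := htZ.top_mem
  have hfM := hf.mem
  have hVS : seqSet V ∈ M := hV
  have hω := natOmega_mem_model (M := M)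
  let C := ζ.sep (fun O => ∃ S, S ∈ F ∧ ∃ n, n ∈ natOmega ∧ ∃ W, W ∈ M ∧ ZFSet.pair n W ∈ seqSet V ∧
    ∀ y, y ∈ O → y ∈ W → ∀ x, x ∈ S → ZFSet.pair y x ∉ f)
  have hC : C ∈ M := sep_mem_model hζ Dfn.auto
  have hCm : ∀ O, O ∈ C ↔ O ∈ ζ ∧ ∃ S ∈ F, ∃ n, ∀ y ∈ O, y ∈ V n → ∀ x ∈ S, ZFSet.pair y x ∉ f := by
    intro O
    rw [ZFSet.mem_sep]
    refine and_congr_right fun _ => exists_congr fun S => and_congr_right fun _ => ?_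
    constructor
    · rintro ⟨n, hn, W, -, hW, h⟩
      obtain ⟨n, rfl⟩ := mem_natOmega.1 hn
      rw [pair_mem_seqSet] at hW
      subst hW
      exact ⟨n, h⟩
    · rintro ⟨n, h⟩
      exact ⟨natSet n, mem_natOmega.2 ⟨n, rfl⟩, V n, hV.mem n, by simp, h⟩
  have hVmono : ∀ m n, m ≤ n → V n ⊆ V m := by
    intro m n hmn
    induction hmn with
    | refl => exact fun _ h => h
    | step _ ih => exact fun x hx => ih (hVd _ hx)
  have hVY : ∀ n, V n ⊆ Y := fun n => htY.subset _ (hVσ n)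
  obtain ⟨z, hz, hzC⟩ : ∃ z ∈ Z, z ∉ ZFSet.sUnion C := by
    by_contra hcon
    push Not at hcon
    have hCζ : C ⊆ ζ := ZFSet.sep_subset
    obtain ⟨F0, hF0, hFC, hFf, hFZ⟩ := hcZ C hC hCζ (by
      ext z
      refine ⟨fun h => ?_, hcon z⟩
      obtain ⟨P, hP, hz⟩ := ZFSet.mem_sUnion.1 h
      exact htZ.subset P (hCζ hP) hz)
    have key : ∀ K : Set ZFSet.{u}, K.Finite → (∀ P ∈ K, P ∈ C) →
        ∃ S ∈ F, ∃ n, ∀ O ∈ K, ∀ y ∈ O, y ∈ V n → ∀ x ∈ S, ZFSet.pair y x ∉ f := by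
      intro K hK
      induction K, hK using Set.Finite.induction_on with
      | empty =>
        intro _
        obtain ⟨S, hS, -⟩ := hFV 0
        exact ⟨S, hS, 0, by simp⟩
      | @insert a K _ _ ih =>
        intro hKC
        obtain ⟨S, hS, n, h⟩ := ih fun P hP => hKC P (Or.inr hP)
        obtain ⟨-, S', hS', n', h'⟩ := (hCm a).1 (hKC a (Or.inl rfl))
        obtain ⟨T, hT, hTS, hTS'⟩ := hFd S hS S' hS'
        refine ⟨T, hT, max n n', fun O hO y hyO hyV x hx => ?_⟩
        rcases hO with rfl | hO
        · exact h' y hyO (hVmono n' _ (le_max_right _ _) hyV) x (hTS' hx)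
        · exact h O hO y hyO (hVmono n _ (le_max_left _ _) hyV) x (hTS hx)
    obtain ⟨S, hS, n, h⟩ := key {O | O ∈ F0} hFf fun P hP => hFC hP
    obtain ⟨S', hS', hSV⟩ := hFV n
    obtain ⟨T, hT, hTS, hTS'⟩ := hFd S hS S' hS'
    obtain ⟨x, hx⟩ := hFne T hT
    obtain ⟨y, hy, hyx⟩ := hSV x (hTS' hx)
    have hyZ : y ∈ ZFSet.sUnion F0 := by
      rw [hFZ]
      exact hYZ (hVY n hy)
    obtain ⟨O, hO, hyO⟩ := ZFSet.mem_sUnion.1 hyZ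
    exact h O hO y hyO hy x (hTS hx) hyx
  have hmeet : ∀ O ∈ ζ, z ∈ O → ∀ S ∈ F, ∀ n, ∃ y ∈ O, y ∈ V n ∧ ∃ x ∈ S, ZFSet.pair y x ∈ f := by
    intro O hO hzO S hS n
    by_contra hcon
    push Not at hcon
    exact hzC (ZFSet.mem_sUnion.2 ⟨O, (hCm O).2 ⟨hO, S, hS, n, hcon⟩, hzO⟩)
  -- If `z` were in the open set `P`, then `P` would meet `V (n + 1)`, from which it is disjoint.
  have hzY : z ∈ Y := by
    rw [hYg z hz]
    intro n
    obtain ⟨P, hP, h1, h2⟩ := hVc n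
    rcases h2 z hz with h | h
    · obtain ⟨S, hS, -⟩ := hFV 0
      obtain ⟨y, hyP, hyV, -⟩ := hmeet P hP h S hS (n + 1)
      exact absurd hyP (h1 y hyV)
    · exact h
  obtain ⟨hfsub, hfun⟩ := hf.isFunc
  obtain ⟨x, hx, -⟩ := hfun z hzY
  refine ⟨x, (ZFSet.pair_mem_prod.1 (hfsub hx)).2, fun O hO hxO S hS => ?_⟩
  obtain ⟨P, hP, hPe⟩ := (hσ _).1 (hf.continuous O hO)
  have hzP : z ∈ P ∩ Y := by
    rw [← hPe]
    exact ZFSet.mem_sep.2 ⟨hzY, x, hxO, hx⟩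
  obtain ⟨y, hyP, hyV, x', hx', hyx⟩ := hmeet P hP (ZFSet.mem_inter.1 hzP).1 S hS 0
  have hyPY : y ∈ P ∩ Y := ZFSet.mem_inter.2 ⟨hyP, hVY 0 hyV⟩
  rw [← hPe] at hyPY
  obtain ⟨hyY, x'', hx'', hyx''⟩ := ZFSet.mem_sep.1 hyPY
  have : x' = x'' := (hfun y hyY).unique hyx hyx''
  exact ⟨x', hx', this ▸ hx''⟩

end SpaceSieve

theorem IsPreinterpretation.mono {X τ : ZFSet.{u}} {Xhat : Type u} [TopologicalSpace Xhat]
    {pt : Pt X → Xhat} {op : ZFSet.{u} → Set Xhat} (h : IsPreinterpretation M X τ Xhat pt op)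
    {O P : ZFSet.{u}} (hO : O ∈ τ) (hP : P ∈ τ) (hOP : O ⊆ P) : op O ⊆ op P := by
  have : O = O ∩ P := by
    ext x
    simpa using fun hx => hOP hx
  rw [this, h.inter O hO P hP]
  exact inter_subset_right

/-- Preservation of unions of families in `M` makes each point of the extension prime with respect
to open covers in `M`. -/
theorem IsPreinterpretation.exists_mem {X τ : ZFSet.{u}} {Xhat : Type u} [TopologicalSpace Xhat]
    {pt : Pt X → Xhat} {op : ZFSet.{u} → Set Xhat} (h : IsPreinterpretation M X τ Xhat pt op)
    (ht : IsTopologyIn M X τ) {O C : ZFSet.{u}} (hO : O ∈ τ) (hC : C ∈ M) (hCτ : C ⊆ τ)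
    (hOC : ∀ x ∈ O, ∃ P ∈ C, x ∈ P) {z : Xhat} (hz : z ∈ op O) : ∃ P ∈ C, z ∈ op P := by
  have h1 := h.mono hO (ht.sUnion C hC hCτ) (fun x hx => ZFSet.mem_sUnion.2 (hOC x hx)) hz
  rw [h.sUnion C hC hCτ] at h1
  simpa using h1

/-- The trace of a point of a preinterpretation. -/
def trace (τ : ZFSet.{u}) {Xhat : Type u} (op : ZFSet.{u} → Set Xhat) (z : Xhat) :
    Set ZFSet.{u} := {O | O ∈ τ ∧ z ∈ op O}

/-- Write `X` as the image of a `G_δ` set `Y = ⋂ g n` of a compact space. A node is a level `n` with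
an open `V ⊆ Y` and carries the open set `f[V]`; a child at the next level has its `V' ⊆ V` with
closure in `Z` inside `g n`. Only first-order properties of covers in `M` are needed to see that
traces of points are prime and can be continued along the sieve. -/
theorem exists_sieve {X τ : ZFSet.{u}} (h : IsInterpretableSpaceIn M X τ) :
    ∃ s : Sieve M X τ, ∀ (Xhat : Type u) [TopologicalSpace Xhat] (pt : Pt X → Xhat)
      (op : ZFSet.{u} → Set Xhat), IsPreinterpretation M X τ Xhat pt op →
      ∀ z, s.Point (trace τ op z) := by
  obtain ⟨Y, σ, f, htY, ⟨Z, ζ, htZ, hHZ, hcZ, ⟨hYZ, g, hg, hgζ, hYg⟩, hσ⟩, hf⟩ := h.image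
  have htX := h.isTopology
  have hX := htX.space_mem
  have hτ := htX.top_mem
  have hζ := htZ.top_mem
  have hZ := htZ.space_mem
  have hσM := htY.top_mem
  have hY := htY.space_mem
  have hfM := hf.mem
  have hgM : seqSet g ∈ M := hg
  have hω := natOmega_mem_model (M := M)
  obtain ⟨hfsub, hfun⟩ := hf.isFunc
  let inU : ZFSet.{u} → ZFSet.{u} → Prop := fun c x => ∃ n, n ∈ natOmega ∧ ∃ V, V ∈ σ ∧
    c = ZFSet.pair n V ∧ ∃ y, y ∈ V ∧ ZFSet.pair y x ∈ f
  let child : ZFSet.{u} → ZFSet.{u} → Prop := fun c d => ∃ n, n ∈ natOmega ∧ ∃ V, V ∈ σ ∧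
    ∃ V', V' ∈ σ ∧ c = ZFSet.pair n V ∧ d = ZFSet.pair (insert n n) V' ∧ V' ⊆ V ∧
    ∃ P, P ∈ ζ ∧ (∀ y, y ∈ V' → y ∉ P) ∧ ∀ z, z ∈ Z → z ∈ P ∨
      ∃ G, G ∈ M ∧ ZFSet.pair n G ∈ seqSet g ∧ z ∈ G
  have hinU : ∀ n, ∀ V ∈ σ, ∀ x, inU (ZFSet.pair (natSet n) V) x ↔
      ∃ y, y ∈ V ∧ ZFSet.pair y x ∈ f := by
    intro n V hV x
    constructor
    · rintro ⟨m, -, W, -, he, h⟩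
      rw [(ZFSet.pair_inj.1 he).2]
      exact h
    · exact fun h => ⟨natSet n, mem_natOmega.2 ⟨n, rfl⟩, V, hV, rfl, h⟩
  let s : Sieve M X τ :=
    { A := natOmega.prod σ
      r := ZFSet.pair (natSet 0) Y
      inU := inU
      child := child
      space_mem := hX
      base_mem := hτ
      A_mem := prod_mem_model hω hσM
      r_mem := ZFSet.pair_mem_prod.2 ⟨mem_natOmega.2 ⟨0, rfl⟩, htY.whole⟩
      dfn_inU := Dfn.auto
      dfn_child := Dfn.auto
      base_subset := htX.subset
      whole_mem := htX.whole
      base_inter := htX.inter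
      inU_root := fun x hx => (hinU 0 Y htY.whole x).2 (hf.onto x hx)
      inU_child := by
        rintro _ _ x ⟨n, hn, V, hV, V', -, rfl, rfl, hVV, -⟩ ⟨m, -, W, -, he, y, hy, hyx⟩
        obtain ⟨-, rfl⟩ := ZFSet.pair_inj.1 he
        exact ⟨n, hn, V, hV, rfl, y, hVV hy, hyx⟩
      complete := by
        intro c hc hcA hc0 hcc F hF hFX hFne hFd hFc
        have hex : ∀ n, ∃ V ∈ σ, c n = ZFSet.pair (natSet n) V := by
          intro n
          induction n with
          | zero => exact ⟨Y, htY.whole, hc0⟩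
          | succ n ih =>
            obtain ⟨V, hV, he⟩ := ih
            obtain ⟨m, -, W, -, V', hV', h1, h2, -⟩ := hcc n
            rw [he, ZFSet.pair_inj] at h1
            exact ⟨V', hV', by rw [h2, ← h1.1, natSet]⟩
        choose V hVσ hcV using hex
        have hcS : seqSet c ∈ M := hc
        have hV : SeqIn M V := by
          refine seqIn_of_graph hσM hVσ
            (R := fun i V => ZFSet.pair i (ZFSet.pair i V) ∈ seqSet c) Dfn.auto ?_
          intro n y _
          simp [hcV, ZFSet.pair_inj]
        have hch : ∀ n, V (n + 1) ⊆ V n ∧ ∃ P ∈ ζ, (∀ y ∈ V (n + 1), y ∉ P) ∧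
            ∀ z ∈ Z, z ∈ P ∨ z ∈ g n := by
          intro n
          obtain ⟨m, -, W, -, V', -, h1, h2, h3, P, hP, h4, h5⟩ := hcc n
          rw [hcV, ZFSet.pair_inj] at h1 h2
          rw [h1.2, h2.2]
          refine ⟨h3, P, hP, h4, fun z hz => (h5 z hz).imp_right ?_⟩
          rintro ⟨G, -, hG, hzG⟩
          rw [← h1.1, pair_mem_seqSet] at hG
          rwa [hG] at hzG
        refine spaceSieve_complete htY hf htZ hcZ hYZ hYg hσ hV hVσ (fun n => (hch n).1)
          (fun n => (hch n).2) hF hFd hFne fun n => ?_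
        obtain ⟨S, hS, h⟩ := hFc n
        refine ⟨S, hS, fun x hx => ?_⟩
        have := h x hx
        rwa [hcV, hinU n _ (hVσ n)] at this }
  refine ⟨s, fun Xhat _ pt op hpre z => ?_⟩
  have hsu : ∀ n, ∀ V ∈ σ, s.u (ZFSet.pair (natSet n) V) =
      X.sep (fun x => ∃ y, y ∈ V ∧ ZFSet.pair y x ∈ f) := by
    intro n V hV
    ext x
    rw [Sieve.mem_u, ZFSet.mem_sep, ← hinU n V hV]
  refine ⟨fun O hO => hO.1, ⟨htX.whole, by rw [hpre.whole]; trivial⟩, ?_, ?_, ?_, ?_⟩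
  · rintro O ⟨hO, hzO⟩ P ⟨hP, hzP⟩
    exact ⟨htX.inter O hO P hP, by rw [hpre.inter O hO P hP]; exact ⟨hzO, hzP⟩⟩
  · rintro O ⟨hO, hzO⟩ C hC hCτ hcov
    -- Finite subsets of `M` are elements of `M`, so unions over them are preserved.
    obtain ⟨c, hc, hcm⟩ := exists_finite_mem_model (M := M) hC
      fun P hP => mem_of_mem_model hτ (hCτ P hP)
    obtain ⟨P, hP, hzP⟩ := hpre.exists_mem htX hO hc (fun P hP => hCτ P ((hcm P).1 hP)) (by
      intro x hx
      obtain ⟨P, hP, hxP⟩ := hcov x hx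
      exact ⟨P, (hcm P).2 hP, hxP⟩) hzO
    exact ⟨P, (hcm P).1 hP, hCτ P ((hcm P).1 hP), hzP⟩
  · rintro a ha ⟨haτ, hza⟩
    obtain ⟨m, hm, V, hV, rfl⟩ := ZFSet.mem_prod.1 ha
    obtain ⟨n, rfl⟩ := mem_natOmega.1 hm
    rw [hsu n V hV] at haτ hza
    have hnM := natSet_mem_model (M := M) n
    have hVM := mem_of_mem_model hσM hV
    have hchild : ∀ {E : Type (u + 1)} [Ctx M E] {f g : E → ZFSet.{u}}, DFun M f → DFun M g →
      Dfn M (fun e => child (f e) (g e)) := Dfn.comp₂ s.dfn_child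
    -- The images carried by the children cover `f[V]`: around `y ∈ V` take a neighborhood with
    -- closure in `g n` and intersect it with `V`. As the cover is in `M`, one child contains the
    -- point.
    let C := τ.sep (fun O => ∃ V', V' ∈ σ ∧
      child (ZFSet.pair (natSet n) V) (ZFSet.pair (insert (natSet n) (natSet n)) V') ∧
      O = X.sep (fun x => ∃ y, y ∈ V' ∧ ZFSet.pair y x ∈ f))
    have hC : C ∈ M := sep_mem_model hτ Dfn.auto
    obtain ⟨O, hO, hzO⟩ := hpre.exists_mem htX haτ hC ZFSet.sep_subset (by
      intro x hx
      obtain ⟨hxX, y, hy, hyx⟩ := ZFSet.mem_sep.1 hx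
      have hyY := htY.subset V hV hy
      have hyg : y ∈ g n := (hYg y (hYZ hyY)).1 hyY n
      obtain ⟨O, hO, P, hP, hyO, hOP, hPg⟩ := hcZ.regular htZ hHZ (hgζ n) hyg
      obtain ⟨Q, hQ, rfl⟩ := (hσ V).1 hV
      have hV' : O ∩ Q ∩ Y ∈ σ := (hσ _).2 ⟨_, htZ.inter O hO Q hQ, rfl⟩
      have hyV' : y ∈ O ∩ Q ∩ Y := by
        simp only [ZFSet.mem_inter] at hy ⊢
        exact ⟨⟨hyO, hy.1⟩, hyY⟩
      refine ⟨_, ZFSet.mem_sep.2 ⟨hf.isOpen _ hV', _, hV', ?_, rfl⟩,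
        ZFSet.mem_sep.2 ⟨hxX, y, hyV', hyx⟩⟩
      refine ⟨natSet n, hm, _, hV, _, hV', rfl, rfl, fun t ht => ?_, P, hP, fun t ht => ?_,
        fun t ht => (hPg t ht).imp_right fun h => ⟨g n, hg.mem n, by simp, h⟩⟩
      · simp only [ZFSet.mem_inter] at ht ⊢
        exact ⟨ht.1.2, ht.2⟩
      · simp only [ZFSet.mem_inter] at ht
        exact hOP t ht.1.1) hza
    obtain ⟨hOτ, V', hV', hch, rfl⟩ := ZFSet.mem_sep.1 hO
    refine ⟨ZFSet.pair (natSet (n + 1)) V', ZFSet.pair_mem_prod.2 ⟨mem_natOmega.2 ⟨_, rfl⟩, hV'⟩,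
      hch, ?_⟩
    rw [hsu (n + 1) V' hV']
    exact ⟨hOτ, hzO⟩
  · rintro O ⟨hO, hzO⟩
    have hOM := mem_of_mem_model hτ hO
    -- By regularity of `X`, the open sets with closure inside `O` cover `O`.
    let C := τ.sep (fun O' => ∃ P, P ∈ τ ∧ (∀ y, y ∈ P → y ∉ O') ∧ ∀ x, x ∈ X → x ∉ O → x ∈ P)
    have hC : C ∈ M := sep_mem_model hτ Dfn.auto
    obtain ⟨O', hO', hzO'⟩ := hpre.exists_mem htX hO hC ZFSet.sep_subset (by
      intro x hx
      have hXO : X \ (X \ O) = O := by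
        ext t
        have : t ∈ O → t ∈ X := fun h => htX.subset O hO h
        simp only [ZFSet.mem_sdiff]
        tauto
      obtain ⟨O', hO', P, hP, hxO', hcP, hdis⟩ := h.regular (X \ O)
        ⟨fun t ht => (ZFSet.mem_sdiff.1 ht).1, by rwa [hXO]⟩ x (htX.subset O hO hx)
        (fun hx' => (ZFSet.mem_sdiff.1 hx').2 hx)
      refine ⟨O', ZFSet.mem_sep.2 ⟨hO', P, hP, fun y hy hy' => ?_, fun t ht ht' => ?_⟩, hxO'⟩
      · exact ZFSet.notMem_empty y (hdis ▸ ZFSet.mem_inter.2 ⟨hy', hy⟩)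
      · exact hcP (ZFSet.mem_sdiff.2 ⟨ht, ht'⟩)) hzO
    obtain ⟨hOτ, P, hP, h1, h2⟩ := ZFSet.mem_sep.1 hO'
    exact ⟨O', ⟨hOτ, hzO'⟩, fun x hx hxO => ⟨P, hP, h2 x hx hxO, h1⟩⟩

/-! ### Points are prime with respect to covers in the model -/

/-- The ideal of the sets that are finitely covered by `C` belongs to `M`. -/
theorem exists_finitely_covered {X C : ZFSet.{u}} (hX : X ∈ M) (hC : C ∈ M) :
    ∃ J ∈ M, ∀ S, S ∈ J ↔ S ∈ M ∧ S ⊆ X ∧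
      ∃ K : Set ZFSet.{u}, K.Finite ∧ (∀ P ∈ K, P ∈ C) ∧ ∀ x ∈ S, ∃ P ∈ K, x ∈ P := by
  -- The ideal is generated by adding one member of `C` at a time, so no quantifier over finite
  -- families has to be expressed in `M`.
  obtain ⟨α, hα, T, hT, -, hTA, hT1, hT2⟩ := exists_lfp (M := M) (powIn_mem hX)
    (R := fun Y S => (∀ x, x ∉ S) ∨ ∃ P, P ∈ C ∧ ∃ S', S' ∈ Y ∧ ∀ x, x ∈ S → x ∈ P ∨ x ∈ S')
    (by
      refine Dfn.or ?_ Dfn.auto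
      exact (Dfn.ball (P := fun _ _ => False) DFun.auto (Dfn.const _)).congr fun _ => Iff.rfl)
  refine ⟨(powIn M X).sep (fun S => ∃ γ, γ ∈ α ∧ ZFSet.pair γ S ∈ T),
    sep_mem_model (powIn_mem hX) Dfn.auto, fun S => ?_⟩
  have hsound : ∀ γ S, ZFSet.pair γ S ∈ T → ∃ K : Set ZFSet.{u}, K.Finite ∧ (∀ P ∈ K, P ∈ C) ∧
      ∀ x ∈ S, ∃ P ∈ K, x ∈ P := by
    intro γ
    induction γ using ZFSet.inductionOn with
    | _ γ ih =>
      intro S h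
      obtain ⟨Y, hY, hR, hy⟩ := hT1 _ _ h
      rcases hR with hR | ⟨P, hP, S', hS', hR⟩
      · exact ⟨∅, finite_empty, by simp, fun x hx => absurd hx (hR x)⟩
      · obtain ⟨δ, hδ, hδT⟩ := hy S' hS'
        obtain ⟨K, hK, hKC, hcov⟩ := ih δ hδ S' hδT
        refine ⟨insert P K, hK.insert P, ?_, fun x hx => ?_⟩
        · rintro Q (rfl | hQ)
          · exact hP
          · exact hKC Q hQ
        · rcases hR x hx with h | h
          · exact ⟨P, Or.inl rfl, h⟩
          · obtain ⟨Q, hQ, hxQ⟩ := hcov x h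
            exact ⟨Q, Or.inr hQ, hxQ⟩
  have hcomp : ∀ K : Set ZFSet.{u}, K.Finite → (∀ P ∈ K, P ∈ C) → ∀ S ∈ powIn M X,
      (∀ x ∈ S, ∃ P ∈ K, x ∈ P) → ∃ γ, ZFSet.pair γ S ∈ T := by
    intro K hK
    induction K, hK using Set.Finite.induction_on with
    | empty =>
      intro _ S hS hcov
      exact hT2 ∅ empty_mem_model S hS (Or.inl fun x hx => by simpa using hcov x hx) (by simp)
    | @insert P K _ _ ih =>
      intro hKC S hS hcov
      obtain ⟨hSX, hSM⟩ := mem_powIn.1 hS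
      have hPM := mem_of_mem_model hC (hKC P (Or.inl rfl))
      have hS' : S \ P ∈ powIn M X := mem_powIn.2 ⟨fun x hx => hSX (ZFSet.mem_sdiff.1 hx).1,
        sdiff_mem_model hSM hPM⟩
      obtain ⟨γ, hγ⟩ := ih (fun Q hQ => hKC Q (Or.inr hQ)) _ hS' (by
        intro x hx
        obtain ⟨hx, hxP⟩ := ZFSet.mem_sdiff.1 hx
        obtain ⟨Q, rfl | hQ, hxQ⟩ := hcov x hx
        · exact absurd hxQ hxP
        · exact ⟨Q, hQ, hxQ⟩)
      refine hT2 {S \ P} (singleton_mem_model (mem_powIn.1 hS').2) S hS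
        (Or.inr ⟨P, hKC P (Or.inl rfl), S \ P, by simp, fun x hx => ?_⟩) ?_
      · rw [ZFSet.mem_sdiff]
        tauto
      · intro y hy
        rw [ZFSet.mem_singleton.1 hy]
        exact ⟨γ, hγ⟩
  rw [ZFSet.mem_sep, mem_powIn]
  constructor
  · rintro ⟨⟨h1, h2⟩, γ, -, h⟩
    exact ⟨h2, h1, hsound γ S h⟩
  · rintro ⟨h2, h1, K, hK, hKC, hcov⟩
    obtain ⟨γ, hγ⟩ := hcomp K hK hKC S (mem_powIn.2 ⟨h1, h2⟩) hcov
    obtain ⟨β, hβ, a, -, he⟩ := hTA _ hγ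
    rw [ZFSet.pair_inj] at he
    exact ⟨⟨h1, h2⟩, γ, he.1 ▸ hβ, hγ⟩

namespace Sieve

variable {X B : ZFSet.{u}} {s : Sieve M X B} {G : Set ZFSet.{u}}

/-- For a single space this is preservation of unions; a trace in a product inherits only primeness
for finite covers, and completeness of the sieve supplies the rest. If `C` contained no member of
`G`, no member of `G` would be finitely covered by `C`. A branch of the sieve in `M` whose nodes are
not finitely covered then has a cluster point avoiding every member of `C`. -/
theorem Point.exists_mem_of_cover_whole (h : s.Point G) {C : ZFSet.{u}} (hC : C ∈ M)
    (hCB : ∀ P ∈ C, P ∈ B) (hcov : ∀ x ∈ X, ∃ P ∈ C, x ∈ P) : ∃ P ∈ C, P ∈ G := by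
  by_contra hcon
  push Not at hcon
  have hX := s.space_mem
  have hA := s.A_mem
  have hinU : ∀ {E : Type (u + 1)} [Ctx M E] {f g : E → ZFSet.{u}}, DFun M f → DFun M g →
    Dfn M (fun e => s.inU (f e) (g e)) := Dfn.comp₂ s.dfn_inU
  have hch : ∀ {E : Type (u + 1)} [Ctx M E] {f g : E → ZFSet.{u}}, DFun M f → DFun M g →
    Dfn M (fun e => s.child (f e) (g e)) := Dfn.comp₂ s.dfn_child
  have hCX : ∀ P ∈ C, P ⊆ X := fun P hP => s.base_subset P (hCB P hP)
  obtain ⟨J, hJ, hJm⟩ := exists_finitely_covered hX hC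
  have hGJ : ∀ O ∈ G, O ∉ J := by
    intro O hO hOJ
    obtain ⟨-, -, K, hK, hKC, hKcov⟩ := (hJm O).1 hOJ
    obtain ⟨P, hP, hPG⟩ := h.cover O hO K hK (fun P hP => hCB P (hKC P hP)) hKcov
    exact hcon P (hKC P hP) hPG
  have huM : ∀ a ∈ M, s.u a ∈ M := fun a ha => sep_mem_model hX Dfn.auto
  -- `G` is not available in `M`, but the weaker requirement that a child is not in the ideal `J` is
  -- definable there, and the nodes in `G` satisfy it without dead ends.
  obtain ⟨a, ha, ha0, haA, haQ⟩ := exists_branch hA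
    (Q := fun a b => s.child a b ∧ X.sep (fun x => s.inU b x) ∉ J) Dfn.auto
    (S := {a | a ∈ s.A ∧ s.u a ∈ G}) (fun a ha => ha.1) (by
      rintro a ⟨ha, haG⟩
      obtain ⟨b, hb, hab, hbG⟩ := h.child a ha haG
      exact ⟨b, ⟨hb, hbG⟩, hab, hGJ _ hbG⟩) (a₀ := s.r) ⟨s.r_mem, by rw [u_root]; exact h.whole⟩
  have haS : seqSet a ∈ M := ha
  have hω := natOmega_mem_model (M := M)
  have haJ : ∀ n, s.u (a n) ∉ J := by
    intro n
    cases n with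
    | zero => rw [ha0, u_root]; exact hGJ _ h.whole
    | succ n => exact (haQ n).2
  have hle : ∀ m n, m ≤ n → ∀ x, s.inU (a n) x → s.inU (a m) x :=
    fun m n hmn x => inU_of_le (fun n => (haQ n).1) hmn
  let F := (powIn M X).sep (fun S => ∃ K, K ∈ J ∧ ∃ i, i ∈ natOmega ∧ ∃ c, c ∈ s.A ∧
    ZFSet.pair i c ∈ seqSet a ∧ S = X.sep (fun x => s.inU c x ∧ x ∉ K))
  have hF : F ∈ M := sep_mem_model (powIn_mem hX) Dfn.auto
  have hFm : ∀ S, S ∈ F ↔ ∃ K ∈ J, ∃ n, S = X.sep (fun x => s.inU (a n) x ∧ x ∉ K) := by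
    intro S
    rw [ZFSet.mem_sep, mem_powIn]
    constructor
    · rintro ⟨-, K, hK, i, hi, c, -, hic, hS⟩
      obtain ⟨n, rfl⟩ := mem_natOmega.1 hi
      rw [pair_mem_seqSet] at hic
      subst hic
      exact ⟨K, hK, n, hS⟩
    · rintro ⟨K, hK, n, rfl⟩
      have hKM := mem_of_mem_model hJ hK
      have han := ha.mem n
      exact ⟨⟨ZFSet.sep_subset, sep_mem_model hX Dfn.auto⟩, K, hK, natSet n,
        mem_natOmega.2 ⟨n, rfl⟩, a n, haA n, by simp, rfl⟩
  obtain ⟨x, hx, hxF⟩ := s.complete a ha haA ha0 (fun n => (haQ n).1) F hF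
    (fun S hS => (mem_powIn.1 (ZFSet.mem_sep.1 hS).1).1) (by
      intro S hS
      obtain ⟨K, hK, n, rfl⟩ := (hFm S).1 hS
      by_contra hno
      push Not at hno
      obtain ⟨-, -, L, hL, hLC, hLcov⟩ := (hJm K).1 hK
      refine haJ n ((hJm _).2 ⟨huM _ (ha.mem n), fun x hx => (mem_u.1 hx).1, L, hL, hLC,
        fun x hx => ?_⟩)
      by_contra hxL
      obtain ⟨hxX, hxU⟩ := mem_u.1 hx
      exact hno x (ZFSet.mem_sep.2 ⟨hxX, hxU, fun hxK => hxL (hLcov x hxK)⟩)) (by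
      intro S hS S' hS'
      obtain ⟨K, hK, n, rfl⟩ := (hFm S).1 hS
      obtain ⟨K', hK', n', rfl⟩ := (hFm S').1 hS'
      have hKK : K ∪ K' ∈ J := by
        obtain ⟨h1, h2, L, hL, hLC, hLcov⟩ := (hJm K).1 hK
        obtain ⟨h1', h2', L', hL', hLC', hLcov'⟩ := (hJm K').1 hK'
        refine (hJm _).2 ⟨union_mem_model h1 h1', fun x hx => ?_, L ∪ L', hL.union hL', ?_, ?_⟩
        · exact (ZFSet.mem_union.1 hx).elim (fun h => h2 h) (fun h => h2' h)
        · rintro P (hP | hP)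
          · exact hLC P hP
          · exact hLC' P hP
        · intro x hx
          rcases ZFSet.mem_union.1 hx with hx | hx
          · obtain ⟨P, hP, hxP⟩ := hLcov x hx
            exact ⟨P, Or.inl hP, hxP⟩
          · obtain ⟨P, hP, hxP⟩ := hLcov' x hx
            exact ⟨P, Or.inr hP, hxP⟩
      refine ⟨_, (hFm _).2 ⟨_, hKK, max n n', rfl⟩, fun x hx => ?_, fun x hx => ?_⟩ <;>
      obtain ⟨hxX, hxU, hxK⟩ := ZFSet.mem_sep.1 hx <;>
      rw [ZFSet.mem_union, not_or] at hxK
      · exact ZFSet.mem_sep.2 ⟨hxX, hle _ _ (le_max_left _ _) x hxU, hxK.1⟩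
      · exact ZFSet.mem_sep.2 ⟨hxX, hle _ _ (le_max_right _ _) x hxU, hxK.2⟩) (by
      intro n
      refine ⟨_, (hFm _).2 ⟨∅, (hJm _).2 ⟨empty_mem_model, ZFSet.empty_subset X, ∅, finite_empty,
        by simp, by simp⟩, n, rfl⟩, fun x hx => (ZFSet.mem_sep.1 hx).2.1⟩)
  obtain ⟨P, hP, hxP⟩ := hcov x hx
  have hPJ : P ∈ J := (hJm P).2 ⟨mem_of_mem_model hC hP, hCX P hP, {P}, finite_singleton P,
    by rintro _ rfl; exact hP, fun x hx => ⟨P, rfl, hx⟩⟩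
  -- `P` belongs to `J`, so `X \ P` (the root minus `P`) is in `F`, yet it would have to meet the
  -- neighborhood `P` of `x`.
  obtain ⟨y, hy, hyP⟩ := hxF P (hCB P hP) hxP _ ((hFm _).2 ⟨P, hPJ, 0, rfl⟩)
  exact (ZFSet.mem_sep.1 hy).2.2 hyP

/-- Adding the basic sets disjoint from some `O' ∈ G` with closure in `O` turns the cover of `O`
into a cover of `X`; none of the added sets is in `G`. -/
theorem Point.exists_mem_of_cover (h : s.Point G) {O C : ZFSet.{u}} (hO : O ∈ G) (hC : C ∈ M)
    (hCB : ∀ P ∈ C, P ∈ B) (hcov : ∀ x ∈ O, ∃ P ∈ C, x ∈ P) : ∃ P ∈ C, P ∈ G := by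
  have hB := s.base_mem
  obtain ⟨O', hO', hreg⟩ := h.regular O hO
  have hO'M := mem_of_mem_model hB (h.subset O' hO')
  obtain ⟨P, hP, hPG⟩ := h.exists_mem_of_cover_whole
    (C := B.sep (fun P => P ∈ C ∨ ∀ y, y ∈ P → y ∉ O')) (sep_mem_model hB Dfn.auto)
    (fun P hP => (ZFSet.mem_sep.1 hP).1) (by
      intro x hx
      by_cases hxO : x ∈ O
      · obtain ⟨P, hP, hxP⟩ := hcov x hxO
        exact ⟨P, ZFSet.mem_sep.2 ⟨hCB P hP, Or.inl hP⟩, hxP⟩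
      · obtain ⟨P, hP, hxP, hdis⟩ := hreg x hx hxO
        exact ⟨P, ZFSet.mem_sep.2 ⟨hP, Or.inr hdis⟩, hxP⟩)
  rcases (ZFSet.mem_sep.1 hP).2 with hPC | hdis
  · exact ⟨P, hPC, hPG⟩
  · obtain ⟨y, hy⟩ := h.nonempty (h.inter P hPG O' hO')
    obtain ⟨h1, h2⟩ := ZFSet.mem_inter.1 hy
    exact absurd h2 (hdis y h1)

end Sieve

/-! ### Ranked true statements about a point -/

namespace Sieve

variable {X B : ZFSet.{u}}

/-- The open sets of `M`. -/
noncomputable def top (_s : Sieve M X B) : ZFSet.{u} :=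
  (powIn M X).sep (fun W => ∀ x, x ∈ W → ∃ O, O ∈ B ∧ x ∈ O ∧ O ⊆ W)

theorem mem_top {s : Sieve M X B} {W : ZFSet.{u}} :
    W ∈ s.top ↔ (W ⊆ X ∧ W ∈ M) ∧ ∀ x ∈ W, ∃ O ∈ B, x ∈ O ∧ O ⊆ W := by
  rw [top, ZFSet.mem_sep, mem_powIn]

theorem top_mem (s : Sieve M X B) : s.top ∈ M := by
  have hX := s.space_mem
  have hB := s.base_mem
  exact sep_mem_model (powIn_mem hX) Dfn.auto

/-- The point with the trace `G` belongs to the interpretation of the open set `W`. -/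
def Forces (G : Set ZFSet.{u}) (W : ZFSet.{u}) : Prop := ∃ O ∈ G, O ⊆ W

/-- `Truth s G β D` says that the Borel set `D` contains the point with the trace `G`, by a
derivation of rank at most `β`. -/
inductive Truth (s : Sieve M X B) (G : Set ZFSet.{u}) : ZFSet.{u} → ZFSet.{u} → Prop
  | basic (β D W : ZFSet.{u}) (hW : W ∈ s.top) (hG : ¬ Forces G W)
      (h : ∀ x ∈ X, x ∉ W → x ∈ D) : Truth s G β D
  | mono (β D γ C : ZFSet.{u}) (hγ : γ ∈ β) (hC : C ∈ powIn M X) (h : Truth s G γ C)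
      (hCD : C ⊆ D) : Truth s G β D
  -- Only the sequence of sets has to be in `M`; the sequence of ranks is chosen in the universe.
  | inter (β D : ZFSet.{u}) (t : ℕ → ZFSet.{u}) (ht : SeqIn M t) (htX : ∀ i, t i ∈ powIn M X)
      (γ : ℕ → ZFSet.{u}) (hγ : ∀ i, γ i ∈ β) (h : ∀ i, Truth s G (γ i) (t i))
      (hD : ∀ x ∈ X, (∀ i, x ∈ t i) → x ∈ D) : Truth s G β D

theorem Point.exists_forces {s : Sieve M X B} {G : Set ZFSet.{u}} (h : s.Point G)
    {O p : ZFSet.{u}} (hO : O ∈ G) (hp : p ∈ M) (hpt : ∀ W ∈ p, W ∈ s.top)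
    (hcov : ∀ x ∈ O, ∃ W ∈ p, x ∈ W) : ∃ W ∈ p, Forces G W := by
  have hB := s.base_mem
  obtain ⟨P, hP, hPG⟩ := h.exists_mem_of_cover hO (C := B.sep (fun P => ∃ W, W ∈ p ∧ P ⊆ W))
    (sep_mem_model hB Dfn.auto) (fun P hP => (ZFSet.mem_sep.1 hP).1) (by
      intro x hx
      obtain ⟨W, hW, hxW⟩ := hcov x hx
      obtain ⟨O, hO, hxO, hOW⟩ := (mem_top.1 (hpt W hW)).2 x hxW
      exact ⟨O, ZFSet.mem_sep.2 ⟨hO, W, hW, hOW⟩, hxO⟩)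
  obtain ⟨-, W, hW, hPW⟩ := ZFSet.mem_sep.1 hP
  exact ⟨W, hW, P, hPG, hPW⟩

/-! ### Conditions and steps of the search -/

/-- The statement that the point belongs to `D`, with the rank `δ`. -/
noncomputable abbrev stm (δ D : ZFSet.{u}) : ZFSet.{u} := ZFSet.pair (natSet 0) (ZFSet.pair δ D)

/-- The record that the point belongs to all terms of the sequence `t`. -/
noncomputable abbrev rcd (δ t : ZFSet.{u}) : ZFSet.{u} := ZFSet.pair (natSet 1) (ZFSet.pair δ t)

/-- The statement that the point does not belong to the open set `W`. -/
noncomputable abbrev neg (W : ZFSet.{u}) : ZFSet.{u} := ZFSet.pair (natSet 2) W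

/-- What has to be done at the `n`-th step about the members of `p`. -/
def Meets (M : Set ZFSet.{u}) (X top R n p q : ZFSet.{u}) : Prop :=
  (∀ δ, δ ∈ R → ∀ D, D ∈ powIn M X → stm δ D ∈ p →
    (∃ W, W ∈ top ∧ neg W ∈ q ∧ ∀ x, x ∈ X → x ∉ W → x ∈ D) ∨
    (∃ γ, γ ∈ δ ∧ ∃ C, C ∈ powIn M X ∧ stm γ C ∈ q ∧ C ⊆ D) ∨
    ∃ t, t ∈ powIn M (natOmega.prod (powIn M X)) ∧ rcd δ t ∈ q ∧
      ∀ x, x ∈ X → (∀ i, i ∈ natOmega → ∃ C, C ∈ powIn M X ∧ ZFSet.pair i C ∈ t ∧ x ∈ C) → x ∈ D) ∧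
  -- Only the terms with index below `n` are treated, so finite conditions have finite extensions;
  -- every term is treated eventually because conditions grow.
  ∀ δ, δ ∈ R → ∀ t, t ∈ powIn M (natOmega.prod (powIn M X)) → rcd δ t ∈ p → ∀ i, i ∈ n →
    ∃ γ, γ ∈ δ ∧ ∃ C, C ∈ powIn M X ∧ ZFSet.pair i C ∈ t ∧ stm γ C ∈ q

/-- One step of the search for a point with given properties. -/
def SearchStep (s : Sieve M X B) (R I c d : ZFSet.{u}) : Prop :=
  ∃ n, n ∈ natOmega ∧ ∃ a, a ∈ s.A ∧ ∃ p, p ∈ powIn M I ∧ ∃ b, b ∈ s.A ∧ ∃ q, q ∈ powIn M I ∧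
    c = ZFSet.pair n (ZFSet.pair a p) ∧ d = ZFSet.pair (insert n n) (ZFSet.pair b q) ∧
    -- The node is not covered by the excluded open sets, which will keep the filter base nonempty.
    s.child a b ∧ p ⊆ q ∧ (∃ x, x ∈ X ∧ s.inU b x ∧ ∀ W, W ∈ s.top → neg W ∈ q → x ∉ W) ∧
    Meets M X s.top R n p q

theorem dfn_searchStep (s : Sieve M X B) {R I : ZFSet.{u}} (hR : R ∈ M) (hI : I ∈ M) :
    Dfn M (fun q : M × M => SearchStep s R I q.1 q.2) := by
  have hX := s.space_mem
  have hA := s.A_mem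
  have hω := natOmega_mem_model (M := M)
  have htop := s.top_mem
  have h0 := natSet_mem_model (M := M) 0
  have h1 := natSet_mem_model (M := M) 1
  have h2 := natSet_mem_model (M := M) 2
  have hPX := powIn_mem hX
  have hQX := powIn_mem (prod_mem_model hω hPX)
  have hPI := powIn_mem hI
  have hinU : ∀ {E : Type (u + 1)} [Ctx M E] {f g : E → ZFSet.{u}}, DFun M f → DFun M g →
    Dfn M (fun e => s.inU (f e) (g e)) := Dfn.comp₂ s.dfn_inU
  have hch : ∀ {E : Type (u + 1)} [Ctx M E] {f g : E → ZFSet.{u}}, DFun M f → DFun M g →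
    Dfn M (fun e => s.child (f e) (g e)) := Dfn.comp₂ s.dfn_child
  unfold SearchStep Meets
  exact Dfn.auto

end Sieve

/-! ### True conditions, and the point found by the search -/

namespace Sieve

variable {X B : ZFSet.{u}}

/-- The members of the conditions of the search, with ranks in `R`. -/
noncomputable def items (s : Sieve M X B) (R : ZFSet.{u}) : ZFSet.{u} :=
  natOmega.prod ((R.prod (powIn M X) ∪ R.prod (powIn M (natOmega.prod (powIn M X)))) ∪ s.top)

theorem items_mem (s : Sieve M X B) {R : ZFSet.{u}} (hR : R ∈ M) : s.items R ∈ M := by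
  have hX := powIn_mem s.space_mem
  exact prod_mem_model natOmega_mem_model (union_mem_model (union_mem_model (prod_mem_model hR hX)
    (prod_mem_model hR (powIn_mem (prod_mem_model natOmega_mem_model hX)))) s.top_mem)

/-- The true members of conditions. -/
inductive TrueItem (s : Sieve M X B) (G : Set ZFSet.{u}) (R : ZFSet.{u}) : ZFSet.{u} → Prop
  | stm (δ D : ZFSet.{u}) (hδ : δ ∈ R) (hD : D ∈ powIn M X) (h : Truth s G δ D) :
      TrueItem s G R (stm δ D)
  | rcd (δ : ZFSet.{u}) (t : ℕ → ZFSet.{u}) (hδ : δ ∈ R) (ht : SeqIn M t)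
      (htX : ∀ i, t i ∈ powIn M X) (γ : ℕ → ZFSet.{u}) (hγ : ∀ i, γ i ∈ δ)
      (h : ∀ i, Truth s G (γ i) (t i)) : TrueItem s G R (rcd δ (seqSet t))
  | neg (W : ZFSet.{u}) (hW : W ∈ s.top) (hG : ¬ Forces G W) : TrueItem s G R (neg W)

theorem seqSet_mem_powIn {t : ℕ → ZFSet.{u}} {A : ZFSet.{u}} (ht : SeqIn M t)
    (htA : ∀ i, t i ∈ A) : seqSet t ∈ powIn M (natOmega.prod A) := by
  refine mem_powIn.2 ⟨fun p hp => ?_, ht⟩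
  obtain ⟨n, rfl⟩ := mem_seqSet.1 hp
  exact ZFSet.pair_mem_prod.2 ⟨mem_natOmega.2 ⟨n, rfl⟩, htA n⟩

theorem TrueItem.mem_items {s : Sieve M X B} {G : Set ZFSet.{u}} {R x : ZFSet.{u}}
    (h : TrueItem s G R x) : x ∈ s.items R := by
  cases h with
  | stm δ D hδ hD h =>
    refine ZFSet.pair_mem_prod.2 ⟨mem_natOmega.2 ⟨_, rfl⟩, ?_⟩
    rw [ZFSet.mem_union, ZFSet.mem_union]
    exact Or.inl (Or.inl (ZFSet.pair_mem_prod.2 ⟨hδ, hD⟩))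
  | rcd δ t hδ ht htX γ hγ h =>
    refine ZFSet.pair_mem_prod.2 ⟨mem_natOmega.2 ⟨_, rfl⟩, ?_⟩
    rw [ZFSet.mem_union, ZFSet.mem_union]
    exact Or.inl (Or.inr (ZFSet.pair_mem_prod.2 ⟨hδ, seqSet_mem_powIn ht htX⟩))
  | neg W hW hG =>
    refine ZFSet.pair_mem_prod.2 ⟨mem_natOmega.2 ⟨_, rfl⟩, ?_⟩
    rw [ZFSet.mem_union]
    exact Or.inr hW

theorem TrueItem.neg_inv {s : Sieve M X B} {G : Set ZFSet.{u}} {R W : ZFSet.{u}}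
    (h : TrueItem s G R (Sieve.neg W)) : ¬ Forces G W := by
  generalize hx : Sieve.neg W = x at h
  cases h with
  | neg W' hW hG =>
    rw [(ZFSet.pair_inj.1 hx).2]
    exact hG
  | rcd => exact absurd (natSet_injective (ZFSet.pair_inj.1 hx).1) (by decide)
  | stm => exact absurd (natSet_injective (ZFSet.pair_inj.1 hx).1) (by decide)

/-- Conditions can be extended so as to meet the requirements of the next step. -/
theorem Truth.exists_meets {s : Sieve M X B} {G : Set ZFSet.{u}} {R : ZFSet.{u}}
    (hR : R.IsTransitive) (n : ℕ) {K : Set ZFSet.{u}} (hK : K.Finite)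
    (hKt : ∀ x ∈ K, TrueItem s G R x) :
    ∃ L : Set ZFSet.{u}, L.Finite ∧ K ⊆ L ∧ (∀ x ∈ L, TrueItem s G R x) ∧
      ∀ p q : ZFSet.{u}, (∀ x, x ∈ p ↔ x ∈ K) → (∀ x, x ∈ q ↔ x ∈ L) →
        Meets M X s.top R (natSet n) p q := by
  -- The requirement of a single member of `p`. It is monotone in `L`, so the answers for the
  -- finitely many members can be united.
  let Req : ZFSet.{u} → Set ZFSet.{u} → Prop := fun x L =>
    (∀ δ D, x = Sieve.stm δ D →
      (∃ W, W ∈ s.top ∧ Sieve.neg W ∈ L ∧ ∀ x, x ∈ X → x ∉ W → x ∈ D) ∨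
      (∃ γ, γ ∈ δ ∧ ∃ C, C ∈ powIn M X ∧ Sieve.stm γ C ∈ L ∧ C ⊆ D) ∨
      ∃ t, t ∈ powIn M (natOmega.prod (powIn M X)) ∧ Sieve.rcd δ t ∈ L ∧
        ∀ x, x ∈ X → (∀ i, i ∈ natOmega → ∃ C, C ∈ powIn M X ∧ ZFSet.pair i C ∈ t ∧ x ∈ C) →
          x ∈ D) ∧
    ∀ δ t, x = Sieve.rcd δ t → ∀ i, i ∈ natSet n →
      ∃ γ, γ ∈ δ ∧ ∃ C, C ∈ powIn M X ∧ ZFSet.pair i C ∈ t ∧ Sieve.stm γ C ∈ L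
  have hmono : ∀ x (L L' : Set ZFSet.{u}), L ⊆ L' → Req x L → Req x L' := by
    rintro x L L' hLL ⟨h1, h2⟩
    refine ⟨fun δ D hx => ?_, fun δ t hx i hi => ?_⟩
    · rcases h1 δ D hx with ⟨W, h, h', h''⟩ | ⟨γ, h, C, h', h'', h3⟩ | ⟨t, h, h', h''⟩
      · exact Or.inl ⟨W, h, hLL h', h''⟩
      · exact Or.inr (Or.inl ⟨γ, h, C, h', hLL h'', h3⟩)
      · exact Or.inr (Or.inr ⟨t, h, hLL h', h''⟩)
    · obtain ⟨γ, h, C, h', h'', h3⟩ := h2 δ t hx i hi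
      exact ⟨γ, h, C, h', h'', hLL h3⟩
  have hone : ∀ x ∈ K, ∃ L : Set ZFSet.{u}, L.Finite ∧ (∀ x ∈ L, TrueItem s G R x) ∧ Req x L := by
    intro x hx
    have hxt := hKt x hx
    cases hxt with
    | stm δ D hδ hD h =>
      have hno : ∀ (L : Set ZFSet.{u}) δ' t, Sieve.stm δ D = Sieve.rcd δ' t → ∀ i, i ∈ natSet n →
          ∃ γ, γ ∈ δ' ∧ ∃ C, C ∈ powIn M X ∧ ZFSet.pair i C ∈ t ∧ Sieve.stm γ C ∈ L :=
        fun L δ' t he => absurd (natSet_injective (ZFSet.pair_inj.1 he).1) (by decide)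
      cases h with
      | basic _ _ W hW hG hWD =>
        refine ⟨{Sieve.neg W}, finite_singleton _, ?_, fun δ' D' he => ?_, hno _⟩
        · rintro _ rfl
          exact .neg W hW hG
        · obtain ⟨rfl, rfl⟩ := ZFSet.pair_inj.1 (ZFSet.pair_inj.1 he).2
          exact Or.inl ⟨W, hW, rfl, hWD⟩
      | mono _ _ γ C hγ hC h hCD =>
        refine ⟨{Sieve.stm γ C}, finite_singleton _, ?_, fun δ' D' he => ?_, hno _⟩
        · rintro _ rfl
          exact .stm γ C (hR.subset_of_mem hδ hγ) hC h
        · obtain ⟨rfl, rfl⟩ := ZFSet.pair_inj.1 (ZFSet.pair_inj.1 he).2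
          exact Or.inr (Or.inl ⟨γ, hγ, C, hC, rfl, hCD⟩)
      | inter _ _ t ht htX γ hγ h hD =>
        refine ⟨{Sieve.rcd δ (seqSet t)}, finite_singleton _, ?_, fun δ' D' he => ?_, hno _⟩
        · rintro _ rfl
          exact .rcd δ t hδ ht htX γ hγ h
        · obtain ⟨rfl, rfl⟩ := ZFSet.pair_inj.1 (ZFSet.pair_inj.1 he).2
          refine Or.inr (Or.inr ⟨seqSet t, seqSet_mem_powIn ht htX, rfl, fun x hx hall => ?_⟩)
          refine hD x hx fun i => ?_
          obtain ⟨C, -, hC, hxC⟩ := hall (natSet i) (mem_natOmega.2 ⟨i, rfl⟩)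
          rw [pair_mem_seqSet] at hC
          rwa [← hC]
    | rcd δ t hδ ht htX γ hγ h =>
      -- The ranks `γ i` of the true derivations serve as the answers for the first `n` terms.
      refine ⟨(fun i => Sieve.stm (γ i) (t i)) '' {i | i < n}, (finite_lt_nat n).image _, ?_,
        fun δ' D' he => absurd (natSet_injective (ZFSet.pair_inj.1 he).1) (by decide), ?_⟩
      · rintro _ ⟨i, -, rfl⟩
        exact .stm _ _ (hR.subset_of_mem hδ (hγ i)) (htX i) (h i)
      · intro δ' t' he i hi
        obtain ⟨rfl, rfl⟩ := ZFSet.pair_inj.1 (ZFSet.pair_inj.1 he).2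
        obtain ⟨m, hm, rfl⟩ := mem_natSet_iff.1 hi
        exact ⟨γ m, hγ m, t m, htX m, by simp, m, hm, rfl⟩
    | neg W hW hG =>
      exact ⟨∅, finite_empty, by simp,
        fun δ' D' he => absurd (natSet_injective (ZFSet.pair_inj.1 he).1) (by decide),
        fun δ' D' he => absurd (natSet_injective (ZFSet.pair_inj.1 he).1) (by decide)⟩
  choose! f hf1 hf2 hf3 using hone
  refine ⟨K ∪ ⋃ x ∈ K, f x, hK.union (hK.biUnion fun x hx => hf1 x hx), subset_union_left, ?_, ?_⟩
  · rintro x (hx | hx)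
    · exact hKt x hx
    · obtain ⟨y, hy, hxy⟩ := mem_iUnion₂.1 hx
      exact hf2 y hy x hxy
  · intro p q hp hq
    have hreq : ∀ x ∈ p, Req x {x | x ∈ q} := fun x hx => by
      have hxK := (hp x).1 hx
      refine hmono x _ _ (fun y hy => ?_) (hf3 x hxK)
      exact (hq y).2 (Or.inr (mem_iUnion₂.2 ⟨x, hxK, hy⟩))
    exact ⟨fun δ _ D _ hx => (hreq _ hx).1 δ D rfl, fun δ _ t _ hx => (hreq _ hx).2 δ t rfl⟩

/-- A set of `M` that contains a point of an extension of the space, by a derivation whose rank is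
in `M`, is nonempty. -/
theorem Truth.exists_mem {s : Sieve M X B} {G : Set ZFSet.{u}} (h : s.Point G) {β D : ZFSet.{u}}
    (hβ : β ∈ M) (hβo : β.IsOrdinal) (hD : D ∈ powIn M X) (ht : Truth s G β D) :
    ∃ x ∈ X, x ∈ D := by
  -- A transitive set of `M` that contains every rank occurring below `β`, so the conditions form a
  -- set of `M`.
  let R : ZFSet.{u} := insert β β
  have hR : R ∈ M := insert_mem_model hβ hβ
  have hRt : R.IsTransitive := (ZFSet.isOrdinal_succ hβo).isTransitive
  let I := s.items R
  have hI : I ∈ M := s.items_mem hR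
  have hX := s.space_mem
  have hA := s.A_mem
  have hω := natOmega_mem_model (M := M)
  have htop := s.top_mem
  have h2M := natSet_mem_model (M := M) 2
  have hPI := powIn_mem hI
  have hinU : ∀ {E : Type (u + 1)} [Ctx M E] {f g : E → ZFSet.{u}}, DFun M f → DFun M g →
    Dfn M (fun e => s.inU (f e) (g e)) := Dfn.comp₂ s.dfn_inU
  let c₀ : ZFSet.{u} := ZFSet.pair (natSet 0) (ZFSet.pair s.r {Sieve.stm β D})
  -- The family `S`, which is visible only in the universe, consists of conditions whose node
  -- contains the point and whose members are finitely many true items. Such conditions can always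
  -- be extended, so `M` has an infinite search.
  obtain ⟨c, hc, hc0, hcA, hcQ⟩ := exists_branch
    (A := natOmega.prod (s.A.prod (powIn M I))) (prod_mem_model hω (prod_mem_model hA hPI))
    (dfn_searchStep s hR hI)
    (S := {c | ∃ (n : ℕ) (a p : ZFSet.{u}) (K : Set ZFSet.{u}), c = ZFSet.pair (natSet n)
      (ZFSet.pair a p) ∧ a ∈ s.A ∧ s.u a ∈ G ∧ p ∈ M ∧ K.Finite ∧ (∀ x, x ∈ p ↔ x ∈ K) ∧
      ∀ x ∈ K, TrueItem s G R x}) (by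
      rintro _ ⟨n, a, p, K, rfl, ha, -, hp, -, hpK, hKt⟩
      refine ZFSet.pair_mem_prod.2 ⟨mem_natOmega.2 ⟨n, rfl⟩, ZFSet.pair_mem_prod.2 ⟨ha, ?_⟩⟩
      exact mem_powIn.2 ⟨fun x hx => (hKt x ((hpK x).1 hx)).mem_items, hp⟩) (by
      rintro _ ⟨n, a, p, K, rfl, ha, haG, hp, hK, hpK, hKt⟩
      obtain ⟨L, hL, hKL, hLt, hmeet⟩ := Truth.exists_meets hRt n hK hKt
      obtain ⟨b, hb, hab, hbG⟩ := h.child a ha haG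
      obtain ⟨q, hq, hqL⟩ := exists_finite_mem_model (M := M) hL
        fun x hx => mem_of_mem_model hI (hLt x hx).mem_items
      refine ⟨_, ⟨n + 1, b, q, L, rfl, hb, hbG, hq, hL, hqL, hLt⟩, natSet n,
        mem_natOmega.2 ⟨n, rfl⟩, a, ha, p, mem_powIn.2
          ⟨fun x hx => (hKt x ((hpK x).1 hx)).mem_items, hp⟩, b, hb, q, mem_powIn.2
          ⟨fun x hx => (hLt x ((hqL x).1 hx)).mem_items, hq⟩, rfl, rfl, hab,
          fun x hx => (hqL x).2 (hKL ((hpK x).1 hx)), ?_, hmeet p q hpK hqL⟩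
      -- If the excluded sets covered the node of `b`, primeness would put the point into one of
      -- them, although it is truly outside.
      by_contra hno
      push Not at hno
      obtain ⟨W, hW, hGW⟩ := h.exists_forces hbG
        (p := s.top.sep (fun W => Sieve.neg W ∈ q)) (sep_mem_model htop Dfn.auto)
        (fun W hW => (ZFSet.mem_sep.1 hW).1) (by
          intro x hx
          obtain ⟨hxX, hxb⟩ := mem_u.1 hx
          obtain ⟨W, hW, hWq, hxW⟩ := hno x hxX hxb
          exact ⟨W, ZFSet.mem_sep.2 ⟨hW, hWq⟩, hxW⟩)
      obtain ⟨-, hWq⟩ := ZFSet.mem_sep.1 hW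
      exact (hLt _ ((hqL _).1 hWq)).neg_inv hGW)
    (a₀ := c₀) ⟨0, s.r, {Sieve.stm β D}, {Sieve.stm β D}, rfl, s.r_mem, by
      rw [u_root]; exact h.whole, singleton_mem_model (pair_mem_model (natSet_mem_model 0)
      (pair_mem_model hβ (mem_powIn.1 hD).2)), finite_singleton _, by simp, by
      rintro _ rfl
      exact .stm β D (ZFSet.mem_insert _ _) hD ht⟩
  have hex : ∀ n, ∃ a ∈ s.A, ∃ p ∈ powIn M I, c n = ZFSet.pair (natSet n) (ZFSet.pair a p) := by
    intro n
    induction n with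
    | zero =>
      obtain ⟨_, -, d, hd, he⟩ := ZFSet.mem_prod.1 (hcA 0)
      obtain ⟨a, ha, p, hp, rfl⟩ := ZFSet.mem_prod.1 hd
      refine ⟨a, ha, p, hp, ?_⟩
      rw [he]
      rw [hc0, ZFSet.pair_inj] at he
      rw [← he.1]
    | succ n ih =>
      obtain ⟨a, ha, p, hp, he⟩ := ih
      obtain ⟨m, -, _, -, _, -, b, hb, q, hq, h1, h2, -⟩ := hcQ n
      rw [he, ZFSet.pair_inj] at h1
      exact ⟨b, hb, q, hq, by rw [h2, ← h1.1, natSet]⟩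
  choose a haA p hpI hcp using hex
  have hstep : ∀ n, s.child (a n) (a (n + 1)) ∧ p n ⊆ p (n + 1) ∧
      (∃ x, x ∈ X ∧ s.inU (a (n + 1)) x ∧ ∀ W, W ∈ s.top → Sieve.neg W ∈ p (n + 1) → x ∉ W) ∧
      Meets M X s.top R (natSet n) (p n) (p (n + 1)) := by
    intro n
    obtain ⟨m, -, a', -, p', -, b, -, q, -, h1, h2, h3⟩ := hcQ n
    rw [hcp, ZFSet.pair_inj, ZFSet.pair_inj] at h1 h2
    obtain ⟨rfl, rfl, rfl⟩ := h1
    obtain ⟨-, rfl, rfl⟩ := h2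
    exact h3
  have h0 : a 0 = s.r ∧ p 0 = {Sieve.stm β D} := by
    have := (hcp 0).symm.trans hc0
    rw [ZFSet.pair_inj, ZFSet.pair_inj] at this
    exact this.2
  have hpmono : ∀ m n, m ≤ n → p m ⊆ p n := by
    intro m n hmn
    induction hmn with
    | refl => exact fun _ h => h
    | step _ ih => exact fun x hx => (hstep _).2.1 (ih hx)
  have hcS : seqSet c ∈ M := hc
  have ha : SeqIn M a := by
    refine seqIn_of_graph hA haA (R := fun i y => ∃ q, q ∈ powIn M I ∧
      ZFSet.pair i (ZFSet.pair i (ZFSet.pair y q)) ∈ seqSet c) Dfn.auto fun n y _ => ?_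
    simp only [pair_mem_seqSet, hcp, ZFSet.pair_inj, true_and]
    exact ⟨fun ⟨_, _, h, _⟩ => h, fun h => ⟨p n, hpI n, h, rfl⟩⟩
  -- The nodes along the branch minus the open sets excluded so far: a decreasing sequence of
  -- nonempty sets in `M`.
  let F := (powIn M X).sep (fun S => ∃ i, i ∈ natOmega ∧ ∃ b, b ∈ s.A ∧ ∃ q, q ∈ powIn M I ∧
    ZFSet.pair i (ZFSet.pair i (ZFSet.pair b q)) ∈ seqSet c ∧
    S = X.sep (fun x => s.inU b x ∧ ∀ W, W ∈ s.top → Sieve.neg W ∈ q → x ∉ W))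
  have hF : F ∈ M := sep_mem_model (powIn_mem hX) Dfn.auto
  have hFm : ∀ S, S ∈ F ↔ ∃ n, S = X.sep (fun x => s.inU (a n) x ∧
      ∀ W, W ∈ s.top → Sieve.neg W ∈ p n → x ∉ W) := by
    intro S
    rw [ZFSet.mem_sep, mem_powIn]
    constructor
    · rintro ⟨-, i, hi, b, -, q, -, hic, hS⟩
      obtain ⟨n, rfl⟩ := mem_natOmega.1 hi
      rw [pair_mem_seqSet, hcp, ZFSet.pair_inj, ZFSet.pair_inj] at hic
      obtain ⟨-, rfl, rfl⟩ := hic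
      exact ⟨n, hS⟩
    · rintro ⟨n, rfl⟩
      have han := ha.mem n
      have hpn := (mem_powIn.1 (hpI n)).2
      exact ⟨⟨ZFSet.sep_subset, sep_mem_model hX Dfn.auto⟩, natSet n, mem_natOmega.2 ⟨n, rfl⟩, a n,
        haA n, p n, hpI n, by simp [hcp], rfl⟩
  have hdec : ∀ m n, m ≤ n → ∀ x, (s.inU (a n) x ∧ ∀ W, W ∈ s.top → Sieve.neg W ∈ p n → x ∉ W) →
      s.inU (a m) x ∧ ∀ W, W ∈ s.top → Sieve.neg W ∈ p m → x ∉ W :=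
    fun m n hmn x hx => ⟨inU_of_le (fun n => (hstep n).1) hmn hx.1,
      fun W hW hWp => hx.2 W hW (hpmono m n hmn hWp)⟩
  obtain ⟨x, hx, hxF⟩ := s.complete a ha haA h0.1 (fun n => (hstep n).1) F hF
    (fun S hS => (mem_powIn.1 (ZFSet.mem_sep.1 hS).1).1) (by
      intro S hS
      obtain ⟨n, rfl⟩ := (hFm S).1 hS
      obtain ⟨x, hx, h1, h2⟩ := (hstep n).2.2.1
      exact ⟨x, ZFSet.mem_sep.2 ⟨hx, hdec n (n + 1) (Nat.le_succ n) x ⟨h1, h2⟩⟩⟩) (by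
      intro S hS S' hS'
      obtain ⟨n, rfl⟩ := (hFm S).1 hS
      obtain ⟨n', rfl⟩ := (hFm S').1 hS'
      refine ⟨_, (hFm _).2 ⟨max n n', rfl⟩, fun x hx => ?_, fun x hx => ?_⟩ <;>
      obtain ⟨hxX, hx⟩ := ZFSet.mem_sep.1 hx
      · exact ZFSet.mem_sep.2 ⟨hxX, hdec _ _ (le_max_left _ _) x hx⟩
      · exact ZFSet.mem_sep.2 ⟨hxX, hdec _ _ (le_max_right _ _) x hx⟩)
    fun n => ⟨_, (hFm _).2 ⟨n, rfl⟩, fun x hx => (ZFSet.mem_sep.1 hx).2.1⟩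
  -- Exclusion from an open set passes to cluster points: a neighborhood of `x` inside `W` would
  -- meet a set disjoint from `W`.
  have hneg : ∀ n, ∀ W ∈ s.top, Sieve.neg W ∈ p n → x ∉ W := by
    intro n W hW hWp hxW
    obtain ⟨O, hO, hxO, hOW⟩ := (mem_top.1 hW).2 x hxW
    obtain ⟨y, hy, hyO⟩ := hxF O hO hxO _ ((hFm _).2 ⟨n, rfl⟩)
    exact (ZFSet.mem_sep.1 hy).2.2 W hW hWp (hOW hyO)
  -- On the branch nothing is known about truth at the original point; only the decreasing ranks
  -- remain, and they suffice for an induction at `x`.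
  have key : ∀ δ, δ ∈ R → ∀ n, ∀ C ∈ powIn M X, Sieve.stm δ C ∈ p n → x ∈ C := by
    intro δ
    induction δ using ZFSet.inductionOn with
    | _ δ ih =>
      intro hδ n C hC hCp
      rcases (hstep n).2.2.2.1 δ hδ C hC hCp with ⟨W, hW, hWq, hWC⟩ | ⟨γ, hγ, C', hC', hCq, hCC⟩ |
        ⟨t, ht, htq, htC⟩
      · exact hWC x hx (hneg _ W hW hWq)
      · exact hCC (ih γ hγ (hRt.subset_of_mem hδ hγ) _ C' hC' hCq)
      · refine htC x hx fun i hi => ?_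
        obtain ⟨i, rfl⟩ := mem_natOmega.1 hi
        -- At this stage the record, present since `n + 1`, is still there and the index `i` is
        -- among those treated.
        let m := max (n + 1) (i + 1)
        obtain ⟨γ, hγ, C', hC', hiC, hCq⟩ := (hstep m).2.2.2.2 δ hδ t ht
          (hpmono (n + 1) m (le_max_left _ _) htq) (natSet i)
          (mem_natSet_iff.2 ⟨i, lt_of_lt_of_le (Nat.lt_succ_self i) (le_max_right _ _), rfl⟩)
        exact ⟨C', hC', hiC, ih γ hγ (hRt.subset_of_mem hδ hγ) _ C' hC' hCq⟩
  exact ⟨x, hx, key β (ZFSet.mem_insert _ _) 0 D hD (by rw [h0.2]; simp)⟩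

end Sieve

/-! ### Truth values of Borel sets at a point -/

theorem sdiff_sdiff_of_subset {X C : ZFSet.{u}} (h : C ⊆ X) : X \ (X \ C) = C := by
  ext x
  simp only [ZFSet.mem_sdiff]
  exact ⟨fun ⟨h1, h2⟩ => by_contra fun h3 => h2 ⟨h1, h3⟩, fun hx => ⟨h hx, fun h2 => h2.2 hx⟩⟩

theorem mem_zfIUnion {t : ℕ → ZFSet.{u}} {x : ZFSet.{u}} : x ∈ ZFSet.iUnion t ↔ ∃ i, x ∈ t i :=
  ZFSet.mem_iUnion

theorem seqIn_two {C D : ZFSet.{u}} (hC : C ∈ M) (hD : D ∈ M) :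
    SeqIn M (fun n => if n = 0 then C else D) := by
  have h0 := empty_mem_model (M := M)
  refine seqIn_of_graph (A := {C, D}) (insert_mem_model hC (singleton_mem_model hD)) (fun n => ?_)
    (R := fun i y => (i = ∅ ∧ y = C) ∨ (i ≠ ∅ ∧ y = D)) Dfn.auto fun n y _ => ?_
  · split_ifs <;> simp
  · have : natSet.{u} n = ∅ ↔ n = 0 := natSet_inj (n := 0)
    simp only [this, ne_eq]
    by_cases hn : n = 0 <;> simp [hn]

namespace Sieve

variable {X B : ZFSet.{u}}

/-- `TV s G D b` says that `b` is the truth value of the statement that the point with the trace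
`G` belongs to the interpretation of the Borel set `D`. -/
inductive TV (s : Sieve M X B) (G : Set ZFSet.{u}) : ZFSet.{u} → Prop → Prop
  | ofOpen (W : ZFSet.{u}) (hW : W ∈ s.top) : TV s G W (Forces G W)
  | compl (C : ZFSet.{u}) (b : Prop) (h : TV s G C b) : TV s G (X \ C) (¬ b)
  | iUnion (t : ℕ → ZFSet.{u}) (b : ℕ → Prop) (ht : SeqIn M t) (h : ∀ i, TV s G (t i) (b i)) :
      TV s G (ZFSet.iUnion t) (∃ i, b i)

variable {s : Sieve M X B} {G : Set ZFSet.{u}}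

theorem Truth.weaken {β β' D D' : ZFSet.{u}} (h : Truth s G β D) (hβ : β ⊆ β') (hD : D ⊆ D') :
    Truth s G β' D' := by
  cases h with
  | basic _ _ W hW hG h => exact .basic _ _ W hW hG fun x hx hxW => hD (h x hx hxW)
  | mono _ _ γ C hγ hC h hCD => exact .mono _ _ γ C (hβ hγ) hC h fun x hx => hD (hCD hx)
  | inter _ _ t ht htX γ hγ h hD' =>
    exact .inter _ _ t ht htX γ (fun i => hβ (hγ i)) h fun x hx hxt => hD (hD' x hx hxt)

/-- The intersection is true with a rank one above both, as a countable intersection of two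
alternating choices, and true sets are nonempty. -/
theorem Truth.not_disjoint (h : s.Point G) {β₁ β₂ D₁ D₂ : ZFSet.{u}} (hβ₁ : β₁ ∈ M)
    (hβ₂ : β₂ ∈ M) (ho₁ : β₁.IsOrdinal) (ho₂ : β₂.IsOrdinal) (hD₁ : D₁ ∈ powIn M X)
    (hD₂ : D₂ ∈ powIn M X) (h₁ : Truth s G β₁ D₁) (h₂ : Truth s G β₂ D₂) :
    ∃ x ∈ X, x ∈ D₁ ∧ x ∈ D₂ := by
  obtain ⟨β, hβ, ho, h₁', h₂'⟩ : ∃ β ∈ M, β.IsOrdinal ∧ β₁ ⊆ β ∧ β₂ ⊆ β := by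
    rcases ho₁.subset_total ho₂ with h | h
    · exact ⟨β₂, hβ₂, ho₂, h, fun _ h => h⟩
    · exact ⟨β₁, hβ₁, ho₁, fun _ h => h, h⟩
  have hD₁' := (mem_powIn.1 hD₁).2
  have hD₂' := (mem_powIn.1 hD₂).2
  obtain ⟨x, hx, hxD⟩ := Truth.exists_mem h (β := insert β β) (D := D₁ ∩ D₂)
    (insert_mem_model hβ hβ) (ZFSet.isOrdinal_succ ho)
    (mem_powIn.2 ⟨fun x hx => (mem_powIn.1 hD₁).1 (ZFSet.mem_inter.1 hx).1,
      inter_mem_model hD₁' hD₂'⟩)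
    (.inter _ _ (fun n => if n = 0 then D₁ else D₂) (seqIn_two hD₁' hD₂')
      (fun i => by split_ifs <;> assumption) (fun _ => β)
      (fun _ => ZFSet.mem_insert _ _)
      (fun i => by
        split_ifs
        · exact h₁.weaken h₁' fun _ h => h
        · exact h₂.weaken h₂' fun _ h => h)
      fun x _ hx => ZFSet.mem_inter.2 ⟨by simpa using hx 0, by simpa using hx 1⟩)
  exact ⟨x, hx, ZFSet.mem_inter.1 hxD⟩

/-- Derivations start from closed sets, so a forced open set must contain a true one. By regularity
it contains the closure of some `O' ∈ G`; the exterior of `O'` is not forced because it is disjoint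
from `O'`. -/
theorem Truth.of_forces (h : s.Point G) {W : ZFSet.{u}} (hW : Forces G W) (β : ZFSet.{u}) :
    Truth s G β W := by
  have hB := s.base_mem
  have hX := s.space_mem
  obtain ⟨O, hO, hOW⟩ := hW
  obtain ⟨O', hO', hdis⟩ := h.regular O hO
  have hO'M := mem_of_mem_model hB (h.subset O' hO')
  refine .basic β W (X.sep fun x => ∃ P, P ∈ B ∧ x ∈ P ∧ ∀ y, y ∈ P → y ∉ O')
    (mem_top.2 ⟨⟨ZFSet.sep_subset, sep_mem_model hX Dfn.auto⟩, fun x hx => ?_⟩) ?_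
    fun x hx hxW => ?_
  · obtain ⟨-, P, hP, hxP, hPO⟩ := ZFSet.mem_sep.1 hx
    exact ⟨P, hP, hxP, fun y hy => ZFSet.mem_sep.2 ⟨s.base_subset P hP hy, P, hP, hy, hPO⟩⟩
  · rintro ⟨P, hP, hPW⟩
    obtain ⟨x, hx⟩ := h.nonempty (h.inter P hP O' hO')
    rw [ZFSet.mem_inter] at hx
    obtain ⟨-, Q, -, hxQ, hQ⟩ := ZFSet.mem_sep.1 (hPW hx.1)
    exact hQ x hxQ hx.2
  · refine hOW (by_contra fun hxO => hxW ?_)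
    obtain ⟨P, hP, hxP, hPO⟩ := hdis x hx hxO
    exact ZFSet.mem_sep.2 ⟨hx, P, hP, hxP, hPO⟩

/-- The rank bound must come from `M`, while truth at the point is evaluated outside. `M` ranks its
Borel sets by an inductive generation `T`, and a set of rank `β` or its complement has a derivation
of rank `β`. The truth value decides which of the two it is. -/
theorem TV.exists_truth (h : s.Point G) : ∃ α ∈ M, α.IsOrdinal ∧ ∀ D b, TV s G D b →
    D ∈ powIn M X ∧ (b → Truth s G α D) ∧ (¬ b → Truth s G α (X \ D)) := by
  have hX := s.space_mem
  have htop := s.top_mem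
  have hPX := powIn_mem hX
  have hω := natOmega_mem_model (M := M)
  have hQX := powIn_mem (prod_mem_model hω hPX)
  obtain ⟨α, hα, T, hT, hαo, hTα, hTR, hRT⟩ := exists_lfp hPX (R := fun Y a =>
    a ∈ s.top ∨ (∃ C, C ∈ Y ∧ a = X \ C) ∨ ∃ t, t ∈ powIn M (natOmega.prod (powIn M X)) ∧
      (∀ i, i ∈ natOmega → ∃ C, C ∈ Y ∧ ∀ C', C' ∈ powIn M X → (ZFSet.pair i C' ∈ t ↔ C' = C)) ∧
      ∀ x, x ∈ X → (x ∈ a ↔ ∃ i, i ∈ natOmega ∧ ∃ C, C ∈ powIn M X ∧ ZFSet.pair i C ∈ t ∧ x ∈ C))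
    Dfn.auto
  have hTm : ∀ β D, ZFSet.pair β D ∈ T → β ∈ α ∧ D ∈ powIn M X := by
    intro β D hβ
    obtain ⟨β', hβ', D', hD', he⟩ := hTα _ hβ
    obtain ⟨rfl, rfl⟩ := ZFSet.pair_inj.1 he
    exact ⟨hβ', hD'⟩
  have hcm : ∀ {D}, D ∈ powIn M X → X \ D ∈ powIn M X := fun {D} hD => mem_powIn.2
    ⟨fun x hx => (ZFSet.mem_sdiff.1 hx).1, sdiff_mem_model hX (mem_powIn.1 hD).2⟩
  have hcs : ∀ {t : ℕ → ZFSet.{u}}, SeqIn M t → (∀ i, t i ∈ powIn M X) →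
      SeqIn M (fun i => X \ t i) := by
    intro t ht htX
    have htS : seqSet t ∈ M := ht
    refine seqIn_of_graph hPX (fun i => hcm (htX i)) (R := fun i y => ∃ C, C ∈ powIn M X ∧
      ZFSet.pair i C ∈ seqSet t ∧ y = X \ C) Dfn.auto fun n y _ => ?_
    simp only [pair_mem_seqSet]
    exact ⟨by rintro ⟨_, _, rfl, rfl⟩; rfl, fun hy => ⟨_, htX n, rfl, hy⟩⟩
  -- Induction on the Borel rank: a union is true if some term is, and otherwise its complement is
  -- the intersection of the true complements of the terms.
  have hdec : ∀ β D, ZFSet.pair β D ∈ T → Truth s G β D ∨ Truth s G β (X \ D) := by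
    intro β
    induction β using ZFSet.inductionOn with
    | _ β ih =>
      intro D hβ
      obtain ⟨Y, hY, hR, hYT⟩ := hTR β D hβ
      have hD := (hTm β D hβ).2
      rcases hR with hD' | ⟨C, hC, rfl⟩ | ⟨t, ht, htY, htD⟩
      · by_cases hf : Forces G D
        · exact .inl (Truth.of_forces h hf β)
        · exact .inr (.basic _ _ D hD' hf fun x hx hxD => ZFSet.mem_sdiff.2 ⟨hx, hxD⟩)
      · obtain ⟨γ, hγ, hγC⟩ := hYT C hC
        have hCX := (hTm γ C hγC).2
        rcases ih γ hγ C hγC with h1 | h1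
        · right
          rw [sdiff_sdiff_of_subset (mem_powIn.1 hCX).1]
          exact .mono _ _ γ C hγ hCX h1 fun _ h => h
        · exact .inl (.mono _ _ γ _ hγ hD h1 fun _ h => h)
      · have hch : ∀ n, ∃ C γ, γ ∈ β ∧ ZFSet.pair γ C ∈ T ∧
            ∀ C', C' ∈ powIn M X → (ZFSet.pair (natSet n) C' ∈ t ↔ C' = C) := by
          intro n
          obtain ⟨C, hC, hCt⟩ := htY (natSet n) (mem_natOmega.2 ⟨n, rfl⟩)
          obtain ⟨γ, hγ, hγC⟩ := hYT C hC
          exact ⟨C, γ, hγ, hγC, hCt⟩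
        choose c γ hγ hγc hct using hch
        have hcX := fun n => (hTm _ _ (hγc n)).2
        have htM := (mem_powIn.1 ht).2
        have hc : SeqIn M c := seqIn_of_graph hPX hcX (R := fun i y => ZFSet.pair i y ∈ t)
          Dfn.auto fun n y hy => hct n y hy
        have hD2 : ∀ x, x ∈ D ↔ ∃ n, x ∈ c n := by
          intro x
          constructor
          · intro hx
            obtain ⟨i, hi, C, hC, hiC, hxC⟩ := (htD x ((mem_powIn.1 hD).1 hx)).1 hx
            obtain ⟨n, rfl⟩ := mem_natOmega.1 hi
            rw [(hct n C hC).1 hiC] at hxC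
            exact ⟨n, hxC⟩
          · rintro ⟨n, hn⟩
            exact (htD x ((mem_powIn.1 (hcX n)).1 hn)).2
              ⟨_, mem_natOmega.2 ⟨n, rfl⟩, _, hcX n, (hct n _ (hcX n)).2 rfl, hn⟩
        by_cases hex : ∃ n, Truth s G (γ n) (c n)
        · obtain ⟨n, hn⟩ := hex
          exact .inl (.mono _ _ _ _ (hγ n) (hcX n) hn fun x hx => (hD2 x).2 ⟨n, hx⟩)
        · push Not at hex
          refine .inr (.inter _ _ _ (hcs hc hcX) (fun i => hcm (hcX i)) γ hγ
            (fun n => (ih _ (hγ n) _ (hγc n)).resolve_left (hex n)) fun x hx hxc => ?_)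
          rw [ZFSet.mem_sdiff, hD2]
          exact ⟨hx, fun ⟨n, hn⟩ => (ZFSet.mem_sdiff.1 (hxc n)).2 hn⟩
  refine ⟨α, hα, hαo, fun D b hDb => ?_⟩
  suffices hs : (∃ β, ZFSet.pair β D ∈ T) ∧ (b → Truth s G α D) ∧ (¬ b → Truth s G α (X \ D)) by
    obtain ⟨⟨β, hβ⟩, h1⟩ := hs
    exact ⟨(hTm β D hβ).2, h1⟩
  induction hDb with
  | ofOpen W hW =>
    have hW' := (mem_top.1 hW).1
    refine ⟨hRT ∅ empty_mem_model W (mem_powIn.2 hW') (.inl hW) (by simp),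
      fun hf => Truth.of_forces h hf α,
      fun hf => .basic _ _ W hW hf fun x hx hxD => ZFSet.mem_sdiff.2 ⟨hx, hxD⟩⟩
  | compl C b _ ih =>
    obtain ⟨⟨β, hβ⟩, h1, h2⟩ := ih
    have hC := (hTm β C hβ).2
    have hCM := (mem_powIn.1 hC).2
    refine ⟨hRT {C} (singleton_mem_model hCM) _ (hcm hC) (.inr (.inl ⟨C, by simp, rfl⟩)) ?_,
      h2, fun hb => ?_⟩
    · intro y hy
      rw [ZFSet.mem_singleton.1 hy]
      exact ⟨β, hβ⟩
    · rw [sdiff_sdiff_of_subset (mem_powIn.1 hC).1]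
      exact h1 (not_not.1 hb)
  | iUnion t b ht _ ih =>
    choose hβ h1 h2 using ih
    choose β hβ using hβ
    have htX := fun n => (hTm _ _ (hβ n)).2
    have htS : seqSet t ∈ M := ht
    have hU : ZFSet.iUnion t ∈ powIn M X := by
      refine mem_powIn.2 ⟨fun x hx => ?_, ?_⟩
      · obtain ⟨n, hn⟩ := mem_zfIUnion.1 hx
        exact (mem_powIn.1 (htX n)).1 hn
      · have : ZFSet.iUnion t = X.sep (fun x => ∃ i, i ∈ natOmega ∧ ∃ C, C ∈ powIn M X ∧
            ZFSet.pair i C ∈ seqSet t ∧ x ∈ C) := by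
          ext x
          rw [mem_zfIUnion, ZFSet.mem_sep]
          constructor
          · rintro ⟨n, hn⟩
            exact ⟨(mem_powIn.1 (htX n)).1 hn, _, mem_natOmega.2 ⟨n, rfl⟩, _, htX n, by simp, hn⟩
          · rintro ⟨-, i, hi, C, -, hiC, hx⟩
            obtain ⟨n, rfl⟩ := mem_natOmega.1 hi
            rw [pair_mem_seqSet] at hiC
            exact ⟨n, hiC ▸ hx⟩
        rw [this]
        exact sep_mem_model hX Dfn.auto
    refine ⟨hRT ((powIn M X).sep fun C => ∃ i, i ∈ natOmega ∧ ZFSet.pair i C ∈ seqSet t)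
      (sep_mem_model hPX Dfn.auto) _ hU (.inr (.inr ⟨_, seqSet_mem_powIn ht htX, ?_, ?_⟩)) ?_,
      ?_, ?_⟩
    · intro i hi
      obtain ⟨n, rfl⟩ := mem_natOmega.1 hi
      exact ⟨t n, ZFSet.mem_sep.2 ⟨htX n, _, hi, by simp⟩, fun C' _ => pair_mem_seqSet⟩
    · intro x hx
      rw [mem_zfIUnion]
      constructor
      · rintro ⟨n, hn⟩
        exact ⟨_, mem_natOmega.2 ⟨n, rfl⟩, _, htX n, by simp, hn⟩
      · rintro ⟨i, hi, C, -, hiC, hx⟩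
        obtain ⟨n, rfl⟩ := mem_natOmega.1 hi
        rw [pair_mem_seqSet] at hiC
        exact ⟨n, hiC ▸ hx⟩
    · intro y hy
      obtain ⟨-, i, hi, hiy⟩ := ZFSet.mem_sep.1 hy
      obtain ⟨n, rfl⟩ := mem_natOmega.1 hi
      rw [pair_mem_seqSet] at hiy
      exact ⟨β n, hiy ▸ hβ n⟩
    · rintro ⟨n, hn⟩
      exact (h1 n hn).weaken (fun _ h => h) fun x hx => mem_zfIUnion.2 ⟨n, hx⟩
    · intro hb
      push Not at hb
      have hβα := fun n => (hTm _ _ (hβ n)).1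
      refine .inter _ _ _ (hcs ht htX) (fun i => hcm (htX i)) β hβα (fun n => ?_) fun x hx hxt => ?_
      -- The induction hypothesis gives the complement of `t n` only rank `α`, too large for the
      -- intersection rule. A derivation of rank `β n` exists for `t n` or for its complement; the
      -- former is impossible, since disjoint sets are not both true.
      · refine (hdec _ _ (hβ n)).resolve_left fun hn => ?_
        obtain ⟨x, -, hx1, hx2⟩ := Truth.not_disjoint h (mem_of_mem_model hα (hβα n)) hα
          (hαo.mem (hβα n)) hαo (htX n) (hcm (htX n)) hn (h2 n (hb n))
        exact (ZFSet.mem_sdiff.1 hx2).2 hx1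
      · rw [ZFSet.mem_sdiff, mem_zfIUnion]
        exact ⟨hx, fun ⟨n, hn⟩ => (ZFSet.mem_sdiff.1 (hxt n)).2 hn⟩

theorem TV.mem_powIn (h : s.Point G) {D : ZFSet.{u}} {b : Prop} (ht : TV s G D b) :
    D ∈ powIn M X := by
  obtain ⟨α, -, -, hα⟩ := TV.exists_truth h
  exact (hα D b ht).1

/-- The transfer from the interpretation to `M`, with the ranks eliminated. -/
theorem TV.exists_mem (h : s.Point G) {D : ZFSet.{u}} {b : Prop} (ht : TV s G D b) (hb : b) :
    ∃ x ∈ X, x ∈ D := by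
  obtain ⟨α, hα, hαo, hαt⟩ := TV.exists_truth h
  obtain ⟨h1, h2, -⟩ := hαt D b ht
  exact Truth.exists_mem h hα hαo h1 (h2 hb)

theorem TV.inter (h : s.Point G) {C D : ZFSet.{u}} {b c : Prop} (hC : TV s G C b)
    (hD : TV s G D c) : TV s G (C ∩ D) (b ∧ c) := by
  have hX := s.space_mem
  obtain ⟨h1, h1'⟩ := AnalyticAbs.mem_powIn.1 (hC.mem_powIn h)
  obtain ⟨h2, h2'⟩ := AnalyticAbs.mem_powIn.1 (hD.mem_powIn h)
  have := (TV.iUnion (s := s) (G := G) (fun n => if n = 0 then X \ C else X \ D)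
    (fun n => if n = 0 then ¬ b else ¬ c) (seqIn_two (sdiff_mem_model hX h1')
    (sdiff_mem_model hX h2')) fun i => by
      split_ifs
      · exact hC.compl
      · exact hD.compl).compl
  convert this using 1
  · ext x
    simp only [ZFSet.mem_inter, ZFSet.mem_sdiff, mem_zfIUnion]
    constructor
    · rintro ⟨hx1, hx2⟩
      refine ⟨h1 hx1, fun ⟨n, hn⟩ => ?_⟩
      split_ifs at hn
      · exact (ZFSet.mem_sdiff.1 hn).2 hx1
      · exact (ZFSet.mem_sdiff.1 hn).2 hx2
    · rintro ⟨hx, hno⟩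
      exact ⟨by_contra fun hxC => hno ⟨0, by simpa using ⟨hx, hxC⟩⟩,
        by_contra fun hxC => hno ⟨1, by simpa using ⟨hx, hxC⟩⟩⟩
  · constructor
    · rintro hbc ⟨n, hn⟩
      split_ifs at hn
      · exact hn hbc.1
      · exact hn hbc.2
    · intro hno
      exact ⟨by_contra fun hb => hno ⟨0, by simpa⟩, by_contra fun hb => hno ⟨1, by simpa⟩⟩

end Sieve

/-! ### Tuples and coordinate maps between finite products -/

theorem tuple_injective {n : ℕ} {a b : Fin n → ZFSet.{u}} (h : tuple a = tuple b) : a = b := by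
  induction n with
  | zero => exact Subsingleton.elim _ _
  | succ n ih =>
    obtain ⟨h0, h1⟩ := ZFSet.pair_inj.1 h
    have h2 := ih h1
    funext k
    exact Fin.cases h0 (fun i => congrFun h2 i) k

theorem mem_prodSet {n : ℕ} {X : Fin n → ZFSet.{u}} {t : ZFSet.{u}} :
    t ∈ prodSet X ↔ ∃ a : Fin n → ZFSet.{u}, (∀ k, a k ∈ X k) ∧ t = tuple a := by
  induction n generalizing t with
  | zero => simp [prodSet, tuple]
  | succ n ih =>
    rw [prodSet, ZFSet.mem_prod]
    constructor
    · rintro ⟨x, hx, y, hy, rfl⟩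
      obtain ⟨a, ha, rfl⟩ := ih.1 hy
      exact ⟨Fin.cons x a, fun k => by refine Fin.cases ?_ ?_ k <;> simp [hx, ha], by simp [tuple]⟩
    · rintro ⟨a, ha, rfl⟩
      exact ⟨a 0, ha 0, _, ih.2 ⟨_, fun k => ha _, rfl⟩, rfl⟩

theorem tuple_mem_prodSet {n : ℕ} {X a : Fin n → ZFSet.{u}} :
    tuple a ∈ prodSet X ↔ ∀ k, a k ∈ X k := by
  rw [mem_prodSet]
  refine ⟨fun ⟨b, hb, he⟩ => ?_, fun h => ⟨a, h, rfl⟩⟩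
  rwa [tuple_injective he]

theorem DFun.tuple {n : ℕ} {f : E → Fin n → ZFSet.{u}} (hf : ∀ k, DFun M (fun e => f e k)) :
    DFun M (fun e => tuple (f e)) := by
  induction n with
  | zero => exact DFun.const empty_mem_model
  | succ n ih => exact DFun.pair (hf 0) (ih fun k => hf k.succ)

theorem prodSet_mem_model {n : ℕ} {X : Fin n → ZFSet.{u}} (hX : ∀ k, X k ∈ M) :
    prodSet X ∈ M := by
  induction n with
  | zero => exact singleton_mem_model empty_mem_model
  | succ n ih => exact prod_mem_model (hX 0) (ih fun k => hX k.succ)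

/-- The set of tuples in the product whose coordinates selected by `e` form a tuple in `B`. -/
noncomputable def pre {m n : ℕ} (X : Fin n → ZFSet.{u}) (e : Fin m → Fin n) (B : ZFSet.{u}) :
    ZFSet.{u} :=
  (prodSet X).sep fun t => ∃ a : Fin n → ZFSet.{u}, t = tuple a ∧ tuple (fun i => a (e i)) ∈ B

section Pre

variable {m n : ℕ} {X : Fin n → ZFSet.{u}} {e : Fin m → Fin n}

theorem tuple_mem_pre {B : ZFSet.{u}} {a : Fin n → ZFSet.{u}} :
    tuple a ∈ pre X e B ↔ (∀ k, a k ∈ X k) ∧ tuple (fun i => a (e i)) ∈ B := by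
  rw [pre, ZFSet.mem_sep, tuple_mem_prodSet]
  refine and_congr_right fun _ => ⟨fun ⟨b, hb, h⟩ => ?_, fun h => ⟨a, rfl, h⟩⟩
  rwa [tuple_injective hb]

theorem mem_pre {B t : ZFSet.{u}} : t ∈ pre X e B ↔
    ∃ a : Fin n → ZFSet.{u}, (∀ k, a k ∈ X k) ∧ t = tuple a ∧ tuple (fun i => a (e i)) ∈ B := by
  constructor
  · intro h
    obtain ⟨a, -, rfl⟩ := mem_prodSet.1 (ZFSet.mem_sep.1 h).1
    exact ⟨a, (tuple_mem_pre.1 h).1, rfl, (tuple_mem_pre.1 h).2⟩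
  · rintro ⟨a, ha, rfl, h⟩
    exact tuple_mem_pre.2 ⟨ha, h⟩

/-- The coordinates of tuples in the product lie in `M`, so the quantifier over tuples can be
bounded to finite tuples from `M`. -/
theorem DFun.pre (hX : ∀ k, X k ∈ M) {f : E → ZFSet.{u}} (hf : DFun M f) :
    DFun M (fun q => pre X e (f q)) := by
  have hP := prodSet_mem_model hX
  have key : ∀ q, AnalyticAbs.pre X e (f q) = (prodSet X).sep fun t => ∃ a : Fin n → M,
      t = AnalyticAbs.tuple (fun k => (a k : ZFSet.{u})) ∧
      AnalyticAbs.tuple (fun i => (a (e i) : ZFSet.{u})) ∈ f q := by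
    intro q
    ext t
    rw [AnalyticAbs.pre, ZFSet.mem_sep, ZFSet.mem_sep]
    refine and_congr_right fun ht => ⟨fun ⟨a, h1, h2⟩ => ?_, fun ⟨a, h1, h2⟩ =>
      ⟨fun k => a k, h1, h2⟩⟩
    rw [h1, tuple_mem_prodSet] at ht
    exact ⟨fun k => ⟨a k, mem_of_mem_model (hX k) (ht k)⟩, h1, h2⟩
  rw [funext key]
  refine DFun.sep (DFun.const hP) (Dfn.exCtx (Dfn.and (Dfn.eq DFun.auto (DFun.tuple fun k => ?_))
    (Dfn.mem (DFun.tuple fun k => ?_) ?_)))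
  · exact DFun.coe (PFun.app (PFun.snd PFun.id) k)
  · exact DFun.coe (PFun.app (PFun.snd PFun.id) (e k))
  · exact hf.comp (PFun.fst (PFun.fst PFun.id))

theorem pre_mem_model (hX : ∀ k, X k ∈ M) {B : ZFSet.{u}} (hB : B ∈ M) : pre X e B ∈ M :=
  (DFun.pre (E := M) (e := e) hX (DFun.const hB)).1 ⟨B, hB⟩

theorem pre_compl (B : ZFSet.{u}) :
    pre X e (prodSet (fun i => X (e i)) \ B) = prodSet X \ pre X e B := by
  ext t
  rw [ZFSet.mem_sdiff]
  constructor
  · intro h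
    obtain ⟨a, ha, rfl, haB⟩ := mem_pre.1 h
    exact ⟨tuple_mem_prodSet.2 ha, fun h' => (ZFSet.mem_sdiff.1 haB).2 (tuple_mem_pre.1 h').2⟩
  · rintro ⟨ht, h⟩
    obtain ⟨a, ha, rfl⟩ := mem_prodSet.1 ht
    rw [tuple_mem_pre] at h ⊢
    exact ⟨ha, ZFSet.mem_sdiff.2 ⟨tuple_mem_prodSet.2 fun i => ha _, fun h' => h ⟨ha, h'⟩⟩⟩

theorem pre_iUnion (t : ℕ → ZFSet.{u}) :
    pre X e (ZFSet.iUnion t) = ZFSet.iUnion fun i => pre X e (t i) := by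
  ext x
  simp only [mem_zfIUnion, mem_pre]
  exact ⟨fun ⟨a, h1, h2, i, h3⟩ => ⟨i, a, h1, h2, h3⟩, fun ⟨i, a, h1, h2, h3⟩ => ⟨a, h1, h2, i, h3⟩⟩

/-- The map `e` may repeat coordinates: `P k` is the intersection of `X k` with all `O i` such that
`e i = k`. -/
theorem exists_pullback {G : Fin n → Set ZFSet.{u}} (hX : ∀ k, X k ∈ G k)
    (hG : ∀ k, ∀ O ∈ G k, ∀ P ∈ G k, O ∩ P ∈ G k) {O : Fin m → ZFSet.{u}}
    (hO : ∀ i, O i ∈ G (e i)) :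
    ∃ P : Fin n → ZFSet.{u}, (∀ k, P k ∈ G k) ∧
      ∀ k x, x ∈ P k ↔ x ∈ X k ∧ ∀ i, e i = k → x ∈ O i := by
  have h : ∀ k, ∀ s : Finset (Fin m), ∃ P ∈ G k, ∀ x, x ∈ P ↔ x ∈ X k ∧
      ∀ i ∈ s, e i = k → x ∈ O i := by
    intro k s
    induction s using Finset.induction_on with
    | empty => exact ⟨X k, hX k, by simp⟩
    | insert j s _ ih =>
      obtain ⟨P, hP, hPx⟩ := ih
      by_cases hj : e j = k
      · refine ⟨P ∩ O j, hG k P hP _ (hj ▸ hO j), fun x => ?_⟩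
        simp only [ZFSet.mem_inter, hPx, Finset.forall_mem_insert, hj, true_imp_iff]
        tauto
      · refine ⟨P, hP, fun x => ?_⟩
        simp only [hPx, Finset.forall_mem_insert, hj, false_imp_iff, true_and]
  choose P hP hPx using fun k => h k Finset.univ
  exact ⟨P, hP, fun k x => by simp [hPx]⟩

theorem prodSet_subset_pre {O : Fin m → ZFSet.{u}} {P : Fin n → ZFSet.{u}}
    (hP : ∀ k x, x ∈ P k ↔ x ∈ X k ∧ ∀ i, e i = k → x ∈ O i) :
    prodSet P ⊆ pre X e (prodSet O) := by
  intro t ht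
  obtain ⟨a, ha, rfl⟩ := mem_prodSet.1 ht
  exact tuple_mem_pre.2 ⟨fun k => ((hP _ _).1 (ha k)).1,
    tuple_mem_prodSet.2 fun i => ((hP _ _).1 (ha (e i))).2 i rfl⟩

theorem pre_mono {B C : ZFSet.{u}} (h : B ⊆ C) : pre X e B ⊆ pre X e C := by
  intro t ht
  obtain ⟨a, ha, rfl, hB⟩ := mem_pre.1 ht
  exact tuple_mem_pre.2 ⟨ha, h hB⟩

/-- In a nonempty box a single coordinate can be changed while the others stay fixed. -/
theorem subset_of_prodSet_subset_pre {O : Fin m → ZFSet.{u}} {P : Fin n → ZFSet.{u}}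
    (hne : ∃ t, t ∈ prodSet P) (h : prodSet P ⊆ pre X e (prodSet O)) (i : Fin m) :
    P (e i) ⊆ O i := by
  intro x hx
  obtain ⟨t, ht⟩ := hne
  obtain ⟨a, ha, rfl⟩ := mem_prodSet.1 ht
  have h1 : tuple (Function.update a (e i) x) ∈ prodSet P := by
    rw [tuple_mem_prodSet]
    intro k
    by_cases hk : k = e i
    · subst hk; simpa
    · simp [hk, ha]
  have h2 := tuple_mem_prodSet.1 (tuple_mem_pre.1 (h h1)).2 i
  simpa using h2

end Pre

/-! ### Interpretations of Borel sets and truth values -/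

section Truth

variable {n : ℕ} {X τ : Fin n → ZFSet.{u}} {Xhat : Fin n → Type u}
  [∀ k, TopologicalSpace (Xhat k)] {pt : ∀ k, Pt (X k) → Xhat k} {op : ∀ k, ZFSet.{u} → Set (Xhat k)}

/-- Basic boxes of the product of the spaces `Xhat k` come from boxes of `M`, and such a box misses
the image of the complement of `W` exactly when the box of `M` lies in `W`. -/
theorem mem_prodOpen (hp : ∀ k, IsPreinterpretation M (X k) (τ k) (Xhat k) (pt k) (op k))
    (hτ : ∀ k, ∀ O ∈ τ k, O ⊆ X k) {W : ZFSet.{u}} {z : ∀ k, Xhat k} :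
    z ∈ prodOpen pt W ↔ ∃ O : Fin n → ZFSet.{u}, (∀ k, O k ∈ trace (τ k) (op k) (z k)) ∧
      prodSet O ⊆ W := by
  constructor
  · intro hz
    have ho : IsOpen (prodOpen pt W) := isClosed_closure.isOpen_compl
    obtain ⟨v, hv, hvW⟩ := isOpen_pi_iff'.1 ho z hz
    have : ∀ k, ∃ O ∈ τ k, z k ∈ op k O ∧ op k O ⊆ v k := by
      intro k
      obtain ⟨_, ⟨O, hO, rfl⟩, hzO, hOv⟩ :=
        (hp k).basis.exists_subset_of_mem_open (hv k).2 (hv k).1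
      exact ⟨O, hO, hzO, hOv⟩
    choose O hO hzO hOv using this
    refine ⟨O, fun k => ⟨hO k, hzO k⟩, fun t ht => ?_⟩
    obtain ⟨a, ha, rfl⟩ := mem_prodSet.1 ht
    by_contra hno
    refine hvW (a := fun k => pt k ⟨a k, hτ k _ (hO k) (ha k)⟩)
      (fun k _ => hOv k (((hp k).mem_iff _ _ (hO k)).1 (ha k))) (subset_closure ⟨_, ?_, rfl⟩)
    exact hno
  · rintro ⟨O, hO, hOW⟩ hz
    obtain ⟨_, hb, a, ha, rfl⟩ := mem_closure_iff.1 hz (univ.pi fun k => op k (O k))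
      (isOpen_set_pi finite_univ fun k _ => (hp k).basis.isOpen ⟨O k, (hO k).1, rfl⟩)
      fun k _ => (hO k).2
    exact ha (hOW (tuple_mem_prodSet.2 fun k =>
      ((hp k).mem_iff _ _ (hO k).1).2 (hb k (mem_univ k))))

variable {s : ∀ k, Sieve M (X k) (τ k)} {z : ∀ k, Xhat k} {m : ℕ} {e : Fin m → Fin n}

theorem pre_mem_top {W : ZFSet.{u}} (hW : W ∈ prodTop M (fun i => X (e i)) (fun i => τ (e i))) :
    pre X e W ∈ (Sieve.pi s).top := by
  obtain ⟨-, hWM, hW⟩ := ZFSet.mem_sep.1 hW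
  refine Sieve.mem_top.2 ⟨⟨ZFSet.sep_subset, pre_mem_model (fun k => (s k).space_mem) hWM⟩,
    fun t ht => ?_⟩
  obtain ⟨a, ha, rfl, haW⟩ := mem_pre.1 ht
  obtain ⟨O, hO, hOW⟩ := hW _ haW
  obtain ⟨P, hP, hPx⟩ := exists_pullback (e := e) (G := fun k => {O | O ∈ τ k})
    (fun k => (s k).whole_mem) (fun k => (s k).base_inter) fun i => (hO i).1
  refine ⟨prodSet P, (Sieve.mem_boxBase s).2 ⟨P, hP, rfl⟩, tuple_mem_prodSet.2 fun k => ?_,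
    fun t ht => pre_mono hOW (prodSet_subset_pre hPx ht)⟩
  refine (hPx _ _).2 ⟨ha k, ?_⟩
  rintro i rfl
  exact (hO i).2

/-- When `e` repeats coordinates, a box inside the pullback of `W` need not project into a box
inside `W`. Covering it in `M` by boxes that do, and applying primeness of the point, gives a
suitable smaller one. -/
theorem forces_pre_iff (hp : ∀ k, IsPreinterpretation M (X k) (τ k) (Xhat k) (pt k) (op k))
    (hz : ∀ k, (s k).Point (trace (τ k) (op k) (z k))) {W : ZFSet.{u}}
    (hW : W ∈ prodTop M (fun i => X (e i)) (fun i => τ (e i))) :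
    Sieve.Forces (Sieve.boxes fun k => trace (τ k) (op k) (z k)) (pre X e W) ↔
      (fun i => z (e i)) ∈ prodOpen (fun i => pt (e i)) W := by
  have hPt := Sieve.Point.pi hz
  have hτ : ∀ k, ∀ O ∈ τ k, O ⊆ X k := fun k => (s k).base_subset
  rw [mem_prodOpen (op := fun i => op (e i)) (fun i => hp (e i)) fun i => hτ (e i)]
  have hpull : ∀ {O : Fin m → ZFSet.{u}}, (∀ i, O i ∈ τ (e i)) → ∃ P : Fin n → ZFSet.{u},
      (∀ k, P k ∈ τ k) ∧ ∀ k x, x ∈ P k ↔ x ∈ X k ∧ ∀ i, e i = k → x ∈ O i := fun hO =>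
    exists_pullback (G := fun k => {O | O ∈ τ k}) (fun k => (s k).whole_mem)
      (fun k => (s k).base_inter) hO
  obtain ⟨-, hWM, hWo⟩ := ZFSet.mem_sep.1 hW
  constructor
  · rintro ⟨N, hN, hNW⟩
    have hXM : ∀ k, X k ∈ M := fun k => (s k).space_mem
    have hbase := (Sieve.pi s).base_mem
    have hbase' := (Sieve.pi fun i => s (e i)).base_mem
    have hpre : ∀ {E : Type (u + 1)} [Ctx M E] {f : E → ZFSet.{u}}, DFun M f →
      DFun M (fun q => pre X e (f q)) := DFun.pre hXM
    obtain ⟨P, hPC, hPG⟩ := hPt.exists_mem_of_cover hN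
      (C := (Sieve.boxBase M X τ).sep fun P => ∃ R,
        R ∈ Sieve.boxBase M (fun i => X (e i)) (fun i => τ (e i)) ∧ R ⊆ W ∧ P ⊆ pre X e R)
      (sep_mem_model hbase Dfn.auto) (fun P hP => (ZFSet.mem_sep.1 hP).1) (by
        intro t ht
        obtain ⟨a, ha, rfl, haW⟩ := mem_pre.1 (hNW ht)
        obtain ⟨O, hO, hOW⟩ := hWo _ haW
        obtain ⟨P, hP, hPx⟩ := hpull fun i => (hO i).1
        refine ⟨prodSet P, ZFSet.mem_sep.2 ⟨(Sieve.mem_boxBase s).2 ⟨P, hP, rfl⟩, prodSet O,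
          (Sieve.mem_boxBase fun i => s (e i)).2 ⟨O, fun i => (hO i).1, rfl⟩, hOW,
          prodSet_subset_pre hPx⟩, tuple_mem_prodSet.2 fun k => (hPx _ _).2 ⟨ha k, ?_⟩⟩
        rintro i rfl
        exact (hO i).2)
    obtain ⟨-, R, hR, hRW, hPR⟩ := ZFSet.mem_sep.1 hPC
    obtain ⟨O, hO, rfl⟩ := (Sieve.mem_boxBase fun i => s (e i)).1 hR
    have hne := hPt.nonempty hPG
    obtain ⟨P, hP, rfl⟩ := hPG
    exact ⟨O, fun i => ⟨hO i, (hp (e i)).mono (hP _).1 (hO i)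
      (subset_of_prodSet_subset_pre hne hPR i) (hP _).2⟩, hRW⟩
  · rintro ⟨O, hO, hOW⟩
    obtain ⟨P, hP, hPx⟩ := exists_pullback (G := fun k => trace (τ k) (op k) (z k))
      (fun k => (hz k).whole) (fun k => (hz k).inter) hO
    exact ⟨prodSet P, ⟨P, hP, rfl⟩, fun t ht => pre_mono hOW (prodSet_subset_pre hPx ht)⟩

/-- Pulling back along `e` moves relations on different tuples of coordinates to one common product,
where their truth values at a single point can be compared. -/
theorem TV.of_borelImage (hp : ∀ k, IsPreinterpretation M (X k) (τ k) (Xhat k) (pt k) (op k))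
    (hz : ∀ k, (s k).Point (trace (τ k) (op k) (z k))) {B : ZFSet.{u}}
    {B' : Set (∀ i, Xhat (e i))}
    (hB : BorelImage M (fun i => τ (e i)) (fun i => pt (e i)) B B') :
    Sieve.TV (Sieve.pi s) (Sieve.boxes fun k => trace (τ k) (op k) (z k)) (pre X e B)
      ((fun i => z (e i)) ∈ B') := by
  have hXM : ∀ k, X k ∈ M := fun k => (s k).space_mem
  induction hB with
  | ofOpen W hW =>
    rw [← forces_pre_iff hp hz hW]
    exact .ofOpen _ (pre_mem_top hW)
  | compl B B' _ ih =>
    rw [pre_compl]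
    exact ih.compl
  | iUnion t t' ht _ ih =>
    rw [pre_iUnion, mem_iUnion]
    refine .iUnion _ _ (ht.map (powIn_mem (prodSet_mem_model hXM))
      (DFun.pre hXM (DFun.coe PFun.id)) fun i => ?_) ih
    exact mem_powIn.2 ⟨ZFSet.sep_subset, pre_mem_model hXM (ht.mem i)⟩

end Truth

/-! ### Reflection of properties of finitely many points -/

section Reflection

variable {I : Type v} {X τ : I → ZFSet.{u}} {Xhat : I → Type u}

/-- The property `Q` of assignments of elements of the spaces `X i` to the points of the spaces
`Xhat i` depends on finitely many of these points, and follows from the membership of the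
assigned tuple in a Borel set whose interpretation contains the tuple of these points. -/
def Reflectable (s : ∀ i, Sieve M (X i) (τ i)) (op : ∀ i, ZFSet.{u} → Set (Xhat i))
    (Q : ((Σ i, Xhat i) → ZFSet.{u}) → Prop) : Prop :=
  -- Every finite list containing `K` is allowed, so that properties with different supports can be
  -- combined over a common list.
  ∃ K : Set (Σ i, Xhat i), K.Finite ∧ ∀ (n : ℕ) (p : Fin n → Σ i, Xhat i), K ⊆ range p →
    ∃ D, Sieve.TV (Sieve.pi fun k => s (p k).1)
      (Sieve.boxes fun k => trace (τ (p k).1) (op (p k).1) (p k).2) D True ∧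
      ∀ (a : Fin n → ZFSet.{u}) g, (∀ k, a k ∈ X (p k).1) → tuple a ∈ D →
        (∀ k, g (p k) = a k) → Q g

variable {s : ∀ i, Sieve M (X i) (τ i)} {op : ∀ i, ZFSet.{u} → Set (Xhat i)}

namespace Reflectable

/-- List the support without repetition; the Borel set attached to the list is nonempty, and the
coordinates of one of its elements are the values. -/
theorem exists_assignment (hs : ∀ i z, (s i).Point (trace (τ i) (op i) z))
    {Q : ((Σ i, Xhat i) → ZFSet.{u}) → Prop} (h : Reflectable s op Q) :
    ∃ g, Q g := by
  obtain ⟨K, hfin, h⟩ := h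
  obtain ⟨n, p, hpi, hpr⟩ := hfin.fin_param
  obtain ⟨D, hD, hDQ⟩ := h n p hpr.ge
  obtain ⟨t, ht, htD⟩ := hD.exists_mem (Sieve.Point.pi fun k => hs (p k).1 (p k).2) trivial
  obtain ⟨a, ha, rfl⟩ := mem_prodSet.1 ht
  exact ⟨Function.extend p a fun _ => ∅, hDQ a _ ha htD fun k => hpi.extend_apply _ _ _⟩

theorem of_forall (hs : ∀ i z, (s i).Point (trace (τ i) (op i) z))
    {Q : ((Σ i, Xhat i) → ZFSet.{u}) → Prop} (h : ∀ g, Q g) :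
    Reflectable s op Q := by
  refine ⟨∅, finite_empty, fun n p _ => ?_⟩
  have hpt := Sieve.Point.pi fun k => hs (p k).1 (p k).2
  let s' := Sieve.pi fun k => s (p k).1
  refine ⟨prodSet fun k => X (p k).1, ?_, fun _ g _ _ _ => h g⟩
  have := Sieve.TV.ofOpen (s := s') (G := Sieve.boxes fun k =>
    trace (τ (p k).1) (op (p k).1) (p k).2) _ (Sieve.mem_top.2 ⟨⟨fun _ h => h, s'.space_mem⟩,
      fun x hx => ⟨_, s'.whole_mem, hx, fun _ h => h⟩⟩)
  rwa [eq_true (p := Sieve.Forces _ _) ⟨_, hpt.whole, fun _ h => h⟩] at this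

theorem and (hs : ∀ i z, (s i).Point (trace (τ i) (op i) z))
    {Q R : ((Σ i, Xhat i) → ZFSet.{u}) → Prop} (hQ : Reflectable s op Q)
    (hR : Reflectable s op R) : Reflectable s op fun g => Q g ∧ R g := by
  obtain ⟨K, hfin, h⟩ := hQ
  obtain ⟨K', hfin', h'⟩ := hR
  refine ⟨K ∪ K', hfin.union hfin', fun n p hp => ?_⟩
  obtain ⟨D, hD, hDQ⟩ := h n p (subset_union_left.trans hp)
  obtain ⟨D', hD', hDR⟩ := h' n p (subset_union_right.trans hp)
  have := hD.inter (Sieve.Point.pi fun k => hs (p k).1 (p k).2) hD'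
  rw [and_self] at this
  refine ⟨_, this, fun a g ha haD hg => ?_⟩
  rw [ZFSet.mem_inter] at haD
  exact ⟨hDQ a g ha haD.1 hg, hDR a g ha haD.2 hg⟩

theorem mono {Q R : ((Σ i, Xhat i) → ZFSet.{u}) → Prop} (hQ : Reflectable s op Q)
    (h : ∀ g, Q g → R g) : Reflectable s op R := by
  obtain ⟨K, hfin, hQ⟩ := hQ
  refine ⟨K, hfin, fun n p hp => ?_⟩
  obtain ⟨D, hD, hDQ⟩ := hQ n p hp
  exact ⟨D, hD, fun a g ha haD hg => h g (hDQ a g ha haD hg)⟩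

theorem forall_fin (hs : ∀ i z, (s i).Point (trace (τ i) (op i) z))
    {m : ℕ} {Q : Fin m → ((Σ i, Xhat i) → ZFSet.{u}) → Prop}
    (hQ : ∀ i, Reflectable s op (Q i)) : Reflectable s op fun g => ∀ i, Q i g := by
  induction m with
  | zero => exact of_forall hs fun g i => i.elim0
  | succ m ih =>
    refine ((hQ 0).and hs (ih fun i => hQ i.succ)).mono fun g hg i => ?_
    exact Fin.cases hg.1 hg.2 i

variable [∀ i, TopologicalSpace (Xhat i)] {pt : ∀ i, Pt (X i) → Xhat i}

/-- The coordinates `w i` occur in the list `p` at places `e i`, and the pullback of `B` along `e`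
is the required Borel set. -/
theorem mem_borel (hs : ∀ i z, (s i).Point (trace (τ i) (op i) z))
    (hp : ∀ i, IsPreinterpretation M (X i) (τ i) (Xhat i) (pt i) (op i))
    {m : ℕ} {d : Fin m → I} {w : ∀ i, Xhat (d i)} {B : ZFSet.{u}}
    {B' : Set (∀ i, Xhat (d i))} (hB : BorelImage M (fun i => τ (d i)) (fun i => pt (d i)) B B')
    (hw : w ∈ B') : Reflectable s op fun g => tuple (fun i => g ⟨d i, w i⟩) ∈ B := by
  refine ⟨range fun i => ⟨d i, w i⟩, finite_range _, fun n p hpr => ?_⟩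
  have : ∀ i, ∃ k, p k = ⟨d i, w i⟩ := fun i => hpr ⟨i, rfl⟩
  choose e he using this
  obtain rfl : d = fun i => (p (e i)).1 := funext fun i => by rw [he]
  obtain rfl : w = fun i => (p (e i)).2 := funext fun i =>
    (eq_of_heq (Sigma.mk.inj (he i)).2).symm
  have := TV.of_borelImage (e := e) (fun k => hp (p k).1) (fun k => hs (p k).1 (p k).2) hB
  rw [eq_true hw] at this
  refine ⟨_, this, fun a g ha haD hg => ?_⟩
  have h := (tuple_mem_pre.1 haD).2
  simpa [hg] using h

theorem notMem_borel (hs : ∀ i z, (s i).Point (trace (τ i) (op i) z))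
    (hp : ∀ i, IsPreinterpretation M (X i) (τ i) (Xhat i) (pt i) (op i))
    {m : ℕ} {d : Fin m → I} {w : ∀ i, Xhat (d i)} {B : ZFSet.{u}}
    {B' : Set (∀ i, Xhat (d i))} (hB : BorelImage M (fun i => τ (d i)) (fun i => pt (d i)) B B')
    (hw : w ∉ B') : Reflectable s op fun g => tuple (fun i => g ⟨d i, w i⟩) ∉ B :=
  (mem_borel hs hp hB.compl hw).mono fun _ hg => (ZFSet.mem_sdiff.1 hg).2

theorem _root_.AnalyticAbs.box_mem_prodTop {n : ℕ} {X τ O : Fin n → ZFSet.{u}}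
    (hτM : ∀ k, τ k ∈ M) (hτ : ∀ k, ∀ O ∈ τ k, O ⊆ X k) (hO : ∀ k, O k ∈ τ k) :
    prodSet O ∈ prodTop M X τ := by
  refine ZFSet.mem_sep.2 ⟨ZFSet.mem_powerset.2 fun t ht => ?_,
    prodSet_mem_model fun k => mem_of_mem_model (hτM k) (hO k), fun a ha => ?_⟩
  · obtain ⟨a, ha, rfl⟩ := mem_prodSet.1 ht
    exact tuple_mem_prodSet.2 fun k => hτ k _ (hO k) (ha k)
  · exact ⟨O, fun k => ⟨hO k, tuple_mem_prodSet.1 ha k⟩, fun _ h => h⟩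

/-- On a one-fold product the canonical extension agrees with `op`, so open sets of one space are
covered by the reflection of Borel sets. -/
theorem mem_prodOpen_const {i : I} (hp : IsPreinterpretation M (X i) (τ i) (Xhat i) (pt i) (op i))
    (hτ : ∀ O ∈ τ i, O ⊆ X i) {O : ZFSet.{u}} (hO : O ∈ τ i) {z : Xhat i} :
    (fun _ => z) ∈ prodOpen (fun _ : Fin 1 => pt i) (prodSet fun _ : Fin 1 => O) ↔ z ∈ op i O := by
  rw [mem_prodOpen (op := fun _ => op i) (fun _ => hp) fun _ => hτ]
  constructor
  · rintro ⟨O', hO', hsub⟩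
    refine hp.mono (hO' 0).1 hO (fun x hx => ?_) (hO' 0).2
    exact tuple_mem_prodSet.1 (hsub (tuple_mem_prodSet (a := fun _ => x).2 fun k => by
      rwa [Subsingleton.elim k 0])) 0
  · exact fun hz => ⟨fun _ => O, fun _ => ⟨hO, hz⟩, fun _ h => h⟩

theorem mem_open (hs : ∀ i z, (s i).Point (trace (τ i) (op i) z))
    (hp : ∀ i, IsPreinterpretation M (X i) (τ i) (Xhat i) (pt i) (op i)) {i : I} {O : ZFSet.{u}}
    (hO : O ∈ τ i) {z : Xhat i} (hz : z ∈ op i O) : Reflectable s op fun g => g ⟨i, z⟩ ∈ O :=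
  (mem_borel hs hp (d := fun _ : Fin 1 => i) (w := fun _ => z) (.ofOpen (prodSet fun _ => O)
    (box_mem_prodTop (fun _ => (s i).base_mem) (fun _ => (s i).base_subset) fun _ => hO))
    ((mem_prodOpen_const (hp i) (s i).base_subset hO).2 hz)).mono fun _ hg => tuple_mem_prodSet.1 hg 0

theorem notMem_open (hs : ∀ i z, (s i).Point (trace (τ i) (op i) z))
    (hp : ∀ i, IsPreinterpretation M (X i) (τ i) (Xhat i) (pt i) (op i)) {i : I} {O : ZFSet.{u}}
    (hO : O ∈ τ i) {z : Xhat i} (hz : z ∉ op i O) : Reflectable s op fun g => g ⟨i, z⟩ ∉ O :=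
  (notMem_borel hs hp (d := fun _ : Fin 1 => i) (w := fun _ => z) (.ofOpen (prodSet fun _ => O)
    (box_mem_prodTop (fun _ => (s i).base_mem) (fun _ => (s i).base_subset) fun _ => hO))
    (fun h => hz ((mem_prodOpen_const (hp i) (s i).base_subset hO).1 h))).mono
    fun _ hg h => hg (tuple_mem_prodSet.2 fun _ => h)

theorem mem_space (hs : ∀ i z, (s i).Point (trace (τ i) (op i) z))
    (hp : ∀ i, IsPreinterpretation M (X i) (τ i) (Xhat i) (pt i) (op i)) {i : I} (z : Xhat i) :
    Reflectable s op fun g => g ⟨i, z⟩ ∈ X i :=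
  mem_open hs hp (s i).whole_mem (by rw [(hp i).whole]; trivial)

/-- The complement of `{x}` is open in `M`, and its interpretation omits `pt i x`. -/
theorem eq_point (hs : ∀ i z, (s i).Point (trace (τ i) (op i) z))
    (hp : ∀ i, IsPreinterpretation M (X i) (τ i) (Xhat i) (pt i) (op i)) {i : I}
    (ht : IsTopologyIn M (X i) (τ i)) (hH : IsHausdorff (X i) (τ i)) (x : Pt (X i)) :
    Reflectable s op fun g => g ⟨i, pt i x⟩ = x := by
  have hxM := mem_of_mem_model ht.space_mem x.2
  have hτ := ht.top_mem
  have hX := ht.space_mem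
  have hO : X i \ {(x : ZFSet.{u})} ∈ τ i := by
    have : X i \ {(x : ZFSet.{u})} = ZFSet.sUnion ((τ i).sep fun P => (x : ZFSet.{u}) ∉ P) := by
      ext y
      simp only [ZFSet.mem_sdiff, ZFSet.mem_singleton, ZFSet.mem_sUnion, ZFSet.mem_sep]
      constructor
      · rintro ⟨hy, hyx⟩
        obtain ⟨O, hO, P, hP, hyO, hxP, hdis⟩ := hH y hy x x.2 hyx
        exact ⟨O, ⟨hO, fun hxO => ZFSet.notMem_empty _ (hdis ▸ ZFSet.mem_inter.2 ⟨hxO, hxP⟩)⟩, hyO⟩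
      · rintro ⟨O, ⟨hO, hxO⟩, hyO⟩
        exact ⟨ht.subset O hO hyO, by rintro rfl; exact hxO hyO⟩
    rw [this]
    exact ht.sUnion _ (sep_mem_model hτ Dfn.auto) ZFSet.sep_subset
  refine ((notMem_open hs hp hO fun h => ?_).and hs (mem_space hs hp (pt i x))).mono
    fun g hg => by_contra fun hgx => hg.1 (ZFSet.mem_sdiff.2 ⟨hg.2, by simpa using hgx⟩)
  exact (ZFSet.mem_sdiff.1 (((hp i).mem_iff x _ hO).2 h)).2 (by simp)

/-- By `T₀`, a basic open set contains exactly one of the two points. -/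
theorem ne (hs : ∀ i z, (s i).Point (trace (τ i) (op i) z))
    (hp : ∀ i, IsPreinterpretation M (X i) (τ i) (Xhat i) (pt i) (op i)) {i : I} {y z : Xhat i}
    (hyz : y ≠ z) : Reflectable s op fun g => g ⟨i, y⟩ ≠ g ⟨i, z⟩ := by
  have := (hp i).t0
  obtain ⟨U, hU, h⟩ := exists_isOpen_xor_mem hyz
  have hb := (hp i).basis
  rcases h with ⟨hyU, hzU⟩ | ⟨hzU, hyU⟩
  · obtain ⟨_, ⟨O, hO, rfl⟩, hyO, hOU⟩ := hb.exists_subset_of_mem_open hyU hU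
    exact ((mem_open hs hp hO hyO).and hs (notMem_open hs hp hO fun h => hzU (hOU h))).mono
      fun g hg he => hg.2 (he ▸ hg.1)
  · obtain ⟨_, ⟨O, hO, rfl⟩, hzO, hOU⟩ := hb.exists_subset_of_mem_open hzU hU
    exact ((mem_open hs hp hO hzO).and hs (notMem_open hs hp hO fun h => hyU (hOU h))).mono
      fun g hg he => hg.2 (he ▸ hg.1)

/-- The pairs of a value and a tuple that have a neighborhood disjoint from the graph of `f`. -/
noncomputable def _root_.AnalyticAbs.offGraph (M : Set ZFSet.{u}) {m : ℕ} (X τ : Fin m → ZFSet.{u})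
    (Y σ f : ZFSet.{u}) : ZFSet.{u} :=
  (Y.prod (prodSet X)).sep fun t => ∃ P, P ∈ σ ∧ ∃ U, U ∈ Sieve.boxBase M X τ ∧
    (∃ y, y ∈ P ∧ ∃ b, b ∈ U ∧ t = ZFSet.pair y b) ∧
    ∀ b, b ∈ U → ∀ y, y ∈ P → ZFSet.pair b y ∉ f

theorem _root_.AnalyticAbs.offGraph_mem_prodTop {m : ℕ} {X τ : Fin m → ZFSet.{u}}
    {Y σ f : ZFSet.{u}} (s : ∀ k, Sieve M (X k) (τ k)) (s' : Sieve M Y σ) (hf : f ∈ M) :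
    offGraph M X τ Y σ f ∈ prodTop M (Fin.cons Y X : Fin (m + 1) → ZFSet.{u})
      (Fin.cons σ τ : Fin (m + 1) → ZFSet.{u}) := by
  have hσ := s'.base_mem
  have hb := (Sieve.pi s).base_mem
  have hP : Y.prod (prodSet X) ∈ M :=
    prod_mem_model s'.space_mem (prodSet_mem_model fun k => (s k).space_mem)
  refine ZFSet.mem_sep.2 ⟨ZFSet.mem_powerset.2 ZFSet.sep_subset, sep_mem_model hP Dfn.auto,
    fun a ha => ?_⟩
  obtain ⟨hat, P, hPσ, U, hU, ⟨y, hy, b, hb, he⟩, hdis⟩ := ZFSet.mem_sep.1 ha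
  obtain ⟨h0, hbt⟩ := ZFSet.pair_inj.1 he
  obtain ⟨O, hO, rfl⟩ := (Sieve.mem_boxBase s).1 hU
  refine ⟨Fin.cons P O, fun k => ?_, fun t ht => ?_⟩
  · rw [← hbt, tuple_mem_prodSet] at hb
    rw [← h0] at hy
    refine Fin.cases ?_ (fun i => ?_) k
    · exact ⟨hPσ, hy⟩
    · exact ⟨hO i, hb i⟩
  · obtain ⟨y', hy', b', hb', rfl⟩ := ZFSet.mem_prod.1 ht
    refine ZFSet.mem_sep.2 ⟨ZFSet.pair_mem_prod.2 ⟨s'.base_subset P hPσ hy',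
      (Sieve.pi s).base_subset _ hU hb'⟩, P, hPσ, _, hU, ⟨y', hy', b', hb', rfl⟩, hdis⟩

/-- Being off the graph by a whole neighborhood is an open condition on a value and an argument. It
fails at `(y, w)` by continuity of `fhat`, and its failure is reflected; in `M`, continuity of `f`
and the Hausdorff property then force the reflected value to be `f` of the reflected argument. -/
theorem mem_fn (hs : ∀ i z, (s i).Point (trace (τ i) (op i) z))
    (hp : ∀ i, IsPreinterpretation M (X i) (τ i) (Xhat i) (pt i) (op i)) {m : ℕ} {d : Fin m → I}
    {c : I} (hH : IsHausdorff (X c) (τ c)) {f D : ZFSet.{u}} (hf : f ∈ M)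
    (hfX : f ⊆ (prodSet fun i => X (d i)).prod (X c))
    (hfD : ∀ x ∈ D, ∃ y, ZFSet.pair x y ∈ f)
    (hfc : ∀ O ∈ τ c, ∃ W ∈ prodTop M (fun i => X (d i)) (fun i => τ (d i)),
      ∀ x y, ZFSet.pair x y ∈ f → (x ∈ W ↔ y ∈ O))
    {fhat : (∀ i, Xhat (d i)) →. Xhat c} (hcont : Continuous fhat.asSubtype)
    (hD : BorelImage M (fun i => τ (d i)) (fun i => pt (d i)) D fhat.Dom)
    (hcomm : ∀ (a : ∀ i, Pt (X (d i))) (y : Pt (X c)), ZFSet.pair (ptTuple a) y ∈ f →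
      pt c y ∈ fhat fun i => pt (d i) (a i))
    {w : ∀ i, Xhat (d i)} {y : Xhat c} (hy : y ∈ fhat w) :
    Reflectable s op fun g => ZFSet.pair (tuple fun i => g ⟨d i, w i⟩) (g ⟨c, y⟩) ∈ f := by
  have hwD : w ∈ fhat.Dom := Part.dom_iff_mem.2 ⟨y, hy⟩
  let d' : Fin (m + 1) → I := Fin.cons c d
  let w' : ∀ i, Xhat (d' i) := Fin.cons (α := fun i => Xhat (d' i)) y w
  let W := offGraph M (fun i => X (d i)) (fun i => τ (d i)) (X c) (τ c) f
  have hW : W ∈ prodTop M (fun i => X (d' i)) (fun i => τ (d' i)) := by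
    have := offGraph_mem_prodTop (fun i => s (d i)) (s c) hf
    convert this using 2 <;>
    · funext i
      exact Fin.cases rfl (fun _ => rfl) i
  -- Otherwise a box around `(y, w)` lies off the graph. A smaller box around `w` is mapped by
  -- `fhat` into the value side; reflecting it together with the domain yields an argument of `f` in
  -- `M` whose graph point lies in the box.
  have hw' : w' ∉ prodOpen (fun i => pt (d' i)) W := by
    rw [mem_prodOpen (fun i => hp (d' i)) fun i => (s (d' i)).base_subset]
    rintro ⟨O, hO, hOW⟩
    have hO0 : O 0 ∈ τ c ∧ y ∈ op c (O 0) := hO 0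
    have hOs : ∀ i : Fin m, O i.succ ∈ trace (τ (d i)) (op (d i)) (w i) := fun i => hO i.succ
    obtain ⟨V, hV, hVf⟩ := isOpen_induced_iff.1 (hcont.isOpen_preimage _
      ((hp c).basis.isOpen ⟨O 0, hO0.1, rfl⟩))
    have hVf' : ∀ w₁ y₁, y₁ ∈ fhat w₁ → (w₁ ∈ V ↔ y₁ ∈ op c (O 0)) := by
      intro w₁ y₁ h₁
      have hd : w₁ ∈ fhat.Dom := Part.dom_iff_mem.2 ⟨y₁, h₁⟩
      have h2 := Set.ext_iff.1 hVf ⟨w₁, hd⟩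
      have h3 : fhat.asSubtype ⟨w₁, hd⟩ = y₁ := Part.get_eq_of_mem h₁ hd
      rw [mem_preimage, mem_preimage, h3] at h2
      exact h2
    obtain ⟨v, hv, hvV⟩ := isOpen_pi_iff'.1 hV w ((hVf' w y hy).2 hO0.2)
    have hbas : ∀ i, ∃ O' ∈ trace (τ (d i)) (op (d i)) (w i), op (d i) O' ⊆ v i := by
      intro i
      obtain ⟨_, ⟨O', hO', rfl⟩, hwO, hOv⟩ :=
        (hp (d i)).basis.exists_subset_of_mem_open (hv i).2 (hv i).1
      exact ⟨O', ⟨hO', hwO⟩, hOv⟩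
    choose O' hO' hO'v using hbas
    obtain ⟨g, hg1, hg2, hgD⟩ := (((forall_fin hs fun i => mem_open hs hp (hOs i).1 (hOs i).2).and
      hs ((forall_fin hs fun i => mem_open hs hp (hO' i).1 (hO' i).2).and hs
      (mem_borel hs hp hD hwD)))).exists_assignment hs
    obtain ⟨y', hy'⟩ := hfD _ hgD
    have hy'X := (ZFSet.pair_mem_prod.1 (hfX hy')).2
    let a : ∀ i, Pt (X (d i)) := fun i =>
      ⟨g ⟨d i, w i⟩, (s (d i)).base_subset _ (hOs i).1 (hg1 i)⟩
    have h1 := hcomm a ⟨y', hy'X⟩ hy'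
    have h2 : y' ∈ O 0 := ((hp c).mem_iff ⟨y', hy'X⟩ _ hO0.1).2 ((hVf' _ _ h1).1
      (hvV fun i _ => hO'v i (((hp (d i)).mem_iff (a i) _ (hO' i).1).1 (hg2 i))))
    have h3 : ZFSet.pair y' (tuple fun i => g ⟨d i, w i⟩) ∈ W :=
      hOW (ZFSet.pair_mem_prod.2 ⟨h2, tuple_mem_prodSet.2 hg1⟩)
    obtain ⟨-, P, -, U, -, ⟨y₁, hy₁, b₁, hb₁, he⟩, hdis⟩ := ZFSet.mem_sep.1 h3
    obtain ⟨rfl, rfl⟩ := ZFSet.pair_inj.1 he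
    exact hdis _ hb₁ _ hy₁ hy'
  refine ((notMem_borel hs hp (.ofOpen W hW) hw').and hs ((mem_borel hs hp hD hwD).and hs
    (mem_space hs hp y))).mono fun g hg => ?_
  obtain ⟨hgW, hgD, hgy⟩ := hg
  obtain ⟨y', hy'⟩ := hfD _ hgD
  obtain ⟨hgX, hy'X⟩ := ZFSet.pair_mem_prod.1 (hfX hy')
  by_contra hno
  -- If the reflected value differed from `y'`, disjoint neighborhoods and continuity of `f` would
  -- give a box off the graph.
  obtain ⟨P, hP, P', hP', hgP, hyP, hdis⟩ := hH _ hgy y' hy'X (by rintro rfl; exact hno hy')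
  obtain ⟨W', hW', hfW⟩ := hfc P' hP'
  obtain ⟨O, hO, hOW⟩ := (ZFSet.mem_sep.1 hW').2.2 _ ((hfW _ _ hy').2 hyP)
  refine hgW (ZFSet.mem_sep.2 ⟨ZFSet.pair_mem_prod.2 ⟨hgy, hgX⟩, P, hP, prodSet O,
    (Sieve.mem_boxBase fun i => s (d i)).2 ⟨O, fun i => (hO i).1, rfl⟩,
    ⟨_, hgP, _, tuple_mem_prodSet.2 fun i => (hO i).2, rfl⟩, fun b hb y₁ hy₁ hf₁ => ?_⟩)
  exact ZFSet.notMem_empty _ (hdis ▸ ZFSet.mem_inter.2 ⟨hy₁, (hfW _ _ hf₁).1 (hOW hb)⟩)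

end Reflectable

end Reflection

/-! ### Terms and quantifier-free formulas -/

theorem Term.HasValue.unique {S : Signature.{w₁, w₂, w₃}} {A : S.Srt → Type v}
    {𝔄 : PartialStructure S A} {V : Type} {Γ : V → S.Srt} {e : ∀ x, A (Γ x)} {i : S.Srt}
    {t : Term S Γ i} {y y' : A i} (h : t.HasValue 𝔄 e y) (h' : t.HasValue 𝔄 e y') : y = y' := by
  induction t with
  | var x => exact Eq.trans h (Eq.symm h')
  | app k t ih =>
    obtain ⟨b, hb, hy⟩ := h
    obtain ⟨b', hb', hy'⟩ := h'
    obtain rfl : b = b' := funext fun m => ih m (hb m) (hb' m)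
    exact Part.mem_unique hy hy'

section Formulas

variable {S : Signature.{w₁, w₂, w₃}} {𝔛 : SetStructure.{u} S} {Xhat : S.Srt → Type u}

theorem mem_fn_iff (h𝔛 : 𝔛.IsInterpretableIn M) {k : S.Fn} {a : ∀ m, Pt (𝔛.X (S.fnDom k m))}
    {y : Pt (𝔛.X (S.fnCod k))} :
    y ∈ 𝔛.toPartialStructure.fn k a ↔ ZFSet.pair (ptTuple a) y ∈ 𝔛.f k := by
  constructor
  · rintro ⟨h, rfl⟩
    exact h.choose_spec
  · intro h
    have h' : ∃ y : Pt (𝔛.X (S.fnCod k)), ZFSet.pair (ptTuple a) y ∈ 𝔛.f k := ⟨y, h⟩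
    exact ⟨h', Subtype.ext (h𝔛.fn_functional k _ _ _ h'.choose_spec h)⟩

/-- The assignment `e` of points of the spaces of `M` is the one given by `g`. -/
def Agrees {V : Type} {Γ : V → S.Srt} (ε : ∀ x, Xhat (Γ x)) (e : ∀ x, Pt (𝔛.X (Γ x)))
    (g : (Σ i, Xhat i) → ZFSet.{u}) : Prop :=
  ∀ x, (e x : ZFSet.{u}) = g ⟨Γ x, ε x⟩

theorem ptTuple_eq_of_coe_eq {m : ℕ} {d : Fin m → S.Srt} {a : ∀ i, Pt (𝔛.X (d i))}
    {w : ∀ i, Xhat (d i)} {g : (Σ i, Xhat i) → ZFSet.{u}}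
    (h : ∀ i, (a i : ZFSet.{u}) = g ⟨d i, w i⟩) : ptTuple a = tuple fun i => g ⟨d i, w i⟩ :=
  congrArg tuple (funext h)

variable [∀ i, TopologicalSpace (Xhat i)] {𝔛hat : PartialStructure S Xhat}
  {pt : ∀ i, Pt (𝔛.X i) → Xhat i} {op : ∀ i, ZFSet.{u} → Set (Xhat i)}
  {s : ∀ i, Sieve M (𝔛.X i) (𝔛.τ i)} {V : Type} {Γ : V → S.Srt} {ε : ∀ x, Xhat (Γ x)}

theorem Term.reflectable_hasValue (h𝔛 : 𝔛.IsInterpretableIn M)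
    (hs : ∀ i z, (s i).Point (trace (𝔛.τ i) (op i) z))
    (hπ : 𝔛.IsInterpretation M Xhat 𝔛hat pt op) {i : S.Srt} (t : Term S Γ i) {y : Xhat i}
    (hy : t.HasValue 𝔛hat ε y) :
    Reflectable s op fun g => ∀ e : ∀ x, Pt (𝔛.X (Γ x)), Agrees ε e g →
      ∃ y' : Pt (𝔛.X i), (y' : ZFSet.{u}) = g ⟨i, y⟩ ∧
        t.HasValue 𝔛.toPartialStructure e y' := by
  have hp := fun i => (hπ.space i).isPreinterpretation
  induction t with
  | var x =>
    refine Reflectable.of_forall hs fun g e he => ⟨e x, ?_, rfl⟩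
    obtain rfl : y = ε x := hy
    exact he x
  | app k t ih =>
    obtain ⟨b, hb, hyb⟩ := hy
    refine ((Reflectable.forall_fin hs fun m => ih m (hb m)).and hs
      (Reflectable.mem_fn hs hp (h𝔛.space _).hausdorff (h𝔛.fn_mem k) (h𝔛.fn_subset k)
        (fun _ hx => (ZFSet.mem_sep.1 hx).2) (h𝔛.fn_continuous k) (hπ.fn_continuous k)
        (hπ.fn_domain k) (hπ.fn_commutes k) hyb)).mono ?_
    rintro g ⟨hg, hgf⟩ e he
    choose a ha hae using fun m => hg m e he
    refine ⟨⟨_, (ZFSet.pair_mem_prod.1 (h𝔛.fn_subset k hgf)).2⟩, rfl, a, hae, ?_⟩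
    rw [mem_fn_iff h𝔛, ptTuple_eq_of_coe_eq ha]
    exact hgf

/-- Either a subterm is undefined, or the arguments have values and their tuple lies outside the
Borel domain; both situations are reflected. -/
theorem Term.reflectable_undefined (h𝔛 : 𝔛.IsInterpretableIn M)
    (hs : ∀ i z, (s i).Point (trace (𝔛.τ i) (op i) z))
    (hπ : 𝔛.IsInterpretation M Xhat 𝔛hat pt op) {i : S.Srt} (t : Term S Γ i)
    (ht : ¬ ∃ y, t.HasValue 𝔛hat ε y) :
    Reflectable s op fun g => ∀ e : ∀ x, Pt (𝔛.X (Γ x)), Agrees ε e g →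
      ¬ ∃ y, t.HasValue 𝔛.toPartialStructure e y := by
  have hp := fun i => (hπ.space i).isPreinterpretation
  induction t with
  | var x => exact absurd ⟨ε x, rfl⟩ ht
  | app k t ih =>
    by_cases h : ∀ m, ∃ y, (t m).HasValue 𝔛hat ε y
    · choose b hb using h
      have hbD : b ∉ (𝔛hat.fn k).Dom := fun hbD => by
        obtain ⟨y, hy⟩ := Part.dom_iff_mem.1 hbD
        exact ht ⟨y, b, hb, hy⟩
      refine ((Reflectable.forall_fin hs fun m => (t m).reflectable_hasValue h𝔛 hs hπ (hb m)).and
        hs (Reflectable.notMem_borel hs hp (hπ.fn_domain k) hbD)).mono ?_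
      rintro g ⟨hg, hgD⟩ e he ⟨y, a, hae, hy⟩
      rw [mem_fn_iff h𝔛, ptTuple_eq_of_coe_eq (w := b) (g := g) fun m => ?_] at hy
      · exact hgD (ZFSet.mem_sep.2 ⟨(ZFSet.pair_mem_prod.1 (h𝔛.fn_subset k hy)).1, y, hy⟩)
      · obtain ⟨y', hy', h⟩ := hg m e he
        rw [(hae m).unique h, hy']
    · push Not at h
      obtain ⟨m, hm⟩ := h
      refine (ih m fun ⟨y, hy⟩ => hm y hy).mono ?_
      rintro g hg e he ⟨y, a, hae, hy⟩
      exact hg e he ⟨a m, hae m⟩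

/-- The truth value itself is reflected, whichever it is, so negation costs nothing. A false atomic
formula is false for a reflected reason: an undefined term, distinct values, or a tuple outside the
relation. -/
theorem QFFormula.reflectable (h𝔛 : 𝔛.IsInterpretableIn M)
    (hs : ∀ i z, (s i).Point (trace (𝔛.τ i) (op i) z))
    (hπ : 𝔛.IsInterpretation M Xhat 𝔛hat pt op) (φ : QFFormula S Γ) :
    Reflectable s op fun g => ∀ e : ∀ x, Pt (𝔛.X (Γ x)), Agrees ε e g →
      (φ.Holds 𝔛.toPartialStructure e ↔ φ.Holds 𝔛hat ε) := by
  have hp := fun i => (hπ.space i).isPreinterpretation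
  induction φ with
  | falsum => exact Reflectable.of_forall hs fun g e _ => Iff.rfl
  | eq t t' =>
    by_cases ht : ∃ y, t.HasValue 𝔛hat ε y
    · by_cases ht' : ∃ y, t'.HasValue 𝔛hat ε y
      · obtain ⟨y, hy⟩ := ht
        obtain ⟨y', hy'⟩ := ht'
        have h := (t.reflectable_hasValue h𝔛 hs hπ hy).and hs
          (t'.reflectable_hasValue h𝔛 hs hπ hy')
        by_cases hyy : y = y'
        · subst hyy
          refine h.mono fun g hg e he => iff_of_true ?_ ⟨y, hy, hy'⟩
          obtain ⟨z, hz, hzt⟩ := hg.1 e he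
          obtain ⟨z', hz', hzt'⟩ := hg.2 e he
          obtain rfl : z = z' := Subtype.ext (hz.trans hz'.symm)
          exact ⟨z, hzt, hzt'⟩
        · refine (h.and hs (Reflectable.ne hs hp hyy)).mono fun g hg e he => iff_of_false ?_ ?_
          · rintro ⟨x, hx, hx'⟩
            obtain ⟨z, hz, hzt⟩ := hg.1.1 e he
            obtain ⟨z', hz', hzt'⟩ := hg.1.2 e he
            refine hg.2 ?_
            rw [← hz, ← hz', ← hx.unique hzt, ← hx'.unique hzt']
          · rintro ⟨x, hx, hx'⟩
            exact hyy ((hy.unique hx).trans (hx'.unique hy'))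
      · refine (t'.reflectable_undefined h𝔛 hs hπ ht').mono fun g hg e he => iff_of_false ?_ ?_
        · rintro ⟨x, -, hx⟩
          exact hg e he ⟨x, hx⟩
        · rintro ⟨x, -, hx⟩
          exact ht' ⟨x, hx⟩
    · refine (t.reflectable_undefined h𝔛 hs hπ ht).mono fun g hg e he => iff_of_false ?_ ?_
      · rintro ⟨x, hx, -⟩
        exact hg e he ⟨x, hx⟩
      · rintro ⟨x, hx, -⟩
        exact ht ⟨x, hx⟩
  | rel j t =>
    by_cases ht : ∀ m, ∃ y, (t m).HasValue 𝔛hat ε y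
    · choose b hb using ht
      have h := Reflectable.forall_fin hs fun m => (t m).reflectable_hasValue h𝔛 hs hπ (hb m)
      by_cases hbR : b ∈ 𝔛hat.rel j
      · refine (h.and hs (Reflectable.mem_borel hs hp (hπ.rel j) hbR)).mono fun g hg e he =>
          iff_of_true ?_ ⟨b, hb, hbR⟩
        choose a ha hae using fun m => hg.1 m e he
        refine ⟨a, hae, ?_⟩
        change ptTuple a ∈ 𝔛.R j
        rw [ptTuple_eq_of_coe_eq ha]
        exact hg.2
      · refine (h.and hs (Reflectable.notMem_borel hs hp (hπ.rel j) hbR)).mono fun g hg e he =>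
          iff_of_false ?_ ?_
        · rintro ⟨a, hae, haR⟩
          refine hg.2 ?_
          rw [← ptTuple_eq_of_coe_eq (a := a) fun m => ?_]
          · exact haR
          · obtain ⟨y', hy', h⟩ := hg.1 m e he
            rw [(hae m).unique h, hy']
        · rintro ⟨b', hb', hR⟩
          obtain rfl : b = b' := funext fun m => (hb m).unique (hb' m)
          exact hbR hR
    · push Not at ht
      obtain ⟨m, hm⟩ := ht
      refine ((t m).reflectable_undefined h𝔛 hs hπ fun ⟨y, hy⟩ => hm y hy).mono fun g hg e he =>
        iff_of_false ?_ ?_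
      · rintro ⟨a, hae, -⟩
        exact hg e he ⟨a m, hae m⟩
      · rintro ⟨b, hb, -⟩
        exact hm _ (hb m)
  | neg φ ih => exact ih.mono fun g hg e he => not_congr (hg e he)
  | conj φ ψ ih ih' =>
    exact (ih.and hs ih').mono fun g hg e he => and_congr (hg.1 e he) (hg.2 e he)

end Formulas

end AnalyticAbs

open AnalyticAbs

/-! ### Σ₁-elementarity -/

theorem mainTheorem5 (M : Set ZFSet.{u}) (hM : IsTransitiveModel M)
    (S : Signature.{w₁, w₂, w₃}) (𝔛 : SetStructure.{u} S) (h𝔛 : 𝔛.IsInterpretableIn M)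
    (Xhat : S.Srt → Type u) [∀ i, TopologicalSpace (Xhat i)] (𝔛hat : PartialStructure S Xhat)
    (pt : ∀ i, Pt (𝔛.X i) → Xhat i) (op : ∀ i, ZFSet.{u} → Set (Xhat i))
    (hπ : 𝔛.IsInterpretation M Xhat 𝔛hat pt op) :
    IsSigma1Elementary 𝔛.toPartialStructure 𝔛hat pt := by
  have : Fact (IsTransitiveModel M) := ⟨hM⟩
  have hp := fun i => (hπ.space i).isPreinterpretation
  choose s hs using fun i => exists_sieve (h𝔛.space i)
  have hs' : ∀ i z, (s i).Point (trace (𝔛.τ i) (op i) z) := fun i => hs i _ _ _ (hp i)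
  have hpt : ∀ {i} (x : Pt (𝔛.X i)), Reflectable s op fun g => g ⟨i, pt i x⟩ = x := fun {i} x =>
    Reflectable.eq_point hs' hp (h𝔛.space i).isTopology (h𝔛.space i).hausdorff x
  intro n m Γ Δ ψ x
  constructor
  · rintro ⟨y, hy⟩
    -- Parameters and witnesses all come from `M`, and reflection returns each of them unchanged.
    obtain ⟨g, hg, hgx, hgy⟩ := ((ψ.reflectable h𝔛 hs' hπ
      (ε := assign (fun k => pt (Γ k) (x k)) fun k => pt (Δ k) (y k))).and hs'
      ((Reflectable.forall_fin hs' fun k => hpt (x k)).and hs'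
      (Reflectable.forall_fin hs' fun k => hpt (y k)))).exists_assignment hs'
    refine ⟨_, (hg (assign (A := fun i => Pt (𝔛.X i)) x y) ?_).1 hy⟩
    rintro (k | k)
    · exact (hgx k).symm
    · exact (hgy k).symm
  · rintro ⟨y, hy⟩
    -- Only the parameters are held fixed; the witnesses in `𝔛hat` reflect to some points of the
    -- spaces of `M`.
    obtain ⟨g, hg, hgx, hgy⟩ := ((ψ.reflectable h𝔛 hs' hπ
      (ε := assign (fun k => pt (Γ k) (x k)) y)).and hs'
      ((Reflectable.forall_fin hs' fun k => hpt (x k)).and hs'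
      (Reflectable.forall_fin hs' fun k => Reflectable.mem_space hs' hp (y k)))).exists_assignment
      hs'
    refine ⟨fun k => ⟨_, hgy k⟩, (hg (assign (A := fun i => Pt (𝔛.X i)) x
      fun k => ⟨_, hgy k⟩) ?_).2 hy⟩
    rintro (k | k)
    · exact (hgx k).symm
    · rfl
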